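/- Let $K$ be a field and $r \ge 0$, $d \ge 1$ integers. Let $R = K[\partial_1,\dots,\partial_r]$ be the graded polynomial ring, and let $\mathcal R = K[x_1,\dots,x_r]^{DP}$ be the divided power ring with $K$-basis the monomials $x^{[\alpha]}$, $\alpha \in \mathbb N_0^r$; $\mathcal R_d$ is the span of the $x^{[\alpha]}$ with $|\alpha| = d$. $R$ acts $K$-linearly on $\mathcal R$ by $\partial^\beta(x^{[\alpha]}) = x^{[\alpha-\beta]}$ if $\beta \le \alpha$ componentwise, and $0$ otherwise. For $f \in \mathcal R_d$ put $\operatorname{ann}_R(f) = \{D \in R : D(f) = 0\}$, $\operatorname{ann}_R(f)_e = \operatorname{ann}_R(f) \cap R_e$, $R_e(f) = \{D(f) : D \in R_e\}$ and $$M_f = \{A \in \mathrm{Mat}_K(r,r) : I_2(\partial\ A\partial) \subseteq \operatorname{ann}_R(f)\},$$ where $\partial = (\partial_1,\dots,\partial_r)^T$ and $I_2(\partial\ A\partial)$ is the ideal generated by the $2\times 2$ minors of the $r \times 2$ matrix with columns $\partial$ and $A\partial$. One says that $f \in \mathcal R_d$ splits regularly $m-1$ times if $f = g_1 + \dots + g_m$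 with non-zero $g_1,\dots,g_m \in \mathcal R_d$ such that $R_{d-1}(g_i) \cap \sum_{j\ne i} R_{d-1}(g_j) = 0$ for all $i$. The same definitions are used over every field; $\mathcal R_d[t_1,\dots,t_n]$ denotes the forms of degree $d$ in $K[t_1,\dots,t_n][x_1,\dots,x_r]^{DP}$. **Theorem.** Assume that $r \le 4$, that $K$ is algebraically closed and that $d \ge 3$. Let $f \in \mathcal R_d$ satisfy $\operatorname{ann}_R(f)_1 = 0$. Then for some $n \ge 1$ there exists $f_t \in \mathcal R_d[t_1,\dots,t_n]$ such that $f_0 = f$ (where $f_0$ is obtained by setting $t_1 = \dots = t_n = 0$) and $f_t$ splits regularly $\dim_K M_f - 1$ times over $K(t_1,\dots,t_n)$, i.e. as a form of degree $d$ in $K(t_1,\dots,t_n)[x_1,\dots,x_r]^{DP}$. -/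

import Mathlib

noncomputable section

namespace RegularSplitting

/-- The underlying module of the divided power ring `k[x_1, …, x_r]^{DP}`: finite `k`-linear
combinations of the divided power monomials `x^[α]`, where `α` runs over the exponent vectors.
The monomial `x^[α]` is `Finsupp.single α 1`. (The multiplication of the ring is not needed.) -/
abbrev DPoly (r : ℕ) (k : Type*) [CommRing k] : Type _ := (Fin r →₀ ℕ) →₀ k

section Basics

variable {r : ℕ} {k : Type*} [CommRing k]

variable (r k) in
/-- The forms of degree `d`, i.e. the span of the monomials `x^[α]` with `|α| = d`. -/
def forms (d : ℕ) : Submodule k (DPoly r k) :=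
  Finsupp.supported k k {α : Fin r →₀ ℕ | α.degree = d}

/-- The action of the monomial `∂^β`: it sends `x^[α]` to `x^[α - β]` if `β ≤ α`, and to `0`
otherwise. -/
def contractMonomial (β : Fin r →₀ ℕ) : DPoly r k →ₗ[k] DPoly r k :=
  Finsupp.lsum k fun α =>
    open Classical in if β ≤ α then Finsupp.lsingle (α - β) else 0

/-- The action of the polynomial ring `R = k[∂_1, …, ∂_r]` on divided power polynomials:
`contract D f` is `D(f)`. -/
def contract : MvPolynomial (Fin r) k →ₗ[k] DPoly r k →ₗ[k] DPoly r k :=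
  (MvPolynomial.basisMonomials (Fin r) k).constr k contractMonomial

theorem contract_monomial_one (β : Fin r →₀ ℕ) :
    contract (MvPolynomial.monomial β (1 : k)) = contractMonomial β := by
  have h := (MvPolynomial.basisMonomials (Fin r) k).constr_basis k
    (contractMonomial (r := r) (k := k)) β
  simpa [contract] using h

theorem contractMonomial_apply (β : Fin r →₀ ℕ) (f : DPoly r k) (γ : Fin r →₀ ℕ) :
    contractMonomial β f γ = f (γ + β) := by
  classical
  induction f using Finsupp.induction_linear with
  | zero => simp
  | add f g hf hg => simp [hf, hg]
  | single α c =>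
    simp only [contractMonomial, Finsupp.lsum_single]
    split_ifs with h
    · have e : α - β = γ ↔ α = γ + β := by
        constructor
        · rintro rfl
          exact (tsub_add_cancel_of_le h).symm
        · rintro rfl
          simp
      simp [Finsupp.single_apply, e]
    · have e : α ≠ γ + β := by
        rintro rfl
        exact h le_add_self
      simp [e]

theorem contractMonomial_add (β γ : Fin r →₀ ℕ) (f : DPoly r k) :
    contractMonomial (β + γ) f = contractMonomial β (contractMonomial γ f) := by
  ext δ
  simp [contractMonomial_apply, add_assoc]

theorem contract_monomial (β : Fin r →₀ ℕ) (c : k) :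
    contract (MvPolynomial.monomial β c) = c • contractMonomial β := by
  rw [← contract_monomial_one, ← map_smul, MvPolynomial.smul_monomial, smul_eq_mul, mul_one]

theorem contract_mul (D E : MvPolynomial (Fin r) k) (f : DPoly r k) :
    contract (D * E) f = contract D (contract E f) := by
  induction D using MvPolynomial.induction_on' with
  | add p q hp hq => simp [add_mul, hp, hq]
  | monomial β c =>
    induction E using MvPolynomial.induction_on' with
    | add p q hp hq => simp [mul_add, hp, hq]
    | monomial γ e =>
      simp [MvPolynomial.monomial_mul, contract_monomial, contractMonomial_add, smul_smul, mul_comm]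

/-- The annihilator ideal `ann_R(f) = {D ∈ R | D(f) = 0}`. -/
def ann (f : DPoly r k) : Ideal (MvPolynomial (Fin r) k) where
  carrier := {D | contract D f = 0}
  add_mem' {D E} hD hE := by
    simp only [Set.mem_ofPred_eq] at *
    simp [hD, hE]
  zero_mem' := by simp
  smul_mem' D E hE := by
    simp only [Set.mem_ofPred_eq] at *
    simp [contract_mul, hE]

/-- The degree `e` part `ann_R(f)_e = ann_R(f) ∩ R_e`. -/
def annDeg (f : DPoly r k) (e : ℕ) : Submodule k (MvPolynomial (Fin r) k) :=
  (ann f).restrictScalars k ⊓ MvPolynomial.homogeneousSubmodule (Fin r) k e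

/-- The module `R_e(f) = {D(f) | D ∈ R_e}`. -/
def contractions (e : ℕ) (f : DPoly r k) : Submodule k (DPoly r k) :=
  (MvPolynomial.homogeneousSubmodule (Fin r) k e).map (contract.flip f)

/-- The ideal `I_s(B)` generated by the `s × s` minors of a matrix `B`. (Selections of rows or
columns with repetitions only add zeros, and reorderings only change signs.) -/
def minorIdeal {S m n : Type*} [CommRing S] (s : ℕ) (B : Matrix m n S) : Ideal S :=
  Ideal.span {q | ∃ (a : Fin s → m) (b : Fin s → n), q = (B.submatrix a b).det}

variable (r k) in
/-- The column vector `∂ = (∂_1, …, ∂_r)`. -/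
def del : Fin r → MvPolynomial (Fin r) k := fun i => MvPolynomial.X i

/-- The vector `A∂`. -/
def mulDel (A : Matrix (Fin r) (Fin r) k) : Fin r → MvPolynomial (Fin r) k :=
  (A.map MvPolynomial.C).mulVec (del r k)

/-- The `r × 2` matrix `(∂ A∂)`. -/
def delMatrix (A : Matrix (Fin r) (Fin r) k) : Matrix (Fin r) (Fin 2) (MvPolynomial (Fin r) k) :=
  Matrix.of fun i => ![del r k i, mulDel A i]

theorem mulDel_add (A B : Matrix (Fin r) (Fin r) k) : mulDel (A + B) = mulDel A + mulDel B := by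
  ext1 i
  simp [mulDel, Matrix.mulVec, dotProduct, add_mul, Finset.sum_add_distrib]

theorem mulDel_smul (c : k) (A : Matrix (Fin r) (Fin r) k) :
    mulDel (c • A) = (MvPolynomial.C c : MvPolynomial (Fin r) k) • mulDel A := by
  ext1 i
  simp [mulDel, Matrix.mulVec, dotProduct, Finset.mul_sum, mul_assoc]

theorem minorIdeal_delMatrix_le_iff (A : Matrix (Fin r) (Fin r) k)
    (J : Ideal (MvPolynomial (Fin r) k)) :
    minorIdeal 2 (delMatrix A) ≤ J ↔
      ∀ i j, del r k i * mulDel A j - del r k j * mulDel A i ∈ J := by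
  rw [minorIdeal, Ideal.span_le]
  constructor
  · intro h i j
    apply h
    refine ⟨![i, j], ![0, 1], ?_⟩
    rw [Matrix.det_fin_two]
    simp [delMatrix, mul_comm]
  · rintro h _ ⟨a, b, rfl⟩
    rw [SetLike.mem_coe, Matrix.det_fin_two]
    have key : ∀ u v : Fin 2, ∀ i j : Fin r,
        delMatrix A i u * delMatrix A j v - delMatrix A i v * delMatrix A j u ∈ J := by
      intro u v i j
      have h1 := h i j
      have h2 := h j i
      fin_cases u <;> fin_cases v <;> simp [delMatrix, mul_comm] at h1 h2 ⊢ <;> assumption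
    exact key (b 0) (b 1) (a 0) (a 1)

/-- `M_f = {A ∈ Mat_k(r, r) | I_2(∂ A∂) ⊆ ann_R(f)}`, as a `k`-subspace of `Mat_k(r, r)`. -/
def matrixSpace (f : DPoly r k) : Submodule k (Matrix (Fin r) (Fin r) k) where
  carrier := {A | minorIdeal 2 (delMatrix A) ≤ ann f}
  add_mem' {A B} hA hB := by
    simp only [Set.mem_ofPred_eq, minorIdeal_delMatrix_le_iff] at *
    intro i j
    have h := (ann f).add_mem (hA i j) (hB i j)
    rw [mulDel_add]
    convert h using 1
    simp only [Pi.add_apply]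
    ring
  zero_mem' := by
    simp only [Set.mem_ofPred_eq, minorIdeal_delMatrix_le_iff]
    intro i j
    have h : mulDel (0 : Matrix (Fin r) (Fin r) k) = 0 := by
      simpa using mulDel_smul (0 : k) (0 : Matrix (Fin r) (Fin r) k)
    simp [h]
  smul_mem' c A hA := by
    simp only [Set.mem_ofPred_eq, minorIdeal_delMatrix_le_iff] at *
    intro i j
    have h := (ann f).mul_mem_left (MvPolynomial.C c) (hA i j)
    rw [mulDel_smul]
    convert h using 1
    simp only [Pi.smul_apply, smul_eq_mul]
    ring

/-- `f = g_1 + … + g_m` is a regular splitting of the degree `d` form `f`: the `g_i` are non-zero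
forms of degree `d` and the subspaces `R_{d-1}(g_i)` of the space of linear forms satisfy
`R_{d-1}(g_i) ∩ ∑_{j ≠ i} R_{d-1}(g_j) = 0` for all `i`. -/
structure IsRegularSplitting (d : ℕ) (f : DPoly r k) {m : ℕ} (g : Fin m → DPoly r k) : Prop where
  mem_forms : ∀ i, g i ∈ forms r k d
  ne_zero : ∀ i, g i ≠ 0
  sum_eq : f = ∑ i, g i
  indep : ∀ i, contractions (d - 1) (g i) ⊓ ⨆ j ≠ i, contractions (d - 1) (g j) = ⊥

/-- The degree `d` form `f` has a regular splitting of length `m`, i.e. `f` splits regularly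
`m - 1` times. -/
def HasRegularSplitting (d : ℕ) (f : DPoly r k) (m : ℕ) : Prop :=
  ∃ g : Fin m → DPoly r k, IsRegularSplitting d f g

/-- Change of coefficients along a ring homomorphism. -/
def mapCoeff {l : Type*} [CommRing l] (φ : k →+* l) (f : DPoly r k) : DPoly r l :=
  Finsupp.mapRange φ φ.map_zero f

end Basics

/-- The field of rational functions `K(t_1, …, t_n)`. -/
abbrev RatFunField (n : ℕ) (K : Type*) [Field K] : Type _ := FractionRing (MvPolynomial (Fin n) K)

section Families

variable {r n : ℕ} {K : Type*} [Field K]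

/-- The specialization `f_0` of `f_t` at `t_1 = … = t_n = 0`. -/
def specializeZero (ft : DPoly r (MvPolynomial (Fin n) K)) : DPoly r K :=
  mapCoeff (MvPolynomial.eval (0 : Fin n → K)) ft

/-- A polynomial family `f_t`, regarded as a divided power polynomial over `K(t_1, …, t_n)`. -/
def generic (ft : DPoly r (MvPolynomial (Fin n) K)) : DPoly r (RatFunField n K) :=
  mapCoeff (algebraMap (MvPolynomial (Fin n) K) (RatFunField n K)) ft

end Families

end RegularSplitting

end

open RegularSplitting

/-!
Let `f` be a form of degree `d ≥ 3` that is not annihilated by a linear form in the `∂_i`. Such an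
`f` defines a symmetric multilinear form on the space `V` of linear forms in the `∂_i`, and `M_f`
is, up to transposition, the space `Z` of the endomorphisms of `V` that are self-adjoint for it
(`mem_matrixSpace_iff_balanced`). Since `d ≥ 3`, two such endomorphisms can be moved past each other
through three arguments of the multilinear form, so `Z` is a commutative algebra
(`Balanced.mul_comm`, `centre`). An element of `Z` with `m` distinct eigenvalues, annihilated by the
product of the corresponding linear factors, splits `f` regularly into `m` summands by its spectral
projections (`hasRegularSplitting_of_diagonalizable`). It therefore suffices to deform `f` together
with a suitable element of `Z` such that this element acquires `dim Z` distinct eigenvalues.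

If `Z` is generated by one element `a`, then `V` is a direct sum of modules
`K[X] / (X - μ_j) ^ n_j`, and `dim Z` is the degree of the minimal polynomial of `a`. All modules
`K[X] / (X - μ_j) ^ n_j` are deformed at once by replacing `(X - μ_j) ^ n_j` with
`∏_{i < n_j} (X - μ_j - c_i t)`, with the same distinct constants `c_i` for all `j`. The polynomial
ring `K[t][X][e_j]` carries a functional that depends on `e^β` modulo the deformed annihilators of
the `e_j` occurring in it and equals `f` at `t = 0`. Evaluating it at products of lifts of a
basis of `V` gives the required family of forms (`deformsToSplitting_natDegree_minpoly`).

It remains to see which algebras `Z` need more than one generator. Generation by one element can be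
checked on the local factors of `Z` (`isMonogenicAt_of_local`). On a local factor that acts on a
space of dimension at most three, some nilpotent element has the maximal order of nilpotency, and
then it generates, or all nilpotent elements have rank at most one, and then they are proportional
because `f` is nondegenerate (`Balanced.exists_eq_smul`). So `Z` is generated by one element unless
`r = 4` and `Z` is local, where two exceptions remain.

* `Z` has a basis `1, x, y, xy` with `x² = 0` and `y² = c xy`. Then `V` is a free `Z`-module of rank
  one, and `Z` is deformed to the algebra of functions on four points (`deformsToSplitting_four`).
* `Z` has a basis `1, a, b` with `a² = ab = b² = 0`, and `V` has a basis `e, v, a e, a v` with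
  `b e = a v`, `b v = τ a v`. Then `f` is the sum of a form in two variables and of a form that is
  computed in the algebra with relations `x² = τ x`, `y² = 0`. The latter is deformed by the
  relations `x² = (τ + t) x`, `y² = t y`, while the former stays fixed
  (`deformsToSplitting_three`).

In every family constructed here the parameter is one variable `t`, and nondegeneracy passes to the
generic member because it is an open condition (`Nondegenerate.of_specialization`).
-/

noncomputable section

namespace RegularSplitting

open Polynomial

universe u

/-! ### The symmetric multilinear form attached to a form -/

section Pairing

variable {r : ℕ} {k : Type*} [CommRing k]

/-- The `k`-linear functional `D ↦ D(f)(0)` on the polynomial ring attached to `f`. Its value at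
the monomial `∂^α` is the coefficient of `x^[α]` in `f`. -/
def pairing (f : DPoly r k) : MvPolynomial (Fin r) k →ₗ[k] k :=
  Finsupp.lapply 0 ∘ₗ contract.flip f

theorem contract_apply (D : MvPolynomial (Fin r) k) (f : DPoly r k) (γ : Fin r →₀ ℕ) :
    contract D f γ = pairing f (D * MvPolynomial.monomial γ 1) := by
  rw [mul_comm]
  simp [pairing, contract_mul, contract_monomial, contractMonomial_apply]

theorem pairing_monomial (f : DPoly r k) (β : Fin r →₀ ℕ) (c : k) :
    pairing f (MvPolynomial.monomial β c) = c * f β := by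
  simp [pairing, contract_monomial, contractMonomial_apply]

theorem pairing_eq_zero_of_contract {f : DPoly r k} {D : MvPolynomial (Fin r) k}
    (h : contract D f = 0) (E : MvPolynomial (Fin r) k) : pairing f (D * E) = 0 := by
  rw [mul_comm]
  simp [pairing, contract_mul, h]

theorem contract_eq_zero_iff {f : DPoly r k} {D : MvPolynomial (Fin r) k} :
    contract D f = 0 ↔ ∀ E, pairing f (D * E) = 0 :=
  ⟨pairing_eq_zero_of_contract, fun h => Finsupp.ext fun γ => by simp [contract_apply, h]⟩

theorem mem_forms {d : ℕ} {f : DPoly r k} :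
    f ∈ forms r k d ↔ ∀ α : Fin r →₀ ℕ, α.degree ≠ d → f α = 0 := by
  rw [forms, Finsupp.mem_supported']
  rfl

/-- The linear form `∑ v_i ∂_i` attached to a vector `v`. -/
def lin : (Fin r → k) →ₗ[k] MvPolynomial (Fin r) k :=
  Fintype.linearCombination k (MvPolynomial.X : Fin r → MvPolynomial (Fin r) k)

theorem lin_apply (v : Fin r → k) :
    lin v = ∑ i, v i • (MvPolynomial.X i : MvPolynomial (Fin r) k) :=
  rfl

theorem lin_single (i : Fin r) : lin (Pi.single i (1 : k)) = MvPolynomial.X i := by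
  simp [lin, Fintype.linearCombination_apply_single]

theorem mulDel_eq_lin (A : Matrix (Fin r) (Fin r) k) (j : Fin r) : mulDel A j = lin (A j) := by
  simp [mulDel, lin_apply, Matrix.mulVec, dotProduct, del, MvPolynomial.smul_eq_C_mul]

theorem pairing_lin_mul_monomial (f : DPoly r k) (v : Fin r → k) (γ : Fin r →₀ ℕ) :
    pairing f (lin v * MvPolynomial.monomial γ 1) = ∑ x, v x * f (γ + Finsupp.single x 1) := by
  simp only [lin_apply, Finset.sum_mul, map_sum, smul_mul_assoc, map_smul, MvPolynomial.X,
    MvPolynomial.monomial_mul, pairing_monomial, smul_eq_mul, one_mul, add_comm γ]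

theorem mem_matrixSpace_iff {f : DPoly r k} {A : Matrix (Fin r) (Fin r) k} :
    A ∈ matrixSpace f ↔ ∀ i j (E : MvPolynomial (Fin r) k),
      pairing f (MvPolynomial.X i * lin (A j) * E) =
        pairing f (MvPolynomial.X j * lin (A i) * E) := by
  change minorIdeal 2 (delMatrix A) ≤ ann f ↔ _
  rw [minorIdeal_delMatrix_le_iff]
  refine forall₂_congr fun i j => ?_
  change contract _ f = 0 ↔ _
  rw [contract_eq_zero_iff]
  simp [mulDel_eq_lin, del, sub_mul, sub_eq_zero]

theorem mem_matrixSpace_iff_coeff {f : DPoly r k} {A : Matrix (Fin r) (Fin r) k} :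
    A ∈ matrixSpace f ↔ ∀ i j (γ : Fin r →₀ ℕ),
      ∑ l, A j l * f (γ + Finsupp.single i 1 + Finsupp.single l 1) =
        ∑ l, A i l * f (γ + Finsupp.single j 1 + Finsupp.single l 1) := by
  have key : ∀ (i j : Fin r) (γ : Fin r →₀ ℕ),
      pairing f (MvPolynomial.X i * lin (A j) * MvPolynomial.monomial γ 1) =
        ∑ l, A j l * f (γ + Finsupp.single i 1 + Finsupp.single l 1) := by
    intro i j γ
    rw [mul_right_comm, mul_comm, MvPolynomial.X, MvPolynomial.monomial_mul, one_mul, add_comm,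
      pairing_lin_mul_monomial]
  rw [mem_matrixSpace_iff]
  refine forall₂_congr fun i j => ⟨fun h γ => ?_, fun h E => ?_⟩
  · rw [← key, h, key]
  · induction E using MvPolynomial.induction_on' with
    | add p q hp hq => simp [mul_add, hp, hq]
    | monomial γ c =>
      have h1 : MvPolynomial.monomial γ c = c • MvPolynomial.monomial γ (1 : k) := by
        simp [MvPolynomial.smul_monomial]
      rw [h1, mul_smul_comm, mul_smul_comm, map_smul, map_smul, key, key, h]

/-- `f` is nondegenerate: no nonzero linear form in the `∂_i` annihilates `f`. -/
def Nondegenerate (f : DPoly r k) : Prop :=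
  ∀ v : Fin r → k, (∀ γ : Fin r →₀ ℕ, ∑ x, v x * f (γ + Finsupp.single x 1) = 0) → v = 0

theorem nondegenerate_of_annDeg_eq_bot {f : DPoly r k} (h : annDeg f 1 = ⊥) :
    Nondegenerate f := by
  intro v hv
  have h1 : lin v ∈ annDeg f 1 := by
    refine ⟨?_, ?_⟩
    · change contract (lin v) f = 0
      ext γ
      rw [contract_apply, pairing_lin_mul_monomial, hv]
      rfl
    · rw [lin_apply]
      exact Submodule.sum_mem _ fun i _ => Submodule.smul_mem _ _ (MvPolynomial.isHomogeneous_X _ _)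
  rw [h, Submodule.mem_bot] at h1
  ext i
  have h2 := congrArg (MvPolynomial.coeff (Finsupp.single i 1)) h1
  simpa [lin_apply, MvPolynomial.coeff_sum, MvPolynomial.coeff_X, Finsupp.single_left_inj]
    using h2

end Pairing

/-! ### Forms given by a functional on an algebra -/

section FormOf

variable {r : ℕ} {k S : Type*} [CommRing k] [CommRing S] [Algebra k S]

/-- The form of degree `d` whose coefficient at `x^[α]` is `Φ(∏ p_i ^ α_i)`, for elements `p_i` of
a commutative algebra and a linear functional `Φ` on that algebra. -/
def formOf (d : ℕ) (Φ : S →ₗ[k] k) (p : Fin r → S) : DPoly r k :=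
  Finsupp.indicator (Finset.univ.finsuppAntidiag d) fun α _ => Φ (∏ x, p x ^ α x)

open Classical in
theorem formOf_apply (d : ℕ) (Φ : S →ₗ[k] k) (p : Fin r → S) (α : Fin r →₀ ℕ) :
    formOf d Φ p α = if α.degree = d then Φ (∏ x, p x ^ α x) else 0 := by
  have : α ∈ (Finset.univ : Finset (Fin r)).finsuppAntidiag d ↔ α.degree = d := by
    simp [Finsupp.degree_eq_sum]
  simp only [formOf, Finsupp.indicator_apply, this, dite_eq_ite]

theorem formOf_mem_forms (d : ℕ) (Φ : S →ₗ[k] k) (p : Fin r → S) : formOf d Φ p ∈ forms r k d :=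
  mem_forms.2 fun α hα => by rw [formOf_apply, if_neg hα]

theorem prod_pow_add_single (p : Fin r → S) (γ : Fin r →₀ ℕ) (x : Fin r) :
    ∏ y, p y ^ ((γ + Finsupp.single x 1 : Fin r →₀ ℕ) y) = p x * ∏ y, p y ^ γ y := by
  classical
  simp only [Finsupp.add_apply, pow_add, Finset.prod_mul_distrib, mul_comm (p x)]
  congr 1
  rw [Finset.prod_eq_single x] <;> simp +contextual [eq_comm]

theorem formOf_add_single {d : ℕ} (Φ : S →ₗ[k] k) (p : Fin r → S) (γ : Fin r →₀ ℕ)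
    (x : Fin r) (h : γ.degree + 1 = d) :
    formOf d Φ p (γ + Finsupp.single x 1) = Φ (p x * ∏ y, p y ^ γ y) := by
  rw [formOf_apply, if_pos (by simp [h]), prod_pow_add_single]

theorem apply_add_single_eq_zero {d : ℕ} {f : DPoly r k} (hf : f ∈ forms r k d) {γ : Fin r →₀ ℕ}
    (h : γ.degree + 1 ≠ d) (x : Fin r) : f (γ + Finsupp.single x 1) = 0 :=
  mem_forms.1 hf _ (by simpa using h)

/-- If multiplication by `Z` on the span of the `p_x` is given by the matrix `A` up to terms
that `Φ` cannot see, then `A` belongs to the matrix space of `formOf d Φ p`. -/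
theorem mem_matrixSpace_formOf {d : ℕ} {Φ : S →ₗ[k] k} {p : Fin r → S} {Z : S}
    {A : Matrix (Fin r) (Fin r) k}
    (h : ∀ x s, Φ (Z * p x * s) = ∑ y, A x y * Φ (p y * s)) : A ∈ matrixSpace (formOf d Φ p) := by
  rw [mem_matrixSpace_iff_coeff]
  intro i j γ
  by_cases hd : γ.degree + 1 + 1 = d
  · have key : ∀ i j, ∑ l, A j l * formOf d Φ p (γ + Finsupp.single i 1 + Finsupp.single l 1) =
        Φ (Z * p j * (p i * ∏ y, p y ^ γ y)) := by
      intro i j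
      rw [h]
      refine Finset.sum_congr rfl fun l _ => ?_
      rw [formOf_add_single _ _ _ _ (by simpa using hd), prod_pow_add_single]
    rw [key, key]
    congr 1
    ring
  · have key : ∀ i l, formOf d Φ p (γ + Finsupp.single i 1 + Finsupp.single l 1) = 0 := fun i l =>
      apply_add_single_eq_zero (d := d) (formOf_mem_forms d Φ p) (by simpa using hd) l
    simp [key]

end FormOf

/-! ### A criterion for regular splittings -/

section Criteria

variable {r : ℕ} {L : Type*} [Field L]

/-- The linear form in `L[x_1, …, x_r]^{DP}` with a given coefficient vector. -/
def dpLin : (Fin r → L) →ₗ[L] DPoly r L :=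
  Fintype.linearCombination L fun x => Finsupp.single (Finsupp.single x 1) 1

theorem dpLin_apply_single (c : Fin r → L) (x : Fin r) : dpLin c (Finsupp.single x 1) = c x := by
  simp [dpLin, Fintype.linearCombination_apply, Finsupp.finsetSum_apply, Finsupp.single_apply,
    Finsupp.single_left_inj]

theorem dpLin_injective : Function.Injective (dpLin : (Fin r → L) →ₗ[L] DPoly r L) := by
  intro c c' h
  ext x
  rw [← dpLin_apply_single c, h, dpLin_apply_single]

theorem dpLin_apply_of_degree_ne_one (c : Fin r → L) {δ : Fin r →₀ ℕ} (h : δ.degree ≠ 1) :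
    dpLin c δ = 0 := by
  classical
  have : ∀ x : Fin r, Finsupp.single x 1 ≠ δ := by
    rintro x rfl
    simp at h
  simp [dpLin, Fintype.linearCombination_apply, Finsupp.finsetSum_apply, this]

theorem degree_eq_one {δ : Fin r →₀ ℕ} (h : δ.degree = 1) : ∃ x, δ = Finsupp.single x 1 := by
  obtain ⟨x, hx⟩ : ∃ x, δ x ≠ 0 := by
    by_contra! h0
    have : δ = 0 := Finsupp.ext h0
    simp [this] at h
  have h1 : δ - Finsupp.single x 1 + Finsupp.single x 1 = δ :=
    tsub_add_cancel_of_le (by simpa [Finsupp.single_le_iff] using Nat.one_le_iff_ne_zero.2 hx)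
  have h2 : (δ - Finsupp.single x 1).degree = 0 := by
    rw [← h1] at h
    simpa using h
  rw [Finsupp.degree_eq_zero_iff] at h2
  exact ⟨x, by rw [← h1, h2, zero_add]⟩

/-- The linear forms obtained from `g` are spanned by those whose coefficients are read off from `g`
at the neighbours `γ + e_x` of the exponent vectors `γ` of degree `d - 1`. -/
theorem contractions_le_map_dpLin {d : ℕ} (hd : 1 ≤ d) {g : DPoly r L} (hg : g ∈ forms r L d)
    {Y : Submodule L (Fin r → L)}
    (hY : ∀ γ : Fin r →₀ ℕ, γ.degree + 1 = d → (fun x => g (γ + Finsupp.single x 1)) ∈ Y) :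
    contractions (d - 1) g ≤ Y.map dpLin := by
  rintro _ ⟨D, hD, rfl⟩
  rw [D.as_sum, map_sum]
  refine Submodule.sum_mem _ fun γ hγ => ?_
  have hγ' : γ.degree + 1 = d := by
    have h1 : γ.degree = d - 1 := by
      rw [Finsupp.degree_eq_weight_one]
      exact hD (MvPolynomial.mem_support_iff.1 hγ)
    omega
  rw [LinearMap.flip_apply, contract_monomial]
  refine Submodule.smul_mem _ _ ⟨_, hY γ hγ', ?_⟩
  ext δ
  rw [contractMonomial_apply]
  by_cases hδ : δ.degree = 1
  · obtain ⟨x, rfl⟩ := degree_eq_one hδ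
    rw [dpLin_apply_single, add_comm]
  · rw [dpLin_apply_of_degree_ne_one _ hδ, mem_forms.1 hg]
    rw [map_add]
    omega

/-- A decomposition of a nondegenerate form is a regular splitting as soon as the linear forms
obtained from the summands lie in independent nonzero subspaces. A vanishing summand would leave a
proper subspace for the linear forms obtained from `f`. -/
theorem hasRegularSplitting_of_iSupIndep {d : ℕ} (hd : 1 ≤ d) {ι : Type*} [Fintype ι]
    {f : DPoly r L} (hf : Nondegenerate f) (g : ι → DPoly r L) (hg : ∀ i, g i ∈ forms r L d)
    (hsum : f = ∑ i, g i) (Y : ι → Submodule L (Fin r → L)) (hY : iSupIndep Y)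
    (hY0 : ∀ i, Y i ≠ ⊥)
    (hgY : ∀ i (γ : Fin r →₀ ℕ), γ.degree + 1 = d →
      (fun x => g i (γ + Finsupp.single x 1)) ∈ Y i) :
    HasRegularSplitting d f (Fintype.card ι) := by
  have hle : ∀ i, contractions (d - 1) (g i) ≤ (Y i).map dpLin := fun i =>
    contractions_le_map_dpLin hd (hg i) (hgY i)
  have hne : ∀ i, g i ≠ 0 := by
    intro i hi
    have hlt : (⨆ j ≠ i, Y j) ≠ ⊤ := by
      intro h
      have := hY i
      rw [h, disjoint_top] at this
      exact hY0 i this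
    obtain ⟨φ, hφ0, hφ⟩ := Submodule.exists_le_ker_of_lt_top _ (lt_top_iff_ne_top.2 hlt)
    have hval : ∀ w, φ w = ∑ x, φ (Pi.single x 1) * w x := by
      intro w
      conv_lhs => rw [pi_eq_sum_univ' w]
      simp [map_sum, mul_comm]
    have hz : (fun x => φ (Pi.single x 1)) = 0 := by
      apply hf
      intro γ
      by_cases hγ : γ.degree + 1 = d
      · rw [← hval fun x => f (γ + Finsupp.single x 1)]
        have : (fun x => f (γ + Finsupp.single x 1)) =
            ∑ j, fun x => g j (γ + Finsupp.single x 1) := by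
          ext x
          rw [hsum]
          simp [Finsupp.finsetSum_apply]
        rw [this, map_sum]
        refine Finset.sum_eq_zero fun j _ => ?_
        by_cases hj : j = i
        · subst hj
          rw [hi]
          exact map_zero φ
        · exact hφ (Submodule.mem_iSup_of_mem j (Submodule.mem_iSup_of_mem hj (hgY j γ hγ)))
      · refine Finset.sum_eq_zero fun x _ => ?_
        rw [hsum, Finsupp.finsetSum_apply, Finset.sum_eq_zero, mul_zero]
        exact fun j _ => apply_add_single_eq_zero (hg j) hγ x
    apply hφ0
    ext x
    simpa using congrFun hz x
  have hind : ∀ i, contractions (d - 1) (g i) ⊓ ⨆ j ≠ i, contractions (d - 1) (g j) = ⊥ := by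
    intro i
    rw [eq_bot_iff]
    refine (inf_le_inf (hle i) (iSup₂_mono fun j _ => hle j)).trans ?_
    simp_rw [← Submodule.map_iSup]
    rw [← Submodule.map_inf _ dpLin_injective, (disjoint_iff.1 (hY i)), Submodule.map_bot]
  let e := (Fintype.equivFin ι).symm
  refine ⟨fun n => g (e n), fun n => hg _, fun n => hne _, ?_, fun n => ?_⟩
  · rw [hsum]
    exact (e.sum_comp g).symm
  · rw [← hind (e n)]
    congr 1
    refine le_antisymm (iSup₂_le fun j hj => ?_) (iSup₂_le fun j hj => ?_)
    · exact le_iSup₂_of_le (e j) (fun h => hj (e.injective h)) le_rfl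
    · refine le_iSup₂_of_le (e.symm j) (fun h => hj ?_) (by simp)
      rw [← h]
      simp

end Criteria

/-! ### Balanced endomorphisms -/

section Balanced

variable {r : ℕ} {k : Type*} [CommRing k]

/-- An endomorphism `a` of the space of linear forms in the `∂_i` is balanced for `f` if it is
self-adjoint for the symmetric multilinear form attached to `f`. -/
def Balanced (f : DPoly r k) (a : Module.End k (Fin r → k)) : Prop :=
  ∀ v w E, pairing f (lin (a v) * lin w * E) = pairing f (lin v * lin (a w) * E)

theorem Balanced.one (f : DPoly r k) : Balanced f 1 := fun _ _ _ => rfl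

theorem Balanced.add {f : DPoly r k} {a b : Module.End k (Fin r → k)} (ha : Balanced f a)
    (hb : Balanced f b) : Balanced f (a + b) := fun v w E => by
  simp [add_mul, mul_add, ha v w E, hb v w E]

theorem Balanced.smul {f : DPoly r k} {a : Module.End k (Fin r → k)} (c : k) (ha : Balanced f a) :
    Balanced f (c • a) := fun v w E => by
  simp [ha v w E]

theorem Balanced.pow {f : DPoly r k} {a : Module.End k (Fin r → k)} (ha : Balanced f a) (n : ℕ) :
    Balanced f (a ^ n) := by
  induction n with
  | zero => exact Balanced.one f
  | succ n ih =>
    intro v w E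
    rw [pow_succ, Module.End.mul_apply, ih, ha, ← Module.End.mul_apply, ← pow_succ', pow_succ]

theorem Balanced.aeval {f : DPoly r k} {a : Module.End k (Fin r → k)} (ha : Balanced f a)
    (P : k[X]) : Balanced f (aeval a P) := by
  induction P using Polynomial.induction_on' with
  | add p q hp hq => rw [map_add]; exact hp.add hq
  | monomial n c => rw [aeval_monomial, ← Algebra.smul_def]; exact (ha.pow n).smul c

/-- The condition on `A` says that `X_i · A∂_j` and `X_j · A∂_i` agree under the pairing with `f`;
by linearity, this is self-adjointness of the transpose of `A`. -/
theorem mem_matrixSpace_iff_balanced {f : DPoly r k} {A : Matrix (Fin r) (Fin r) k} :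
    A ∈ matrixSpace f ↔ Balanced f (Matrix.toLin' A.transpose) := by
  have hA : ∀ i, Matrix.toLin' A.transpose (Pi.single i 1) = A i := fun i => by
    ext j
    simp
  rw [mem_matrixSpace_iff]
  constructor
  · intro h v w E
    rw [pi_eq_sum_univ' v, pi_eq_sum_univ' w]
    simp only [map_sum, map_smul, Finset.sum_mul, Finset.mul_sum, smul_mul_assoc, mul_smul_comm]
    refine Finset.sum_congr rfl fun i _ => ?_
    congr 1
    refine Finset.sum_congr rfl fun j _ => ?_
    rw [hA, hA, lin_single, lin_single, mul_comm (lin (A j)), h i j]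
  · intro h i j E
    have := h (Pi.single i 1) (Pi.single j 1) E
    rw [hA, hA, lin_single, lin_single] at this
    rw [← this, mul_comm (lin (A i))]

theorem aeval_mem_matrixSpace {f : DPoly r k} {A : Matrix (Fin r) (Fin r) k}
    (hA : A ∈ matrixSpace f) (P : k[X]) : aeval A P ∈ matrixSpace f := by
  rw [mem_matrixSpace_iff_balanced] at hA ⊢
  have : Matrix.toLin' (aeval A P).transpose = aeval (Matrix.toLin' A.transpose) P := by
    rw [aeval_eq_sum_range, aeval_eq_sum_range, Matrix.transpose_sum, map_sum]
    exact Finset.sum_congr rfl fun n _ => by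
      rw [Matrix.transpose_smul, map_smul, Matrix.transpose_pow, Matrix.toLin'_pow]
  rw [this]
  exact hA.aeval P

/-- Closed forms are exact: if `A` belongs to the matrix space of `f`, then there is a form `g`
with `∂g = A∂f`. -/
theorem exists_form_of_mem_matrixSpace {d : ℕ} {f : DPoly r k} (hf : f ∈ forms r k d)
    {A : Matrix (Fin r) (Fin r) k} (hA : A ∈ matrixSpace f) :
    ∃ g ∈ forms r k d, ∀ (γ : Fin r →₀ ℕ) x,
      g (γ + Finsupp.single x 1) = ∑ l, A x l * f (γ + Finsupp.single l 1) := by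
  classical
  rw [mem_matrixSpace_iff_coeff] at hA
  -- The coefficient of `g` at `x^[α]` is prescribed by any `x` with `α x ≠ 0`; the condition on `A`
  -- says that the choice of `x` does not matter.
  let G : (Fin r →₀ ℕ) → k := fun α =>
    if h : ∃ x, α x ≠ 0 then
      ∑ l, A h.choose l * f (α - Finsupp.single h.choose 1 + Finsupp.single l 1)
    else 0
  let g : DPoly r k := Finsupp.indicator (Finset.univ.finsuppAntidiag d) fun α _ => G α
  have hg : ∀ α, g α = if α.degree = d then G α else 0 := by
    intro α
    have : α ∈ (Finset.univ : Finset (Fin r)).finsuppAntidiag d ↔ α.degree = d := by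
      simp [Finsupp.degree_eq_sum]
    simp only [g, Finsupp.indicator_apply, this, dite_eq_ite]
  refine ⟨g, mem_forms.2 fun α hα => by rw [hg, if_neg hα], fun γ x => ?_⟩
  rw [hg]
  split_ifs with hd
  · have hex : ∃ y, (γ + Finsupp.single x 1 : Fin r →₀ ℕ) y ≠ 0 := ⟨x, by simp⟩
    simp only [G, dif_pos hex]
    generalize hex.choose = y, hex.choose_spec = hy
    by_cases hxy : x = y
    · subst hxy
      simp
    · have hy' : γ y ≠ 0 := by simpa [Finsupp.single_apply, hxy] using hy
      obtain ⟨δ, rfl⟩ : ∃ δ, γ = δ + Finsupp.single y 1 :=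
        ⟨γ - Finsupp.single y 1, (tsub_add_cancel_of_le
          (by simpa [Finsupp.single_le_iff] using Nat.one_le_iff_ne_zero.2 hy')).symm⟩
      rw [add_right_comm, add_tsub_cancel_right]
      exact hA x y δ
  · refine (Finset.sum_eq_zero fun l _ => ?_).symm
    rw [apply_add_single_eq_zero hf (by simpa using hd), mul_zero]

end Balanced

/-! ### Nondegeneracy in families -/

section Specialization

variable {r : ℕ}

theorem mapCoeff_apply {k l : Type*} [CommRing k] [CommRing l] (φ : k →+* l) (f : DPoly r k)
    (α : Fin r →₀ ℕ) : mapCoeff φ f α = φ (f α) := rfl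

/-- Nondegeneracy is an open condition: it passes from a specialization of a family to the
generic member. -/
theorem Nondegenerate.of_specialization {B K L : Type*} [CommRing B] [Field K] [Field L]
    (ε : B →+* K) (σ : B →+* L) (hσ : Function.Injective σ) {ft : DPoly r B}
    (h : Nondegenerate (mapCoeff ε ft)) : Nondegenerate (mapCoeff σ ft) := by
  -- Nondegeneracy says that the rows `γ` of coefficients span; some `r` of them have a determinant
  -- that does not vanish at the specialization, hence does not vanish.
  let row : (Fin r →₀ ℕ) → Fin r → K := fun γ x => ε (ft (γ + Finsupp.single x 1))
  have hspan : ⊤ ≤ Submodule.span K (Set.range row) := by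
    by_contra hlt
    obtain ⟨φ, hφ0, hφ⟩ := Submodule.exists_le_ker_of_lt_top _
      (lt_top_iff_ne_top.2 fun h => hlt h.ge)
    apply hφ0
    have hz : (fun x => φ (Pi.single x 1)) = 0 := by
      apply h
      intro γ
      have h1 : φ (row γ) = 0 := hφ (Submodule.subset_span ⟨γ, rfl⟩)
      rw [pi_eq_sum_univ' (row γ), map_sum] at h1
      rw [← h1]
      refine Finset.sum_congr rfl fun x _ => ?_
      rw [map_smul, smul_eq_mul, mul_comm]
      rfl
    ext x
    simpa using congrFun hz x
  let b := Module.Basis.ofSpan hspan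
  let b' := b.reindex (b.indexEquiv (Pi.basisFun K (Fin r)))
  have hb : ∀ i, ∃ γ, row γ = b' i := fun i => by
    have := Module.Basis.ofSpan_subset hspan
    apply this
    simp [b', b]
  choose γ hγ using hb
  let M : Matrix (Fin r) (Fin r) B := fun i x => ft (γ i + Finsupp.single x 1)
  have hdet : M.det ≠ 0 := by
    intro h0
    have h1 : (M.map ε).det = 0 := by
      rw [← RingHom.mapMatrix_apply, ← RingHom.map_det, h0, map_zero]
    have h2 : LinearIndependent K (M.map ε).row := by
      have : (M.map ε).row = b' := by
        funext i
        rw [← hγ]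
        rfl
      rw [this]
      exact b'.linearIndependent
    rw [Matrix.linearIndependent_rows_iff_isUnit, Matrix.isUnit_iff_isUnit_det, h1] at h2
    exact not_isUnit_zero h2
  intro v hv
  refine Matrix.eq_zero_of_mulVec_eq_zero (M := M.map σ) ?_ ?_
  · rw [← RingHom.mapMatrix_apply, ← RingHom.map_det]
    exact (map_ne_zero_iff σ hσ).2 hdet
  · ext i
    rw [Pi.zero_apply, ← hv (γ i)]
    simp [Matrix.mulVec, dotProduct, M, mapCoeff_apply, mul_comm]
    rfl

end Specialization

/-! ### Spectral projections and regular splittings -/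

section Diagonalizable

variable {r : ℕ} {L : Type*} [Field L]

/-- A diagonalizable element of the matrix space with `m` distinct eigenvalues yields a regular
splitting with `m` summands: the summands are obtained from `f` by means of the spectral
projections. -/
theorem hasRegularSplitting_of_diagonalizable {d : ℕ} (hd : 1 ≤ d) {ι : Type*} [Fintype ι]
    [DecidableEq ι] [Nonempty ι] {f : DPoly r L} (hf : f ∈ forms r L d) (hn : Nondegenerate f)
    {A : Matrix (Fin r) (Fin r) L} (hA : A ∈ matrixSpace f) (ξ : ι → L)
    (hξ : Function.Injective ξ) (hzero : aeval A (∏ i, (X - C (ξ i))) = 0)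
    (heig : ∀ i, ∃ v ≠ 0, A.mulVec v = ξ i • v) :
    HasRegularSplitting d f (Fintype.card ι) := by
  let E : ι → Matrix (Fin r) (Fin r) L := fun i => aeval A (Lagrange.basis Finset.univ ξ i)
  choose g hg hgE using fun i =>
    exists_form_of_mem_matrixSpace hf (aeval_mem_matrixSpace hA (Lagrange.basis Finset.univ ξ i))
  have hsumE : ∑ i, E i = 1 := by
    simp only [E]
    rw [← map_sum, Lagrange.sum_basis hξ.injOn Finset.univ_nonempty, map_one]
  refine hasRegularSplitting_of_iSupIndep hd hn g hg ?_
    (fun i => Module.End.eigenspace (Matrix.toLin' A) (ξ i))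
    ((Module.End.eigenspaces_iSupIndep _).comp hξ) ?_ ?_
  · ext α
    by_cases hα : α.degree = d
    · obtain ⟨x, hx⟩ : ∃ x, α x ≠ 0 := by
        by_contra! h0
        have : α = 0 := Finsupp.ext h0
        simp [this] at hα
        omega
      obtain ⟨δ, rfl⟩ : ∃ δ, α = δ + Finsupp.single x 1 :=
        ⟨α - Finsupp.single x 1, (tsub_add_cancel_of_le
          (by simpa [Finsupp.single_le_iff] using Nat.one_le_iff_ne_zero.2 hx)).symm⟩
      rw [Finsupp.finsetSum_apply]
      simp_rw [hgE]
      rw [Finset.sum_comm]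
      simp_rw [← Finset.sum_mul]
      have : ∀ l, ∑ i, E i x l = (1 : Matrix (Fin r) (Fin r) L) x l := fun l => by
        rw [← hsumE, Matrix.sum_apply]
      simp only [E] at this
      simp [this, Matrix.one_apply]
    · rw [Finsupp.finsetSum_apply, mem_forms.1 hf _ hα,
        Finset.sum_eq_zero fun i _ => mem_forms.1 (hg i) _ hα]
  · intro i
    obtain ⟨v, hv0, hv⟩ := heig i
    intro h
    apply hv0
    rw [← Submodule.mem_bot L, ← h, Module.End.mem_eigenspace_iff, Matrix.toLin'_apply, hv]
  · intro i γ _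
    rw [Module.End.mem_eigenspace_iff, Matrix.toLin'_apply]
    have h1 : (fun x => g i (γ + Finsupp.single x 1)) =
        (E i).mulVec fun l => f (γ + Finsupp.single l 1) := by
      ext x
      rw [hgE]
      rfl
    have h2 : (A - algebraMap L _ (ξ i)) * E i = 0 := by
      have h3 : (X - C (ξ i)) * Lagrange.basis Finset.univ ξ i =
          C (∏ j ∈ Finset.univ.erase i, (ξ i - ξ j)⁻¹) * ∏ j, (X - C (ξ j)) := by
        rw [← Finset.mul_prod_erase _ _ (Finset.mem_univ i), Lagrange.basis]
        simp only [Lagrange.basisDivisor, Finset.prod_mul_distrib, map_prod]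
        ring
      have h4 : A - algebraMap L _ (ξ i) = aeval A (X - C (ξ i)) := by simp
      rw [h4, ← map_mul, h3, map_mul, hzero, mul_zero]
    rw [h1, Matrix.mulVec_mulVec]
    rw [sub_mul, sub_eq_zero] at h2
    rw [h2, ← Matrix.mulVec_mulVec, Algebra.algebraMap_eq_smul_one, Matrix.smul_mulVec,
      Matrix.one_mulVec]

end Diagonalizable

/-- `f` is the special member at `t = 0` of a polynomial family of forms of degree `d` in one
parameter `t` whose generic member has a regular splitting with `m` summands. The latter is
required over every field that contains `K[t]`. -/
def DeformsToSplitting {r : ℕ} {K : Type u} [Field K] (d : ℕ) (f : DPoly r K) (m : ℕ) : Prop :=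
  ∃ ft : DPoly r K[X], ft ∈ forms r K[X] d ∧ mapCoeff (evalRingHom 0) ft = f ∧
    ∀ (L : Type u) [Field L] (σ : K[X] →+* L), Function.Injective σ →
      HasRegularSplitting d (mapCoeff σ ft) m

theorem DeformsToSplitting.intro {r : ℕ} {K : Type u} [Field K] {d : ℕ} {f : DPoly r K} {m : ℕ}
    (ft : DPoly r K[X]) (hft : ft ∈ forms r K[X] d) (h0 : mapCoeff (evalRingHom 0) ft = f)
    (h : ∀ (L : Type u) [Field L] (σ : K[X] →+* L), Function.Injective σ →
      HasRegularSplitting d (mapCoeff σ ft) m) : DeformsToSplitting d f m :=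
  ⟨ft, hft, h0, fun L _ σ hσ => h L σ hσ⟩

/-! ### Functionals on polynomial rings -/

section Functionals

variable {J A B N : Type*} [CommRing A] [CommRing B] [Algebra B A] [AddCommGroup N] [Module B N]

/-- The linear map on `A[e_j]` given by `s e^β ↦ θ β s`. -/
def coeffLsum (θ : (J →₀ ℕ) → A →ₗ[B] N) : MvPolynomial J A →ₗ[B] N where
  toFun s := ∑ β ∈ s.support, θ β (s.coeff β)
  map_add' s t := by
    classical
    have h : ∀ u : MvPolynomial J A, u.support ⊆ s.support ∪ t.support →
        ∑ β ∈ u.support, θ β (u.coeff β) = ∑ β ∈ s.support ∪ t.support, θ β (u.coeff β) :=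
      fun u hu => Finset.sum_subset hu fun β _ hβ => by
        rw [MvPolynomial.notMem_support_iff.1 hβ, map_zero]
    rw [h _ MvPolynomial.support_add, h _ Finset.subset_union_left,
      h _ Finset.subset_union_right, ← Finset.sum_add_distrib]
    simp
  map_smul' c s := by
    rw [RingHom.id_apply, Finset.smul_sum]
    have : (c • s).support ⊆ s.support := MvPolynomial.support_smul
    rw [Finset.sum_subset this fun β _ hβ => by
      rw [MvPolynomial.notMem_support_iff.1 hβ, map_zero]]
    refine Finset.sum_congr rfl fun β _ => ?_
    rw [← map_smul, MvPolynomial.coeff_smul]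

theorem coeffLsum_monomial (θ : (J →₀ ℕ) → A →ₗ[B] N) (β : J →₀ ℕ) (s : A) :
    coeffLsum θ (MvPolynomial.monomial β s) = θ β s := by
  classical
  change ∑ γ ∈ _, _ = _
  by_cases hs : s = 0
  · simp [hs]
  · simp [MvPolynomial.support_monomial, hs]

end Functionals

/-! ### Decomposition into cyclic modules -/

section Decomposition

/-- A finite-dimensional vector space with an endomorphism `a` over an algebraically closed field
is a direct sum of cyclic modules `K[X] / (X - μ_j) ^ n_j`, generated by vectors `e_j`. -/
theorem exists_cyclic_decomposition {K V : Type u} [Field K] [IsAlgClosed K] [AddCommGroup V]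
    [Module K V] [FiniteDimensional K V] (a : Module.End K V) :
    ∃ (J : Type u) (_ : Fintype J) (μ : J → K) (n : J → ℕ) (e : J → V),
      (∀ v, ∃ P : J → K[X], (∀ j, (P j).degree < n j) ∧ ∑ j, aeval a (P j) (e j) = v) ∧
      ∀ P : J → K[X], ∑ j, aeval a (P j) (e j) = 0 ↔ ∀ j, (X - C (μ j)) ^ n j ∣ P j := by
  classical
  obtain ⟨J, hJ, p, hp, n, ⟨φ⟩⟩ := Module.equiv_directSum_of_isTorsion
    (R := K[X]) (M := Module.AEval' a) (Module.AEval.isTorsion_of_finiteDimensional K V a)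
  have hμ : ∀ j, ∃ x, Associated (X - C x) (p j) := fun j => by
    obtain ⟨x, hx⟩ := IsAlgClosed.exists_root (p j)
      (by rw [IsAlgClosed.degree_eq_one_of_irreducible K (hp j)]; exact one_ne_zero)
    exact ⟨x, (irreducible_X_sub_C x).associated_of_dvd (hp j) (dvd_iff_isRoot.2 hx)⟩
  choose μ hμ using hμ
  let V' := Module.AEval' a
  let o : V ≃ₗ[K] V' := Module.AEval'.of a
  let mk : ∀ j, K[X] →ₗ[K[X]] K[X] ⧸ Submodule.span K[X] {p j ^ n j} := fun j =>
    Submodule.mkQ _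
  let e : J → V := fun j => o.symm (φ.symm (DirectSum.lof K[X] J _ j (mk j 1)))
  have he : ∀ j (P : K[X]), o (aeval a P (e j)) = φ.symm (DirectSum.lof K[X] J _ j (mk j P)) := by
    intro j P
    have h1 : o (aeval a P (e j)) = P • o (e j) := rfl
    rw [h1]
    simp only [e, LinearEquiv.apply_symm_apply]
    rw [← map_smul, ← map_smul, ← map_smul, smul_eq_mul, mul_one]
  have hsum : ∀ P : J → K[X], φ (o (∑ j, aeval a (P j) (e j))) =
      ∑ j, DirectSum.lof K[X] J _ j (mk j (P j)) := by
    intro P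
    rw [map_sum, map_sum]
    exact Finset.sum_congr rfl fun j _ => by rw [he, LinearEquiv.apply_symm_apply]
  have hcomp : ∀ (P : J → K[X]) j, (∑ j, DirectSum.lof K[X] J
      (fun j => K[X] ⧸ Submodule.span K[X] {p j ^ n j}) j (mk j (P j))) j = mk j (P j) := by
    intro P j
    rw [DFinsupp.finsetSum_apply, Finset.sum_eq_single j]
    · exact DirectSum.lof_apply _ _ _
    · intro i _ hij
      exact DFinsupp.single_eq_of_ne (Ne.symm hij)
    · simp
  have hker : ∀ j P, mk j P = 0 ↔ (X - C (μ j)) ^ n j ∣ P := by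
    intro j P
    rw [((hμ j).pow_pow (n := n j)).dvd_iff_dvd_left, Submodule.mkQ_apply,
      Submodule.Quotient.mk_eq_zero, Submodule.mem_span_singleton, dvd_def]
    simp [eq_comm, mul_comm]
  refine ⟨J, hJ, μ, n, e, fun v => ?_, fun P => ?_⟩
  · have hs : ∀ j, ∃ P, mk j P = φ (o v) j := fun j => Submodule.mkQ_surjective _ _
    choose P hP using hs
    have hq : ∀ j, ((X - C (μ j)) ^ n j).Monic := fun j => (monic_X_sub_C _).pow _
    refine ⟨fun j => P j %ₘ (X - C (μ j)) ^ n j, fun j => ?_, ?_⟩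
    · have := degree_modByMonic_lt (P j) (hq j)
      rwa [degree_pow, degree_X_sub_C, nsmul_one] at this
    · apply o.injective
      apply φ.injective
      rw [hsum]
      refine DFinsupp.ext fun j => ?_
      rw [hcomp, ← hP, ← sub_eq_zero, ← map_sub, hker, ← dvd_neg, neg_sub]
      exact ⟨_, sub_eq_of_eq_add' (modByMonic_add_div _ _).symm⟩
  · rw [← o.map_eq_zero_iff, ← φ.map_eq_zero_iff, hsum]
    constructor
    · intro h j
      rw [← hker, ← hcomp P, h]
      rfl
    · intro h
      refine DFinsupp.ext fun j => ?_
      rw [hcomp, (hker j _).2 (h j)]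
      rfl

end Decomposition

/-! ### Transport of matrices to the members of a family -/

section Transport

variable {r : ℕ} {B S L : Type*} [CommRing B] [CommRing S] [Algebra B S] [Field L]

/-- If multiplication by `Z` has the matrix `A` under the functional `Φ`, then multiplication by
`P(Z)` has the matrix `P(A)`. -/
theorem apply_aeval_mul_eq_sum {Φ : S →ₗ[B] B} {p : Fin r → S} {Z : S}
    {A : Matrix (Fin r) (Fin r) B}
    (h : ∀ x s, Φ (Z * p x * s) = ∑ y, A x y * Φ (p y * s)) (P : B[X]) (x : Fin r) (s : S) :
    Φ (aeval Z P * p x * s) = ∑ y, aeval A P x y * Φ (p y * s) := by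
  induction P using Polynomial.induction_on' generalizing x s with
  | add P Q hP hQ => simp [add_mul, hP, hQ, Finset.sum_add_distrib]
  | monomial n c =>
    have hpow : ∀ (n : ℕ) x s, Φ (Z ^ n * p x * s) = ∑ y, (A ^ n) x y * Φ (p y * s) := by
      intro n
      induction n with
      | zero => intro x s; simp [Matrix.one_apply]
      | succ n ih =>
        intro x s
        rw [show Z ^ (n + 1) * p x * s = Z * p x * (Z ^ n * s) by ring, h, pow_succ']
        simp_rw [show ∀ y, p y * (Z ^ n * s) = Z ^ n * p y * s by intro y; ring, ih,
          Matrix.mul_apply, Finset.sum_mul, Finset.mul_sum]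
        rw [Finset.sum_comm]
        simp_rw [mul_assoc]
    rw [aeval_monomial, aeval_monomial, ← Algebra.smul_def, ← Algebra.smul_def, smul_mul_assoc,
      smul_mul_assoc, map_smul, hpow, smul_eq_mul, Finset.mul_sum]
    simp [mul_assoc]

theorem map_mem_matrixSpace {f : DPoly r B} {A : Matrix (Fin r) (Fin r) B}
    (hA : A ∈ matrixSpace f) (σ : B →+* L) : A.map σ ∈ matrixSpace (mapCoeff σ f) := by
  rw [mem_matrixSpace_iff_coeff] at hA ⊢
  intro i j γ
  simpa [mapCoeff_apply] using congrArg σ (hA i j γ)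

theorem mapCoeff_mem_forms {d : ℕ} {f : DPoly r B} (hf : f ∈ forms r B d) (σ : B →+* L) :
    mapCoeff σ f ∈ forms r L d :=
  mem_forms.2 fun α hα => by rw [mapCoeff_apply, mem_forms.1 hf α hα, map_zero]

/-- A polynomial relation satisfied by multiplication by `Z` under the functional `Φ` is satisfied
by its matrix, provided that the form is nondegenerate. -/
theorem aeval_map_eq_zero {d : ℕ} {Φ : S →ₗ[B] B} {p : Fin r → S} {Z : S}
    {A : Matrix (Fin r) (Fin r) B}
    (h : ∀ x s, Φ (Z * p x * s) = ∑ y, A x y * Φ (p y * s)) (σ : B →+* L)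
    (hn : Nondegenerate (mapCoeff σ (formOf d Φ p))) {P : B[X]}
    (hP : ∀ x s, Φ (aeval Z P * p x * s) = 0) : aeval (A.map σ) (P.map σ) = 0 := by
  have h1 : aeval (A.map σ) (P.map σ) = (aeval A P).map σ := by
    rw [aeval_def, eval₂_map, aeval_def]
    have := Polynomial.hom_eval₂ P (algebraMap B (Matrix (Fin r) (Fin r) B)) σ.mapMatrix A
    rw [← RingHom.mapMatrix_apply, ← RingHom.mapMatrix_apply, this]
    congr 1
    ext b i j
    simp [Matrix.algebraMap_matrix_apply, apply_ite σ]
  rw [h1]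
  ext x y
  refine congrFun (hn (fun y => σ (aeval A P x y)) fun γ => ?_) y
  by_cases hγ : γ.degree + 1 = d
  · have h2 := apply_aeval_mul_eq_sum h P x (∏ y, p y ^ γ y)
    rw [hP] at h2
    have h3 := congrArg σ h2
    rw [map_zero, map_sum] at h3
    rw [h3]
    refine Finset.sum_congr rfl fun y _ => ?_
    rw [mapCoeff_apply, formOf_add_single _ _ _ _ hγ, σ.map_mul]
  · refine Finset.sum_eq_zero fun y _ => ?_
    rw [mapCoeff_apply, apply_add_single_eq_zero (formOf_mem_forms d Φ p) hγ, map_zero, mul_zero]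

/-- A balanced endomorphism `a` can be absorbed into the form: `f(a v ⋯)` is the derivative along
`v` of another form of degree `d`. -/
theorem exists_form_of_balanced {K : Type*} [Field K] {d : ℕ} {f : DPoly r K}
    (hf : f ∈ forms r K d) {a : Module.End K (Fin r → K)} (ha : Balanced f a) :
    ∃ g ∈ forms r K d, ∀ v E, pairing g (lin v * E) = pairing f (lin (a v) * E) := by
  have hA : (LinearMap.toMatrix' a).transpose ∈ matrixSpace f := by
    rw [mem_matrixSpace_iff_balanced]
    simpa using ha
  obtain ⟨g, hg, hgA⟩ := exists_form_of_mem_matrixSpace hf hA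
  refine ⟨g, hg, fun v E => ?_⟩
  induction E using MvPolynomial.induction_on' with
  | add p q hp hq => simp [mul_add, hp, hq]
  | monomial γ c =>
    have h1 : MvPolynomial.monomial γ c = c • MvPolynomial.monomial γ (1 : K) := by
      simp [MvPolynomial.smul_monomial]
    rw [h1, mul_smul_comm, mul_smul_comm, map_smul, map_smul, pairing_lin_mul_monomial,
      pairing_lin_mul_monomial]
    congr 1
    simp_rw [hgA, Finset.mul_sum]
    rw [Finset.sum_comm]
    refine Finset.sum_congr rfl fun l _ => ?_
    have h2 : a v l = ∑ x, v x * a (Pi.single x 1) l := by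
      conv_lhs => rw [pi_eq_sum_univ' v]
      simp
    rw [h2, Finset.sum_mul]
    refine Finset.sum_congr rfl fun x _ => ?_
    rw [Matrix.transpose_apply, LinearMap.toMatrix'_apply, mul_assoc]

end Transport

/-! ### The deformation of cyclic modules -/

section Blocks

variable {K J : Type u}

/-- The pairs `(μ_j, i)` with `i < n_j`; they label the roots of the deformation of the polynomial
`(X - μ_j) ^ n_j`. -/
def block (μ : J → K) (n : J → ℕ) (j : J) : Finset (K × ℕ) := {μ j} ×ˢ Finset.range (n j)

variable [Fintype J]

open Classical in
/-- The pairs that are common to all blocks `j` in the support of `β`. -/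
def blockInter (μ : J → K) (n : J → ℕ) (β : J →₀ ℕ) : Finset (K × ℕ) :=
  (Finset.univ.biUnion (block μ n)).filter fun ω => ∀ j ∈ β.support, ω ∈ block μ n j

theorem blockInter_subset (μ : J → K) (n : J → ℕ) {β : J →₀ ℕ} {j : J} (hj : j ∈ β.support) :
    blockInter μ n β ⊆ block μ n j := by
  classical
  intro ω hω
  exact (Finset.mem_filter.1 hω).2 j hj

end Blocks

section Family

variable {K J : Type u} [Field K]

/-- The linear polynomial `μ + c_i t` attached to a pair `(μ, i)`: the eigenvalue `μ` is split
into the eigenvalues `μ + c_0 t, μ + c_1 t, …`. -/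
def node (c : ℕ → K) (ω : K × ℕ) : K[X] := C ω.1 + C (c ω.2) * X

theorem node_injective {c : ℕ → K} (hc : Function.Injective c) : Function.Injective (node c) := by
  intro ω ω' h
  have h0 := congrArg (coeff · 0) h
  have h1 := congrArg (coeff · 1) h
  simp only [node, coeff_add, coeff_C_mul, coeff_C_zero, coeff_X_zero, mul_zero, add_zero,
    coeff_X_one, mul_one, coeff_C_succ, zero_add] at h0 h1
  exact Prod.ext h0 (hc h1)

/-- The polynomial over `K[t]` with simple roots at the nodes of a finite set of pairs. -/
def nodePoly (c : ℕ → K) (Ω : Finset (K × ℕ)) : K[X][X] := ∏ ω ∈ Ω, (X - C (node c ω))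

theorem nodePoly_monic (c : ℕ → K) (Ω : Finset (K × ℕ)) : (nodePoly c Ω).Monic :=
  monic_prod_of_monic _ _ fun _ _ => monic_X_sub_C _

theorem nodePoly_dvd (c : ℕ → K) {Ω Ω' : Finset (K × ℕ)} (h : Ω ⊆ Ω') :
    nodePoly c Ω ∣ nodePoly c Ω' := Finset.prod_dvd_prod_of_subset _ _ _ h

theorem map_nodePoly (c : ℕ → K) (Ω : Finset (K × ℕ)) :
    (nodePoly c Ω).map (evalRingHom 0) = ∏ ω ∈ Ω, (X - C ω.1) := by
  simp [nodePoly, Polynomial.map_prod, node]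

theorem prod_block (μ : J → K) (n : J → ℕ) (j : J) :
    ∏ ω ∈ block μ n j, (X - C ω.1) = (X - C (μ j)) ^ n j := by
  simp [block]

variable [Fintype J]

/-- The functional on `K[t][X][e_j]` that reduces the coefficient of `e^β` modulo the deformed
annihilator of `e^β` and sends `X ^ i e^β` to the constant `W i β`. -/
def deformedFunctional (c : ℕ → K) (μ : J → K) (n : J → ℕ) (W : ℕ → (J →₀ ℕ) → K) :
    MvPolynomial J K[X][X] →ₗ[K[X]] K[X] :=
  coeffLsum fun β => (lsum fun i => LinearMap.toSpanSingleton K[X] K[X] (C (W i β))) ∘ₗ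
    modByMonicHom (nodePoly c (blockInter μ n β))

theorem deformedFunctional_apply (c : ℕ → K) (μ : J → K) (n : J → ℕ) (W : ℕ → (J →₀ ℕ) → K)
    (s : MvPolynomial J K[X][X]) : deformedFunctional c μ n W s =
      ∑ β ∈ s.support, (s.coeff β %ₘ nodePoly c (blockInter μ n β)).sum
        fun i b => b * C (W i β) := rfl

/-- The deformed functional factors through the deformed cyclic modules: it kills the multiples of
`q e_j` if `q` is a multiple of the deformed polynomial `∏_{i < n_j} (X - μ_j - c_i t)`. -/
theorem deformedFunctional_eq_zero (c : ℕ → K) (μ : J → K) (n : J → ℕ) (W : ℕ → (J →₀ ℕ) → K)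
    {q : K[X][X]} {j : J} (hq : nodePoly c (block μ n j) ∣ q) (s : MvPolynomial J K[X][X]) :
    deformedFunctional c μ n W (MvPolynomial.C q * MvPolynomial.X j * s) = 0 := by
  induction s using MvPolynomial.induction_on' with
  | add s s' h h' => rw [mul_add, map_add, h, h', add_zero]
  | monomial β b =>
    have h1 : MvPolynomial.C q * MvPolynomial.X j * MvPolynomial.monomial β b =
        MvPolynomial.monomial (Finsupp.single j 1 + β) (q * b) := by
      simp [MvPolynomial.X, MvPolynomial.C_mul_monomial, MvPolynomial.monomial_mul]
    rw [h1, deformedFunctional, coeffLsum_monomial, LinearMap.comp_apply]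
    have h2 : modByMonicHom (nodePoly c (blockInter μ n (Finsupp.single j 1 + β))) (q * b) = 0 := by
      have hj : j ∈ (Finsupp.single j 1 + β).support := by simp
      exact (modByMonic_eq_zero_iff_dvd (nodePoly_monic _ _)).2
        (((nodePoly_dvd c (blockInter_subset μ n hj)).trans hq).mul_right b)
    rw [h2, map_zero]

/-- At `t = 0` the deformed annihilators specialize to the annihilators, because these are
the greatest common divisors of the polynomials `(X - μ_j) ^ n_j`. -/
theorem eval_deformedFunctional (c : ℕ → K) (μ : J → K) (n : J → ℕ) (W : ℕ → (J →₀ ℕ) → K)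
    (hW : ∀ β : J →₀ ℕ, ∀ j ∈ β.support, ∀ P : K[X], (X - C (μ j)) ^ n j ∣ P →
      P.sum (fun i b => b * W i β) = 0)
    (s : MvPolynomial J K[X][X]) (hs : s.coeff 0 = 0) :
    (deformedFunctional c μ n W s).eval 0 =
      ∑ β ∈ s.support, ((s.coeff β).map (evalRingHom 0)).sum fun i b => b * W i β := by
  classical
  have hadd : ∀ β (P Q : K[X]), (P + Q).sum (fun i b => b * W i β) =
      P.sum (fun i b => b * W i β) + Q.sum fun i b => b * W i β := fun β P Q =>
    sum_add_index _ _ _ (by simp) (by intros; ring)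
  rw [deformedFunctional_apply, eval_finsetSum]
  refine Finset.sum_congr rfl fun β hβ => ?_
  have hβ0 : β ≠ 0 := by
    rintro rfl
    exact MvPolynomial.mem_support_iff.1 hβ hs
  obtain ⟨j, hj⟩ := Finsupp.support_nonempty_iff.2 hβ0
  set q := nodePoly c (blockInter μ n β)
  set P := s.coeff β
  -- If all `μ_j` in the support of `β` agree, the smallest block is the intersection of the blocks;
  -- otherwise two of the polynomials `(X - μ_j) ^ n_j` are coprime.
  have hvan : ∀ R : K[X], (q.map (evalRingHom 0) * R).sum (fun i b => b * W i β) = 0 := by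
    intro R
    obtain ⟨j₀, hj₀, hmin⟩ := β.support.exists_min_image n ⟨j, hj⟩
    by_cases hμ : ∀ j' ∈ β.support, μ j' = μ j₀
    · have h1 : blockInter μ n β = block μ n j₀ := by
        refine (blockInter_subset μ n hj₀).antisymm fun ω hω => ?_
        refine Finset.mem_filter.2 ⟨Finset.mem_biUnion.2 ⟨j₀, Finset.mem_univ _, hω⟩,
          fun j' hj' => ?_⟩
        simp only [block, Finset.mem_product, Finset.mem_singleton, Finset.mem_range] at hω ⊢
        exact ⟨hω.1.trans (hμ j' hj').symm, hω.2.trans_le (hmin j' hj')⟩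
      apply hW β j₀ hj₀
      rw [map_nodePoly, h1, prod_block]
      exact dvd_mul_right _ _
    · push Not at hμ
      obtain ⟨j', hj', hne⟩ := hμ
      have hcop : IsCoprime ((X - C (μ j')) ^ n j') ((X - C (μ j₀)) ^ n j₀) :=
        (isCoprime_X_sub_C_of_isUnit_sub (sub_ne_zero.2 hne).isUnit).pow
      obtain ⟨u, v, huv⟩ := hcop
      set T := q.map (evalRingHom 0) * R
      have hT : T = (X - C (μ j')) ^ n j' * (u * T) + (X - C (μ j₀)) ^ n j₀ * (v * T) := by
        linear_combination (-T) * huv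
      rw [hT, hadd, hW β j' hj' _ (dvd_mul_right _ _), hW β j₀ hj₀ _ (dvd_mul_right _ _), add_zero]
  have hdiv : P.map (evalRingHom 0) = (P %ₘ q).map (evalRingHom 0) +
      q.map (evalRingHom 0) * (P /ₘ q).map (evalRingHom 0) := by
    rw [← Polynomial.map_mul, ← Polynomial.map_add, modByMonic_add_div]
  rw [hdiv, hadd, hvan, add_zero]
  rw [Polynomial.sum_def, eval_finsetSum,
    sum_eq_of_subset _ (by simp) (s := (P %ₘ q).support)]
  · simp
  · exact support_map_subset _ _

end Family

/-! ### The special member of the family -/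

section SpecialFibre

variable {r : ℕ} {K J : Type u} [Field K] [Fintype J]

/-- The monomial `∏ e_j ^ β_j` in the linear forms attached to vectors `e_j`. -/
def linMonomial (e : J → Fin r → K) (β : J →₀ ℕ) : MvPolynomial (Fin r) K := ∏ j, lin (e j) ^ β j

theorem linMonomial_add_single (e : J → Fin r → K) (β : J →₀ ℕ) (j : J) :
    linMonomial e (Finsupp.single j 1 + β) = lin (e j) * linMonomial e β := by
  classical
  simp only [linMonomial, Finsupp.add_apply, pow_add, Finset.prod_mul_distrib]
  congr 1
  rw [Finset.prod_eq_single j] <;> simp +contextual [eq_comm]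

/-- The linear map on `K[X][e_j]` with `X ^ i e^β ↦ (D ↦ g_i(e^β D))`. -/
def specialFunctional (g : ℕ → DPoly r K) (e : J → Fin r → K) :
    MvPolynomial J K[X] →ₗ[K] MvPolynomial (Fin r) K →ₗ[K] K :=
  coeffLsum fun β => lsum fun i => LinearMap.toSpanSingleton K _
    (pairing (g i) ∘ₗ LinearMap.mulLeft K (linMonomial e β))

theorem specialFunctional_monomial (g : ℕ → DPoly r K) (e : J → Fin r → K) (β : J →₀ ℕ)
    (P : K[X]) (D : MvPolynomial (Fin r) K) :
    specialFunctional g e (MvPolynomial.monomial β P) D =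
      P.sum fun i b => b * pairing (g i) (linMonomial e β * D) := by
  rw [specialFunctional, coeffLsum_monomial]
  change (P.sum _ : MvPolynomial (Fin r) K →ₗ[K] K) D = _
  simp [Polynomial.sum_def, LinearMap.sum_apply]

variable {f : DPoly r K} {a : Module.End K (Fin r → K)} {g : ℕ → DPoly r K}

/-- If `g_i` is obtained from `f` by inserting `a ^ i`, then inserting `P(a)` is a linear
combination of the `g_i`, with the coefficients of `P`. -/
theorem sum_mul_pairing (hg : ∀ i v E, pairing (g i) (lin v * E) = pairing f (lin ((a ^ i) v) * E))
    (P : K[X]) (v : Fin r → K) (E : MvPolynomial (Fin r) K) :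
    (P.sum fun i b => b * pairing (g i) (lin v * E)) = pairing f (lin (aeval a P v) * E) := by
  simp_rw [hg]
  rw [aeval_eq_sum_range, Polynomial.sum_over_range _ (by simp)]
  simp [LinearMap.sum_apply, Finset.sum_mul]

/-- Under the special functional, multiplication by `∑ u_j e_j` is multiplication by the linear form
attached to the vector `∑ u_j(a) e_j`. -/
theorem specialFunctional_mul
    (hg : ∀ i v E, pairing (g i) (lin v * E) = pairing f (lin ((a ^ i) v) * E))
    (e : J → Fin r → K) (u : J → K[X]) (s : MvPolynomial J K[X]) (D : MvPolynomial (Fin r) K) :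
    specialFunctional g e ((∑ j, MvPolynomial.C (u j) * MvPolynomial.X j) * s) D =
      specialFunctional g e s (lin (∑ j, aeval a (u j) (e j)) * D) := by
  induction s using MvPolynomial.induction_on' with
  | add s s' h h' => rw [mul_add, map_add, map_add, LinearMap.add_apply, LinearMap.add_apply, h, h']
  | monomial β b =>
    rw [Finset.sum_mul, map_sum, LinearMap.sum_apply, map_sum, Finset.sum_mul, map_sum]
    refine Finset.sum_congr rfl fun j _ => ?_
    have h1 : MvPolynomial.C (u j) * MvPolynomial.X j * MvPolynomial.monomial β b =
        MvPolynomial.monomial (Finsupp.single j 1 + β) (u j * b) := by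
      simp [MvPolynomial.X, MvPolynomial.C_mul_monomial, MvPolynomial.monomial_mul]
    rw [h1, specialFunctional_monomial, specialFunctional_monomial, linMonomial_add_single]
    simp_rw [mul_assoc (lin (e j)), mul_left_comm (linMonomial e β)]
    rw [sum_mul_pairing hg, sum_mul_pairing hg, mul_comm (u j), aeval_mul, Module.End.mul_apply]

theorem specialFunctional_prod
    (hg : ∀ i v E, pairing (g i) (lin v * E) = pairing f (lin ((a ^ i) v) * E))
    (e : J → Fin r → K) (p : Fin r → J → K[X]) (α : Fin r → ℕ) (D : MvPolynomial (Fin r) K) :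
    specialFunctional g e (∏ x, (∑ j, MvPolynomial.C (p x j) * MvPolynomial.X j) ^ α x) D =
      specialFunctional g e 1 ((∏ x, lin (∑ j, aeval a (p x j) (e j)) ^ α x) * D) := by
  have hpow : ∀ (u : J → K[X]) (m : ℕ) s D,
      specialFunctional g e ((∑ j, MvPolynomial.C (u j) * MvPolynomial.X j) ^ m * s) D =
        specialFunctional g e s (lin (∑ j, aeval a (u j) (e j)) ^ m * D) := by
    intro u m
    induction m with
    | zero => intro s D; simp
    | succ m ih =>
      intro s D
      rw [pow_succ, mul_assoc, ih, specialFunctional_mul hg, pow_succ', mul_assoc]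
  have key : ∀ (t : Finset (Fin r)) s D, specialFunctional g e
      ((∏ x ∈ t, (∑ j, MvPolynomial.C (p x j) * MvPolynomial.X j) ^ α x) * s) D =
        specialFunctional g e s ((∏ x ∈ t, lin (∑ j, aeval a (p x j) (e j)) ^ α x) * D) := by
    classical
    intro t
    induction t using Finset.induction_on with
    | empty => intro s D; simp
    | insert x t hx ih =>
      intro s D
      rw [Finset.prod_insert hx, Finset.prod_insert hx, mul_assoc, hpow, ih]
      congr 1
      ring
  simpa using key Finset.univ 1 D

/-- On products of the basis of the space of linear forms, the special functional gives back the
coefficients of `f`. The exponent must not vanish: `a ^ i` can be moved into `f` only through a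
linear factor. -/
theorem specialFunctional_one
    (hg : ∀ i v E, pairing (g i) (lin v * E) = pairing f (lin ((a ^ i) v) * E))
    (e : J → Fin r → K) {α : Fin r →₀ ℕ} (hα : α ≠ 0) :
    specialFunctional g e 1 (∏ x, lin (Pi.single x 1) ^ α x) = f α := by
  obtain ⟨x, hx⟩ := Finsupp.support_nonempty_iff.2 hα
  obtain ⟨δ, rfl⟩ : ∃ δ, α = δ + Finsupp.single x 1 :=
    ⟨α - Finsupp.single x 1, (tsub_add_cancel_of_le
      (by simpa [Finsupp.single_le_iff] using
        Nat.one_le_iff_ne_zero.2 (Finsupp.mem_support_iff.1 hx))).symm⟩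
  have h1 : (1 : MvPolynomial J K[X]) = MvPolynomial.monomial 0 1 := rfl
  rw [h1, specialFunctional_monomial, prod_pow_add_single (fun x => lin (Pi.single x (1 : K)))]
  simp_rw [show ∀ D, linMonomial e 0 * D = D by intro D; simp [linMonomial]]
  rw [sum_mul_pairing hg, map_one, Module.End.one_apply]
  have h2 : ∏ y, (lin (Pi.single y (1 : K)) : MvPolynomial (Fin r) K) ^ δ y =
      MvPolynomial.monomial δ 1 := by
    rw [MvPolynomial.monomial_eq, Finsupp.prod_fintype _ _ (by simp)]
    simp [lin_single]
  rw [h2, lin_single, MvPolynomial.X, MvPolynomial.monomial_mul, pairing_monomial, add_comm]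
  simp

/-- The special fibre of the deformed functional. -/
theorem eval_deformedFunctional_eq_specialFunctional
    (hg : ∀ i v E, pairing (g i) (lin v * E) = pairing f (lin ((a ^ i) v) * E))
    (c : ℕ → K) {μ : J → K} {n : J → ℕ} {e : J → Fin r → K}
    (he : ∀ j P, (X - C (μ j)) ^ n j ∣ P → aeval a P (e j) = 0)
    (s : MvPolynomial J K[X][X]) (hs : s.coeff 0 = 0) :
    (deformedFunctional c μ n (fun i β => pairing (g i) (linMonomial e β)) s).eval 0 =
      specialFunctional g e (s.map (mapRingHom (evalRingHom 0))) 1 := by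
  rw [eval_deformedFunctional _ _ _ _ _ s hs]
  · conv_rhs => rw [s.as_sum]
    rw [map_sum, map_sum, LinearMap.sum_apply]
    refine Finset.sum_congr rfl fun β _ => ?_
    rw [MvPolynomial.map_monomial, specialFunctional_monomial]
    simp
  · intro β j hj P hP
    obtain ⟨δ, rfl⟩ : ∃ δ, β = Finsupp.single j 1 + δ :=
      ⟨β - Finsupp.single j 1, (add_tsub_cancel_of_le
        (by simpa [Finsupp.single_le_iff] using
          Nat.one_le_iff_ne_zero.2 (Finsupp.mem_support_iff.1 hj))).symm⟩
    simp_rw [linMonomial_add_single]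
    rw [sum_mul_pairing hg, he j P hP, map_zero, zero_mul, map_zero]

end SpecialFibre

/-! ### The deformed module is spanned by lifts of a basis -/

section Reduction

variable {r : ℕ} {K J : Type u} [Field K] [Fintype J]

/-- The vectors `p_x`, which lift the standard basis, generate `K[t][X]^J` over `K[t]` modulo the
deformed relations. -/
theorem exists_combination {μ : J → K} {n : J → ℕ} {e : J → Fin r → K}
    {a : Module.End K (Fin r → K)} (c : ℕ → K) {p : Fin r → J → K[X]}
    (hker : ∀ P : J → K[X], ∑ j, aeval a (P j) (e j) = 0 → ∀ j, (X - C (μ j)) ^ n j ∣ P j)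
    (hdeg : ∀ x j, (p x j).degree < n j)
    (hp : ∀ x, ∑ j, aeval a (p x j) (e j) = Pi.single x 1) (P : J → K[X][X]) :
    ∃ b : Fin r → K[X], ∀ j, nodePoly c (block μ n j) ∣
      P j - ∑ x, C (b x) * (p x j).map (C : K →+* K[X]) := by
  classical
  have hmono : ∀ j i j', i < n j →
      ∑ x, C ((aeval a (X ^ i : K[X])) (e j) x) * p x j' = if j' = j then X ^ i else 0 := by
    intro j i j' hi
    set v := aeval a (X ^ i : K[X]) (e j) with hv
    have h1 : ∑ j', aeval a (∑ x, C (v x) * p x j' - if j' = j then X ^ i else 0) (e j') = 0 := by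
      have h2 : ∑ j', aeval a (∑ x, C (v x) * p x j') (e j') = v := by
        conv_rhs => rw [pi_eq_sum_univ' v]
        simp_rw [map_sum, LinearMap.sum_apply]
        rw [Finset.sum_comm]
        refine Finset.sum_congr rfl fun x _ => ?_
        simp_rw [map_mul, aeval_C, Module.algebraMap_end_eq_smul_id, Module.End.mul_apply,
          LinearMap.smul_apply, LinearMap.id_apply]
        rw [← Finset.smul_sum, hp]
      simp_rw [map_sub, LinearMap.sub_apply]
      rw [Finset.sum_sub_distrib, h2, Finset.sum_eq_single j]
      · simp [hv]
      · intro j' _ hj'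
        simp [hj']
      · simp
    have h3 := hker _ h1 j'
    rw [← sub_eq_zero]
    refine eq_zero_of_dvd_of_degree_lt h3 ?_
    rw [degree_pow, degree_X_sub_C, nsmul_one]
    refine (degree_sub_le _ _).trans_lt (max_lt ?_ ?_)
    · refine (degree_sum_le _ _).trans_lt ?_
      rw [Finset.sup_lt_iff (WithBot.bot_lt_coe _)]
      intro x _
      rw [← smul_eq_C_mul]
      exact (degree_smul_le _ _).trans_lt (hdeg x j')
    · split_ifs with h
      · subst h
        rw [degree_X_pow]
        exact_mod_cast hi
      · rw [degree_zero]
        exact WithBot.bot_lt_coe _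
  have hcard : ∀ j, (nodePoly c (block μ n j)).natDegree = n j := fun j => by
    rw [nodePoly, natDegree_prod_of_monic _ _ fun _ _ => monic_X_sub_C _]
    simp [block]
  let R : J → K[X][X] := fun j => P j %ₘ nodePoly c (block μ n j)
  have hR : ∀ j, R j = ∑ i ∈ Finset.range (n j), C ((R j).coeff i) * X ^ i := fun j => by
    have hlt : (R j).degree < n j := by
      have := degree_modByMonic_lt (P j) (nodePoly_monic c (block μ n j))
      rwa [degree_eq_natDegree (nodePoly_monic _ _).ne_zero, hcard] at this
    ext1 k
    simp only [finsetSum_coeff, coeff_C_mul, coeff_X_pow, mul_ite, mul_one, mul_zero,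
      Finset.sum_ite_eq, Finset.mem_range]
    split_ifs with hk
    · rfl
    · exact coeff_eq_zero_of_degree_lt (hlt.trans_le (by exact_mod_cast not_lt.1 hk))
  refine ⟨fun x => ∑ j, ∑ i ∈ Finset.range (n j),
    (R j).coeff i * C (aeval a (X ^ i : K[X]) (e j) x), fun j' => ?_⟩
  have h1 : ∑ x, C (∑ j, ∑ i ∈ Finset.range (n j),
      (R j).coeff i * C (aeval a (X ^ i : K[X]) (e j) x)) * (p x j').map (C : K →+* K[X]) =
        R j' := by
    simp_rw [map_sum, Finset.sum_mul]
    rw [Finset.sum_comm]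
    have h2 : ∀ j, ∑ x, ∑ i ∈ Finset.range (n j),
        C ((R j).coeff i * C (aeval a (X ^ i : K[X]) (e j) x)) * (p x j').map (C : K →+* K[X]) =
          if j' = j then R j else 0 := by
      intro j
      rw [Finset.sum_comm]
      have h3 : ∀ i ∈ Finset.range (n j), ∑ x,
          C ((R j).coeff i * C (aeval a (X ^ i : K[X]) (e j) x)) *
            (p x j').map (C : K →+* K[X]) =
              C ((R j).coeff i) * (if j' = j then X ^ i else 0 : K[X]).map (C : K →+* K[X]) := by
        intro i hi
        rw [← hmono j i j' (Finset.mem_range.1 hi), Polynomial.map_sum, Finset.mul_sum]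
        refine Finset.sum_congr rfl fun x _ => ?_
        rw [map_mul, Polynomial.map_mul, Polynomial.map_C, mul_assoc]
      rw [Finset.sum_congr rfl h3]
      split_ifs with h
      · conv_rhs => rw [hR j]
        simp
      · simp
    simp_rw [h2]
    simp
  rw [h1]
  exact ⟨_, sub_eq_of_eq_add' (modByMonic_add_div _ _).symm⟩

end Reduction

/-! ### Families attached to one balanced endomorphism -/

section Curvilinear

/-- The number of labels in all blocks is the degree of the minimal polynomial. -/
theorem card_biUnion_block {K J V : Type u} [Field K] [Fintype J] [DecidableEq (K × ℕ)]
    [AddCommGroup V]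
    [Module K V] [FiniteDimensional K V] (a : Module.End K V) {μ : J → K} {n : J → ℕ} {e : J → V}
    (hspan : ∀ v, ∃ P : J → K[X], ∑ j, aeval a (P j) (e j) = v)
    (he : ∀ j P, aeval a P (e j) = 0 ↔ (X - C (μ j)) ^ n j ∣ P) :
    (Finset.univ.biUnion (block μ n)).card = (minpoly K a).natDegree := by
  set Ω := Finset.univ.biUnion (block μ n)
  set Q : K[X] := ∏ ω ∈ Ω, (X - C ω.1) with hQ
  have hQm : Q.Monic := monic_prod_of_monic _ _ fun _ _ => monic_X_sub_C _
  have hdeg : Q.natDegree = Ω.card := by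
    rw [hQ, natDegree_prod_of_monic _ _ fun _ _ => monic_X_sub_C _]
    simp
  have hm0 : minpoly K a ≠ 0 := minpoly.ne_zero_of_finite K a
  have h1 : minpoly K a ∣ Q := by
    apply minpoly.dvd
    ext1 v
    obtain ⟨P, rfl⟩ := hspan v
    rw [map_sum]
    refine Finset.sum_eq_zero fun j _ => ?_
    rw [← Module.End.mul_apply, ← aeval_mul, he, ← prod_block]
    exact (Finset.prod_dvd_prod_of_subset _ _ _
      (Finset.subset_biUnion_of_mem (block μ n) (Finset.mem_univ j))).mul_right _
  have h2 : Q ∣ minpoly K a := by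
    classical
    have hQ' : Q = ((Ω.val.map Prod.fst).map fun x => X - C x).prod := by
      rw [hQ, Multiset.map_map]
      rfl
    rw [hQ', Multiset.prod_X_sub_C_dvd_iff_le_roots hm0, Multiset.le_iff_count]
    intro x
    rw [count_roots, Multiset.count_map]
    have h3 : Ω.filter (fun ω => x = ω.1) ⊆
        (Finset.range (rootMultiplicity x (minpoly K a))).image fun i => (x, i) := by
      intro ω hω
      obtain ⟨hω', rfl⟩ := Finset.mem_filter.1 hω
      obtain ⟨j, -, hj⟩ := Finset.mem_biUnion.1 hω'
      simp only [block, Finset.mem_product, Finset.mem_singleton, Finset.mem_range] at hj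
      refine Finset.mem_image.2 ⟨ω.2, Finset.mem_range.2 (hj.2.trans_le ?_), rfl⟩
      rw [le_rootMultiplicity_iff hm0, hj.1, ← he, minpoly.aeval, LinearMap.zero_apply]
    have h4 := (Finset.card_le_card h3).trans Finset.card_image_le
    rwa [Finset.card_range] at h4
  rw [← hdeg]
  exact le_antisymm (natDegree_le_of_dvd h2 hm0) (natDegree_le_of_dvd h1 hQm.ne_zero)

/-- If multiplication by `Z` on the span of the `q_x` is diagonalizable over the fraction field of
`K[t]`, with distinct eigenvalues, then the form given by `Φ` and the `q_x` deforms its special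
member to a form with a regular splitting. -/
theorem DeformsToSplitting.of_formOf {K : Type u} [Field K] {r d : ℕ} (hd : 1 ≤ d)
    {f : DPoly r K} (hn : Nondegenerate f) {S : Type*} [CommRing S] [Algebra K[X] S]
    {Φ : S →ₗ[K[X]] K[X]} {q : Fin r → S} {Z : S} {A : Matrix (Fin r) (Fin r) K[X]}
    (hmul : ∀ x s, Φ (Z * q x * s) = ∑ y, A x y * Φ (q y * s))
    (h0 : mapCoeff (evalRingHom 0) (formOf d Φ q) = f) {ι : Type*} [Fintype ι] [Nonempty ι]
    (ξ : ι → K[X]) (hξ : Function.Injective ξ)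
    (hz : ∀ x s, Φ (aeval Z (∏ i, (X - C (ξ i))) * q x * s) = 0) (u : ι → Fin r → K[X])
    (hu : ∀ i, u i ≠ 0) (hA : ∀ i, A.mulVec (u i) = ξ i • u i) :
    DeformsToSplitting d f (Fintype.card ι) := by
  classical
  refine .intro (formOf d Φ q) (formOf_mem_forms d Φ q) h0 fun L _ σ hσ => ?_
  have hn0 : Nondegenerate (mapCoeff (evalRingHom 0) (formOf d Φ q)) := by rwa [h0]
  have hnL : Nondegenerate (mapCoeff σ (formOf d Φ q)) := hn0.of_specialization _ σ hσ
  refine hasRegularSplitting_of_diagonalizable hd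
    (mapCoeff_mem_forms (formOf_mem_forms d Φ q) σ) hnL
    (map_mem_matrixSpace (mem_matrixSpace_formOf hmul) σ) (fun i => σ (ξ i)) (hσ.comp hξ) ?_ ?_
  · have h1 : ∏ i, (X - C (σ (ξ i))) = (∏ i, (X - C (ξ i))).map σ := by
      simp [Polynomial.map_prod]
    rw [h1]
    exact aeval_map_eq_zero hmul σ hnL hz
  · intro i
    refine ⟨fun x => σ (u i x), fun h => hu i ?_, ?_⟩
    · ext1 x
      exact hσ (by simpa using congrFun h x)
    · ext x
      have := congrArg σ (congrFun (hA i) x)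
      simpa [Matrix.mulVec, dotProduct] using this

/-- If multiplication by `z` on the vectors `w_x` is given by a matrix modulo vectors that `Φ`
kills, then the same matrix describes multiplication by `z` under `Φ`. -/
theorem map_sum_mul_eq_sum {A B J : Type*} [CommRing A] [CommRing B] [Algebra B A] [Fintype J]
    {r : ℕ} (Φ : MvPolynomial J A →ₗ[B] B) (w : Fin r → J → A) (z : A) (b : Fin r → Fin r → B)
    (h : ∀ x s, Φ ((∑ j, MvPolynomial.C (z * w x j - ∑ y, algebraMap B A (b x y) * w y j) *
      MvPolynomial.X j) * s) = 0) (x : Fin r) (s : MvPolynomial J A) :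
    Φ (MvPolynomial.C z * (∑ j, MvPolynomial.C (w x j) * MvPolynomial.X j) * s) =
      ∑ y, b x y * Φ ((∑ j, MvPolynomial.C (w y j) * MvPolynomial.X j) * s) := by
  have h1 := h x s
  have h2 : (∑ j, MvPolynomial.C (z * w x j - ∑ y, algebraMap B A (b x y) * w y j) *
      MvPolynomial.X j : MvPolynomial J A) =
        MvPolynomial.C z * (∑ j, MvPolynomial.C (w x j) * MvPolynomial.X j) -
          ∑ y, b x y • ∑ j, MvPolynomial.C (w y j) * MvPolynomial.X j := by
    simp only [map_sub, sub_mul, Finset.sum_sub_distrib, Finset.mul_sum, map_mul, mul_assoc,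
      map_sum, Finset.sum_mul, Finset.smul_sum]
    congr 1
    rw [Finset.sum_comm]
    refine Finset.sum_congr rfl fun y _ => Finset.sum_congr rfl fun j _ => ?_
    rw [Algebra.smul_def]
    rfl
  rw [h2, sub_mul, map_sub, sub_eq_zero] at h1
  rw [h1, Finset.sum_mul, map_sum]
  simp_rw [smul_mul_assoc, map_smul, smul_eq_mul]

/-- The element `∑ p_j e_j` of `K[t][X][e_j]` attached to a vector of polynomials that does not
depend on `t`. -/
def constVector {K J : Type u} [Field K] [Fintype J] (p : J → K[X]) : MvPolynomial J K[X][X] :=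
  ∑ j, MvPolynomial.C ((p j).map (C : K →+* K[X])) * MvPolynomial.X j

theorem constantCoeff_constVector {K J : Type u} [Field K] [Fintype J] (p : J → K[X]) :
    MvPolynomial.constantCoeff (constVector p) = 0 := by
  simp [constVector]

theorem map_constVector {K J : Type u} [Field K] [Fintype J] (p : J → K[X]) :
    (constVector p).map (mapRingHom (evalRingHom 0)) =
      ∑ j, MvPolynomial.C (p j) * MvPolynomial.X j := by
  rw [constVector, map_sum]
  refine Finset.sum_congr rfl fun j _ => ?_
  rw [map_mul, MvPolynomial.map_C, MvPolynomial.map_X, coe_mapRingHom, Polynomial.map_map]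
  have : (evalRingHom 0).comp (C : K →+* K[X]) = RingHom.id K := by
    ext
    simp
  rw [this, Polynomial.map_id]

theorem C_mul_constVector {K J : Type u} [Field K] [Fintype J] (q : K[X][X]) (p : J → K[X]) :
    MvPolynomial.C q * constVector p =
      ∑ j, MvPolynomial.C (q * (p j).map (C : K →+* K[X])) * MvPolynomial.X j := by
  simp [constVector, Finset.mul_sum, mul_assoc]

/-- If `a` is balanced for `f`, then `f` deforms to a form that splits into as many summands as
the degree of the minimal polynomial of `a`. As a module over `K[X]`, the space of linear forms
is a direct sum of modules `K[X] / (X - μ_j) ^ n_j`; the module and the form deform together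
when each `(X - μ_j) ^ n_j` is replaced by a product of `n_j` distinct linear factors. -/
theorem deformsToSplitting_natDegree_minpoly {K : Type u} [Field K] [IsAlgClosed K] {r d : ℕ}
    (hr : 0 < r) (hd : 1 ≤ d) {f : DPoly r K} (hf : f ∈ forms r K d) (hn : Nondegenerate f)
    {a : Module.End K (Fin r → K)} (ha : Balanced f a) :
    DeformsToSplitting d f (minpoly K a).natDegree := by
  classical
  have : Infinite K := IsAlgClosed.instInfinite
  let c : ℕ → K := Infinite.natEmbedding K
  have hc : Function.Injective c := (Infinite.natEmbedding K).injective
  choose g hgf hg using fun i => exists_form_of_balanced hf (ha.pow i)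
  obtain ⟨J, _, μ, n, e, hdecomp, hker⟩ := exists_cyclic_decomposition a
  have he : ∀ j P, aeval a P (e j) = 0 ↔ (X - C (μ j)) ^ n j ∣ P := by
    intro j P
    have h1 := hker (Pi.single j P)
    rw [Finset.sum_eq_single j (fun i _ hi => by simp [hi]) (by simp), Pi.single_eq_same] at h1
    rw [h1]
    refine ⟨fun h => by simpa using h j, fun h i => ?_⟩
    by_cases hi : i = j
    · subst hi
      simpa using h
    · simp [hi]
  choose p hdeg hp using fun x => hdecomp (Pi.single x 1)
  have hker' := fun P => (hker P).1
  rw [← card_biUnion_block a (fun v => (hdecomp v).imp fun P hP => hP.2) he]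
  set Ω := Finset.univ.biUnion (block μ n) with hΩ
  obtain ⟨Φ, hΦ⟩ : ∃ Φ, Φ = deformedFunctional c μ n fun i β => pairing (g i) (linMonomial e β) :=
    ⟨_, rfl⟩
  let q : Fin r → MvPolynomial J K[X][X] := fun x => constVector (p x)
  have hkill : ∀ (u : J → K[X][X]), (∀ j, nodePoly c (block μ n j) ∣ u j) → ∀ s,
      Φ ((∑ j, MvPolynomial.C (u j) * MvPolynomial.X j) * s) = 0 := by
    intro u hu s
    rw [Finset.sum_mul, map_sum, hΦ]
    exact Finset.sum_eq_zero fun j _ => deformedFunctional_eq_zero c μ n _ (hu j) s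
  choose b hb using fun x => exists_combination c hker' hdeg hp
    fun j => X * (p x j).map (C : K →+* K[X])
  let A : Matrix (Fin r) (Fin r) K[X] := Matrix.of b
  have hmul : ∀ x s, Φ (MvPolynomial.C X * q x * s) =
      ∑ y, A x y * Φ (q y * s) := by
    exact map_sum_mul_eq_sum Φ _ _ _ fun x s => hkill _ (hb x) s
  have hft0 : mapCoeff (evalRingHom 0) (formOf d Φ q) = f := by
    ext α
    rw [mapCoeff_apply, formOf_apply]
    split_ifs with hα
    · have hα0 : α ≠ 0 := by
        rintro rfl
        simp at hα
        omega
      obtain ⟨x, hx⟩ := Finsupp.support_nonempty_iff.2 hα0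
      rw [coe_evalRingHom, hΦ, eval_deformedFunctional_eq_specialFunctional hg c
        (fun j P => (he j P).2), ← specialFunctional_one hg e hα0]
      · have h1 : (∏ x, q x ^ α x).map (mapRingHom (evalRingHom 0)) =
            ∏ x, (∑ j, MvPolynomial.C (p x j) * MvPolynomial.X j) ^ α x := by
          rw [map_prod]
          exact Finset.prod_congr rfl fun x _ => by rw [map_pow, map_constVector]
        rw [h1, specialFunctional_prod hg, mul_one]
        simp_rw [hp]
      · change MvPolynomial.constantCoeff _ = 0
        rw [map_prod]
        refine Finset.prod_eq_zero (Finset.mem_univ x) ?_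
        rw [map_pow]
        rw [constantCoeff_constVector, zero_pow (Finsupp.mem_support_iff.1 hx)]
    · rw [mem_forms.1 hf α hα, map_zero]
  have hΩne : Nonempty Ω := by
    by_contra hemp
    have h1 : ∀ j, n j = 0 := by
      intro j
      by_contra hj
      exact hemp ⟨⟨(μ j, 0), Finset.mem_biUnion.2 ⟨j, Finset.mem_univ _, by
        simp [block, Nat.pos_of_ne_zero hj]⟩⟩⟩
    have h2 := hp ⟨0, hr⟩
    have h3 : ∀ j, p ⟨0, hr⟩ j = 0 := fun j => by
      have := hdeg ⟨0, hr⟩ j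
      rw [h1 j] at this
      exact degree_eq_bot.1 (by simpa using this)
    simp only [h3, map_zero, LinearMap.zero_apply, Finset.sum_const_zero] at h2
    have := congrFun h2 ⟨0, hr⟩
    simp at this
  have hzero : ∀ x s, Φ (aeval (MvPolynomial.C X : MvPolynomial J K[X][X])
      (∏ ω : Ω, (X - C (node c ω))) * q x * s) = 0 := by
    intro x s
    have h1 : ∏ ω : Ω, (X - C (node c ω)) = nodePoly c Ω :=
      Finset.prod_coe_sort Ω fun ω => (X - C (node c ω))
    have h2 : aeval (MvPolynomial.C X : MvPolynomial J K[X][X]) (nodePoly c Ω) =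
        MvPolynomial.C (nodePoly c Ω) := by
      have := aeval_algebraMap_apply (MvPolynomial J K[X][X]) (X : K[X][X]) (nodePoly c Ω)
      rw [aeval_X_left_apply] at this
      exact this
    rw [h1, h2, C_mul_constVector]
    exact hkill _ (fun j => (nodePoly_dvd c
      (Finset.subset_biUnion_of_mem (block μ n) (Finset.mem_univ j))).mul_right _) s
  -- The `j`-th coordinates of the lifts form an eigenvector when evaluated at a root of the `j`-th
  -- deformed polynomial.
  have heig : ∀ ω : Ω, ∃ u : Fin r → K[X], u ≠ 0 ∧ A.mulVec u = node c ω • u := by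
    rintro ⟨ω, hω⟩
    obtain ⟨j, -, hj⟩ := Finset.mem_biUnion.1 hω
    have hroot : ∀ T, nodePoly c (block μ n j) ∣ T → T.eval (node c ω) = 0 := by
      rintro T ⟨T', rfl⟩
      rw [eval_mul, nodePoly, eval_prod, Finset.prod_eq_zero hj (by simp), zero_mul]
    refine ⟨fun x => ((p x j).map (C : K →+* K[X])).eval (node c ω), fun h0 => ?_, ?_⟩
    · obtain ⟨b', hb'⟩ := exists_combination c hker' hdeg hp (Pi.single j 1)
      have h1 := hroot _ (hb' j)
      simp only [Pi.single_eq_same, eval_sub, eval_one, eval_finsetSum, eval_mul, eval_C] at h1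
      simp_rw [fun x => congrFun h0 x] at h1
      simp at h1
    · ext1 x
      have h1 := hroot _ (hb x j)
      simp only [eval_sub, eval_finsetSum, eval_mul, eval_C, eval_X, sub_eq_zero] at h1
      exact h1.symm
  choose u hu hAu using heig
  rw [← Fintype.card_coe]
  exact .of_formOf hd hn hmul hft0 (fun ω : Ω => node c ω)
    ((node_injective hc).comp Subtype.val_injective) hzero u hu hAu

end Curvilinear

/-! ### From one parameter over `K[t]` to polynomial families -/

section Conclusion

theorem mapCoeff_comp {r : ℕ} {A B C : Type*} [CommRing A] [CommRing B] [CommRing C] (φ : A →+* B)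
    (χ : B →+* C) (f : DPoly r A) : mapCoeff (χ.comp φ) f = mapCoeff χ (mapCoeff φ f) := by
  ext α
  simp [mapCoeff_apply]

/-- Families over `K[t]` are families over the polynomial ring in one variable. -/
theorem DeformsToSplitting.exists_family {K : Type u} [Field K] {r d m : ℕ} {f : DPoly r K}
    (h : DeformsToSplitting d f m) :
    ∃ n : ℕ, 1 ≤ n ∧ ∃ ft : DPoly r (MvPolynomial (Fin n) K),
      ft ∈ forms r (MvPolynomial (Fin n) K) d ∧ specializeZero ft = f ∧
      HasRegularSplitting d (generic ft) m := by
  obtain ⟨ft, hft, h0, hL⟩ := h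
  let ψ : K[X] →+* MvPolynomial (Fin 1) K := ((aeval (MvPolynomial.X 0) :
    K[X] →ₐ[K] MvPolynomial (Fin 1) K) : K[X] →+* MvPolynomial (Fin 1) K)
  have hψ0 : (MvPolynomial.eval (0 : Fin 1 → K)).comp ψ = evalRingHom 0 := by
    ext <;> simp [ψ]
  have hψ : Function.Injective ψ := by
    let χ : MvPolynomial (Fin 1) K →+* K[X] := MvPolynomial.eval₂Hom C fun _ => X
    have : χ.comp ψ = RingHom.id _ := by
      ext <;> simp [ψ, χ]
    exact Function.LeftInverse.injective (g := χ) fun x => RingHom.congr_fun this x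
  refine ⟨1, le_rfl, mapCoeff ψ ft, ?_, ?_, ?_⟩
  · exact mem_forms.2 fun α hα => by rw [mapCoeff_apply, mem_forms.1 hft α hα, map_zero]
  · rw [← h0, ← hψ0, mapCoeff_comp]
    rfl
  · rw [generic, ← mapCoeff_comp]
    exact hL _ ((algebraMap (MvPolynomial (Fin 1) K) (RatFunField 1 K)).comp ψ)
      ((IsFractionRing.injective _ _).comp hψ)

end Conclusion

/-! ### Families attached to deformations of an algebra -/

section Basis

theorem exists_eq_add_single {r : ℕ} {α : Fin r →₀ ℕ} {n : ℕ} (h : α.degree = n + 1) :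
    ∃ (δ : Fin r →₀ ℕ) (x : Fin r), δ.degree = n ∧ α = δ + Finsupp.single x 1 := by
  have hα : α ≠ 0 := by
    rintro rfl
    simp at h
  obtain ⟨x, hx⟩ := Finsupp.support_nonempty_iff.2 hα
  have h1 : α = α - Finsupp.single x 1 + Finsupp.single x 1 := (tsub_add_cancel_of_le
    (by simpa [Finsupp.single_le_iff] using
      Nat.one_le_iff_ne_zero.2 (Finsupp.mem_support_iff.1 hx))).symm
  refine ⟨α - Finsupp.single x 1, x, ?_, h1⟩
  rw [h1] at h
  simpa using h

/-- Elements `m_i` of a commutative `K[t]`-algebra, indexed by a basis of the space of linear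
forms, and a functional give a family of forms. If the span of the `m_i` is stable under a
multiplication that is diagonalizable over the fraction field, with distinct eigenvalues, then the
generic member splits. -/
theorem DeformsToSplitting.of_basis {K : Type u} [Field K] {r d : ℕ} (hd : 1 ≤ d)
    {f : DPoly r K} (hn : Nondegenerate f) {N : Type*} [Fintype N]
    (b : Module.Basis N K (Fin r → K)) {S : Type*} [CommRing S] [Algebra K[X] S]
    (m : N → S) (z : S) (G : Matrix N N K[X]) (hG : ∀ i, z * m i = ∑ j, G i j • m j)
    (Φ : S →ₗ[K[X]] K[X])
    (h0 : mapCoeff (evalRingHom 0)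
      (formOf d Φ fun x => ∑ i, (C (b.repr (Pi.single x 1) i) : K[X]) • m i) = f)
    {ι : Type*} [Fintype ι] [Nonempty ι] (ξ : ι → K[X]) (hξ : Function.Injective ξ)
    (hz : ∀ j, aeval z (∏ i, (X - C (ξ i))) * m j = 0) (ν : ι → N → K[X])
    (hν : ∀ i, ν i ≠ 0) (hGν : ∀ i, G.mulVec (ν i) = ξ i • ν i) :
    DeformsToSplitting d f (Fintype.card ι) := by
  classical
  let W : Matrix (Fin r) N K[X] := Matrix.of fun x i => C (b.repr (Pi.single x 1) i)
  let B : Matrix N (Fin r) K[X] := Matrix.of fun i x => C (b i x)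
  have hBW : B * W = 1 := by
    ext1 i j
    simp only [B, W, Matrix.mul_apply, Matrix.of_apply, ← C_mul, ← map_sum]
    have h1 : ∑ x, b i x * b.repr (Pi.single x 1) j = b.repr (b i) j := by
      conv_rhs => rw [pi_eq_sum_univ' (b i)]
      simp [map_sum, Finsupp.finsetSum_apply]
    rw [h1, Module.Basis.repr_self, Matrix.one_apply, Finsupp.single_apply]
    split_ifs <;> simp
  have hact : ∀ (M : Matrix (Fin r) (Fin r) K[X]) x,
      ∑ y, M x y • ∑ j, W y j • m j = ∑ j, (M * W) x j • m j := by
    intro M x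
    simp only [Finset.smul_sum, smul_smul, Matrix.mul_apply, Finset.sum_smul]
    exact Finset.sum_comm
  have hzq : ∀ x, z * ∑ i, W x i • m i = ∑ y, (W * G * B) x y • ∑ i, W y i • m i := by
    intro x
    rw [hact, Matrix.mul_assoc _ B W, hBW, Matrix.mul_one]
    simp only [Finset.mul_sum, mul_smul_comm, hG, Finset.smul_sum, smul_smul, Matrix.mul_apply,
      Finset.sum_smul]
    exact Finset.sum_comm
  refine .of_formOf (Z := z) (A := W * G * B) hd hn ?_ h0 ξ hξ ?_ (fun i => W.mulVec (ν i)) ?_ ?_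
  · intro x s
    change Φ (z * (∑ i, W x i • m i) * s) = ∑ y, _ * Φ ((∑ i, W y i • m i) * s)
    rw [hzq, Finset.sum_mul, map_sum]
    exact Finset.sum_congr rfl fun y _ => by rw [smul_mul_assoc, map_smul, smul_eq_mul]
  · intro x s
    rw [Finset.mul_sum]
    simp only [mul_smul_comm, hz, smul_zero, Finset.sum_const_zero, zero_mul, map_zero]
  · intro i h
    apply hν i
    rw [← Matrix.one_mulVec (ν i), ← hBW, ← Matrix.mulVec_mulVec, h, Matrix.mulVec_zero]
  · intro i
    rw [Matrix.mulVec_mulVec, Matrix.mul_assoc _ B W, hBW, Matrix.mul_one, ← Matrix.mulVec_mulVec,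
      hGν, Matrix.mulVec_smul]

/-- The special member of a family as above, if the special fibre of the algebra acts by balanced
endomorphisms `Z_i` and `e` is a cyclic vector with `Z_i e = b_i`: it is the given form when the
functional is `s ↦ f(s e · e^{d-1})`. -/
theorem mapCoeff_formOf_of_cyclic {K : Type u} [Field K] {r d : ℕ} (hd : 1 ≤ d)
    {f : DPoly r K} (hf : f ∈ forms r K d) {N : Type*} [Fintype N]
    (b : Module.Basis N K (Fin r → K)) {S : Type*} [CommRing S] [Algebra K[X] S] (m : N → S)
    (Φ : S →ₗ[K[X]] K[X]) (ρ : S →+ (Fin r → K)) {e : Fin r → K} {Z : N → Module.End K (Fin r → K)}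
    (hZ : ∀ i, Balanced f (Z i)) (hZe : ∀ i, Z i e = b i) (hρ1 : ρ 1 = e)
    (hρm : ∀ s i, ρ (s * m i) = Z i (ρ s)) (hρs : ∀ (c : K) s, ρ ((C c : K[X]) • s) = c • ρ s)
    (hΦ : ∀ s, (Φ s).eval 0 = pairing f (lin (ρ s) * lin e ^ (d - 1))) :
    mapCoeff (evalRingHom 0)
      (formOf d Φ fun x => ∑ i, (C (b.repr (Pi.single x 1) i) : K[X]) • m i) = f := by
  set q : Fin r → S := fun x => ∑ i, (C (b.repr (Pi.single x 1) i) : K[X]) • m i with hq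
  have hw : ∀ x, ∑ i, b.repr (Pi.single x 1) i • b i = Pi.single x 1 := fun x => b.sum_repr _
  have hρq : ∀ s x, ρ (s * q x) = ∑ i, b.repr (Pi.single x 1) i • Z i (ρ s) := by
    intro s x
    simp only [hq, Finset.mul_sum, map_sum, mul_smul_comm, hρs, hρm]
  have key : ∀ s x D, pairing f (lin (ρ (s * q x)) * lin e * D) =
      pairing f (lin (ρ s) * MvPolynomial.X x * D) := by
    intro s x D
    rw [hρq, ← lin_single]
    conv_rhs => rw [← hw x]
    simp only [map_sum, map_smul, Finset.sum_mul, Finset.mul_sum, smul_mul_assoc, mul_smul_comm]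
    exact Finset.sum_congr rfl fun i _ => by rw [hZ i, hZe]
  have main : ∀ (n : ℕ) (δ : Fin r →₀ ℕ), δ.degree = n → ∀ s D,
      pairing f (lin (ρ (s * ∏ x, q x ^ δ x)) * lin e ^ n * D) =
        pairing f (lin (ρ s) * (∏ x, MvPolynomial.X x ^ δ x) * D) := by
    intro n
    induction n with
    | zero =>
      intro δ hδ s D
      rw [Finsupp.degree_eq_zero_iff] at hδ
      simp [hδ]
    | succ n ih =>
      intro δ hδ s D
      obtain ⟨δ, x, hδ', rfl⟩ := exists_eq_add_single hδ
      rw [prod_pow_add_single, prod_pow_add_single, mul_comm (q x), ← mul_assoc s, pow_succ',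
        ← mul_assoc (lin _), mul_assoc _ (lin e ^ n), key,
        show ∀ a c e D : MvPolynomial (Fin r) K, a * c * (e * D) = a * e * (c * D) by
          intros; ring, ih δ hδ']
      congr 1
      ring
  ext α
  rw [mapCoeff_apply, formOf_apply]
  split_ifs with hα
  · obtain ⟨δ, x, hδ, rfl⟩ := exists_eq_add_single (n := d - 1) (α := α) (by omega)
    have h1 : ρ (q x) = Pi.single x 1 := by
      have := hρq 1 x
      rw [one_mul, hρ1] at this
      simp only [hZe, hw] at this
      exact this
    have h2 := main (d - 1) δ hδ (q x) 1
    rw [mul_one, mul_one, h1, lin_single] at h2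
    rw [coe_evalRingHom, hΦ, prod_pow_add_single, h2]
    have h3 : MvPolynomial.X x * ∏ y, (MvPolynomial.X y : MvPolynomial (Fin r) K) ^ δ y =
        MvPolynomial.monomial (δ + Finsupp.single x 1) 1 := by
      rw [← prod_pow_add_single, MvPolynomial.monomial_eq, Finsupp.prod_fintype _ _ (by simp)]
      simp
    rw [h3, pairing_monomial, one_mul]
  · rw [mem_forms.1 hf α hα, map_zero]

end Basis

/-! ### Towers of two quadratic algebras -/

section DoubleQuadratic

variable {B : Type*} [CommRing B]

/-- The commutative `B`-algebra with basis `1, x, y, xy` and relations `x² = p x` and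
`y² = (q + c x) y`. -/
abbrev DoubleQuadratic (p q c : B) : Type _ :=
  QuadraticAlgebra (QuadraticAlgebra B 0 p) 0 ⟨q, c⟩

namespace DoubleQuadratic

/-- The element `a₀ + a₁ x + a₂ y + a₃ xy`. -/
def mk (p q c a₀ a₁ a₂ a₃ : B) : DoubleQuadratic p q c := ⟨⟨a₀, a₁⟩, ⟨a₂, a₃⟩⟩

variable {p q c : B}

theorem exists_eq_mk (s : DoubleQuadratic p q c) : ∃ a₀ a₁ a₂ a₃, s = mk p q c a₀ a₁ a₂ a₃ :=
  ⟨s.re.re, s.re.im, s.im.re, s.im.im, rfl⟩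

theorem one_eq : (1 : DoubleQuadratic p q c) = mk p q c 1 0 0 0 := rfl

theorem zero_eq : (0 : DoubleQuadratic p q c) = mk p q c 0 0 0 0 := rfl

theorem mk_add_mk (a₀ a₁ a₂ a₃ b₀ b₁ b₂ b₃ : B) :
    mk p q c a₀ a₁ a₂ a₃ + mk p q c b₀ b₁ b₂ b₃ =
      mk p q c (a₀ + b₀) (a₁ + b₁) (a₂ + b₂) (a₃ + b₃) := rfl

theorem mk_sub_mk (a₀ a₁ a₂ a₃ b₀ b₁ b₂ b₃ : B) :
    mk p q c a₀ a₁ a₂ a₃ - mk p q c b₀ b₁ b₂ b₃ =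
      mk p q c (a₀ - b₀) (a₁ - b₁) (a₂ - b₂) (a₃ - b₃) := rfl

theorem smul_mk (b a₀ a₁ a₂ a₃ : B) :
    b • mk p q c a₀ a₁ a₂ a₃ = mk p q c (b * a₀) (b * a₁) (b * a₂) (b * a₃) := rfl

theorem algebraMap_eq (b : B) :
    algebraMap B (DoubleQuadratic p q c) b = mk p q c b 0 0 0 := rfl

theorem mk_mul_mk (a₀ a₁ a₂ a₃ b₀ b₁ b₂ b₃ : B) :
    mk p q c a₀ a₁ a₂ a₃ * mk p q c b₀ b₁ b₂ b₃ =
      mk p q c (a₀ * b₀) (a₀ * b₁ + a₁ * b₀ + p * (a₁ * b₁))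
        (a₀ * b₂ + a₂ * b₀ + q * (a₂ * b₂))
        (a₀ * b₃ + a₁ * b₂ + p * (a₁ * b₃) + (a₂ * b₁ + a₃ * b₀ + p * (a₃ * b₁)) +
          c * (a₂ * b₂) + (q + p * c) * (a₂ * b₃ + a₃ * b₂ + p * (a₃ * b₃))) := by
  refine QuadraticAlgebra.ext (QuadraticAlgebra.ext ?_ ?_) (QuadraticAlgebra.ext ?_ ?_) <;>
    simp [mk] <;> ring

/-- The linear functional with prescribed values on the basis `1, x, y, xy`. -/
def functional (p q c : B) (θ : Fin 4 → B) : DoubleQuadratic p q c →ₗ[B] B where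
  toFun s := s.re.re * θ 0 + s.re.im * θ 1 + s.im.re * θ 2 + s.im.im * θ 3
  map_add' s s' := by
    simp only [QuadraticAlgebra.re_add, QuadraticAlgebra.im_add]
    ring
  map_smul' c s := by
    simp only [QuadraticAlgebra.re_smul, QuadraticAlgebra.im_smul, smul_eq_mul, RingHom.id_apply]
    ring

theorem functional_mk (θ : Fin 4 → B) (a₀ a₁ a₂ a₃ : B) :
    functional p q c θ (mk p q c a₀ a₁ a₂ a₃) = a₀ * θ 0 + a₁ * θ 1 + a₂ * θ 2 + a₃ * θ 3 := rfl

/-- The additive map to a vector space that takes `φ`-semilinear combinations of four vectors. -/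
def combination (p q c : B) {K V : Type*} [CommRing K] [AddCommGroup V] [Module K V] (φ : B →+* K)
    (b : Fin 4 → V) : DoubleQuadratic p q c →+ V where
  toFun s := φ s.re.re • b 0 + φ s.re.im • b 1 + φ s.im.re • b 2 + φ s.im.im • b 3
  map_zero' := by simp
  map_add' s s' := by
    simp only [QuadraticAlgebra.re_add, QuadraticAlgebra.im_add, map_add]
    module

theorem combination_mk {K V : Type*} [CommRing K] [AddCommGroup V] [Module K V] (φ : B →+* K)
    (b : Fin 4 → V) (a₀ a₁ a₂ a₃ : B) :
    combination p q c φ b (mk p q c a₀ a₁ a₂ a₃) =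
      φ a₀ • b 0 + φ a₁ • b 1 + φ a₂ • b 2 + φ a₃ • b 3 := rfl

end DoubleQuadratic

end DoubleQuadratic

/-! ### Deformation to four points -/

section Four

open DoubleQuadratic in
/-- A form whose space of linear forms is a free module of rank one over an algebra with basis
`1, x, y, xy` and relations `x² = 0`, `y² = c xy` deforms to a form that splits into four powers:
the algebra deforms to that of the four points `(0, 0), (t, 0), (0, u t), (t, (c + u) t)`. -/
theorem deformsToSplitting_four {K : Type u} [Field K] [Infinite K] {r d : ℕ} (hd : 1 ≤ d)
    {f : DPoly r K} (hf : f ∈ forms r K d) (hn : Nondegenerate f)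
    {x y : Module.End K (Fin r → K)} (hx : Balanced f x) (hy : Balanced f y)
    (hxy : x * y = y * x) (hxy' : Balanced f (x * y)) (hxx : x * x = 0) (c : K)
    (hyy : y * y = c • (x * y)) {e : Fin r → K} (b : Module.Basis (Fin 4) K (Fin r → K))
    (hb : ⇑b = ![e, x e, y e, x (y e)]) : DeformsToSplitting d f 4 := by
  classical
  obtain ⟨u, hu⟩ := Infinite.exists_notMem_finset ({0, -c} : Finset K)
  simp only [Finset.mem_insert, Finset.mem_singleton, not_or] at hu
  obtain ⟨hu0, huc⟩ := hu
  have huc' : c + u ≠ 0 := fun h => huc (by linear_combination h)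
  -- The choice of `μ` makes `x + μ y` separate the four points.
  obtain ⟨μ, hμ⟩ := Infinite.exists_notMem_finset ({0, u⁻¹, -(c + u)⁻¹, -c⁻¹} : Finset K)
  simp only [Finset.mem_insert, Finset.mem_singleton, not_or] at hμ
  obtain ⟨hμ0, hμ1, hμ2, hμ3⟩ := hμ
  let ν₀ : Fin 4 → K := ![0, 1, μ * u, 1 + μ * (c + u)]
  have hν₀ : Function.Injective ν₀ := by
    have e1 : μ * u ≠ 0 := mul_ne_zero hμ0 hu0
    have e2 : μ * u ≠ 1 := fun h => hμ1 (eq_inv_of_mul_eq_one_left h)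
    have e3 : 1 + μ * (c + u) ≠ 0 := fun h => hμ2 (by
      rw [← inv_neg]
      exact eq_inv_of_mul_eq_one_left (by linear_combination -h))
    have e5 : 1 + μ * c ≠ 0 := fun h => hμ3 (by
      rw [← inv_neg]
      exact eq_inv_of_mul_eq_one_left (by linear_combination -h))
    have e6 : 1 + μ * (c + u) ≠ μ * u := fun h => e5 (by linear_combination h)
    intro i j
    fin_cases i <;> fin_cases j <;> simp [ν₀, e2, e3, e6, e2.symm, e3.symm,
      e6.symm, hμ0, huc', hu0]
  let p : K[X] := X
  let q : K[X] := C u * X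
  let c' : K[X] := C c
  let v : K[X] := c' * p + q
  let m : Fin 4 → DoubleQuadratic p q c' :=
    ![mk p q c' 1 0 0 0, mk p q c' 0 1 0 0, mk p q c' 0 0 1 0, mk p q c' 0 0 0 1]
  let z : DoubleQuadratic p q c' := mk p q c' 0 1 (C μ) 0
  let G : Matrix (Fin 4) (Fin 4) K[X] := !![0, 1, C μ, 0; 0, p, 0, C μ;
    0, 0, C μ * q, 1 + C μ * c'; 0, 0, 0, p + C μ * v]
  let ν : Fin 4 → Fin 4 → K[X] := ![![1, 0, 0, 0], ![1, p, 0, 0], ![1, 0, q, 0],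
    ![1, p, v, p * v]]
  let ξ : Fin 4 → K[X] := fun i => C (ν₀ i) * X
  have hξ : ξ = ![0, p, C μ * q, p + C μ * v] := by
    ext1 i
    fin_cases i <;> simp [ξ, ν₀, v, p, q, c'] <;> ring
  let Z : Fin 4 → Module.End K (Fin r → K) := ![1, x, y, x * y]
  let ρ := combination p q c' (evalRingHom (0 : K)) b
  let Φ := functional p q c' fun i => C (pairing f (lin (b i) * lin e ^ (d - 1)))
  rw [← Fintype.card_fin 4]
  refine .of_basis hd hn b m z G ?_ Φ ?_ ξ ?_ ?_ ν ?_ ?_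
  · intro i
    rw [Fin.sum_univ_four]
    fin_cases i <;> simp [m, z, G, smul_mk, mk_mul_mk, mk_add_mk] <;> congr 1 <;> ring
  · refine mapCoeff_formOf_of_cyclic (Z := Z) (e := e) hd hf b m Φ ρ ?_ ?_ ?_ ?_ ?_ ?_
    · intro i
      fin_cases i
      exacts [Balanced.one f, hx, hy, hxy']
    · intro i
      fin_cases i <;> simp [Z, hb]
    · simp [ρ, one_eq, combination_mk, hb]
    · have r1 : x (x e) = 0 := LinearMap.congr_fun hxx e
      have r2 : y (x e) = x (y e) := (LinearMap.congr_fun hxy e).symm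
      have r3 : y (y e) = c • x (y e) := LinearMap.congr_fun hyy e
      have r4 : x (x (y e)) = 0 := LinearMap.congr_fun hxx (y e)
      have r5 : y (x (y e)) = 0 := by
        have h1 := LinearMap.congr_fun hxy (y e)
        simp only [Module.End.mul_apply] at h1
        rw [← h1, r3, map_smul, r4, smul_zero]
      intro s i
      obtain ⟨a₀, a₁, a₂, a₃, rfl⟩ := exists_eq_mk s
      fin_cases i <;> simp [m, Z, ρ, combination_mk, mk_mul_mk, hb, r1, r2, r3, r4, r5, smul_smul,
        p, q, c']
      module
    · intro k s
      obtain ⟨a₀, a₁, a₂, a₃, rfl⟩ := exists_eq_mk s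
      simp [ρ, smul_mk, combination_mk, smul_smul]
    · intro s
      obtain ⟨a₀, a₁, a₂, a₃, rfl⟩ := exists_eq_mk s
      simp [Φ, ρ, functional_mk, combination_mk, add_mul]
  · intro i j h
    have h1 := congrArg (coeff · 1) h
    simp only [ξ, coeff_C_mul, coeff_X_one, mul_one] at h1
    exact hν₀ h1
  · intro j
    have h1 : aeval z (∏ i, (X - C (ξ i))) = 0 := by
      have hfac : ∀ g : K[X], aeval z (X - C g) = z - mk p q c' g 0 0 0 := fun g => by
        rw [map_sub, aeval_X, aeval_C, DoubleQuadratic.algebraMap_eq]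
      rw [Fin.prod_univ_four, hξ, map_mul, map_mul, map_mul]
      simp only [hfac, z, mk_sub_mk, mk_mul_mk, zero_eq, Matrix.cons_val]
      congr 1 <;> ring
    rw [h1, zero_mul]
  · intro i h
    have := congrFun h 0
    fin_cases i <;> simp [ν] at this
  · intro i
    rw [hξ]
    ext1 k
    fin_cases i <;> fin_cases k <;>
      simp only [G, ν, v, Matrix.mulVec, dotProduct, Fin.sum_univ_four, Matrix.of_apply,
        Matrix.cons_val, Pi.smul_apply, smul_eq_mul, Fin.zero_eta, Fin.mk_one, Fin.reduceFinMk] <;>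
      ring

end Four

/-! ### Deformation of a form with square-zero centre -/

section Three

theorem map_pairing {r : ℕ} {A B : Type*} [CommRing A] [CommRing B] (φ : A →+* B) (f : DPoly r A)
    (D : MvPolynomial (Fin r) A) :
    φ (pairing f D) = pairing (mapCoeff φ f) (MvPolynomial.map φ D) := by
  induction D using MvPolynomial.induction_on' with
  | add D E hD hE => simp [hD, hE]
  | monomial β c => simp [pairing_monomial, mapCoeff_apply]

theorem map_lin {r : ℕ} {A B : Type*} [CommRing A] [CommRing B] (φ : A →+* B) (v : Fin r → A) :
    MvPolynomial.map φ (lin v) = lin (φ ∘ v) := by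
  simp [lin_apply, MvPolynomial.smul_eq_C_mul]

/-- The first order expansion of `f` along `X_x = L_x + σ(ε n_x)`: the terms of order zero are
products of the `L_x`, and those of order one are computed in the algebra by `σ`. -/
theorem pairing_prod_eq_add {K : Type u} [Field K] {r : ℕ} {f : DPoly r K} {S : Type u}
    [CommRing S] (σ : S →+ (Fin r → K)) {ε : S} {l n : Fin r → S}
    {L : Fin r → MvPolynomial (Fin r) K} {e : Fin r → K} (hl : ∀ x, σ (l x) = 0)
    (hX : ∀ x, MvPolynomial.X x = L x + lin (σ (ε * n x)))
    (K1 : ∀ s x D, pairing f (lin (σ (s * l x)) * lin e * D) = pairing f (lin (σ s) * L x * D))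
    (K2 : ∀ s x D, pairing f (lin (σ (ε * s * (l x + ε * n x))) * lin e * D) =
      pairing f (lin (σ (ε * s)) * MvPolynomial.X x * D)) :
    ∀ (k : ℕ) (δ : Fin r →₀ ℕ), δ.degree = k + 1 → ∀ D,
      pairing f ((∏ x, MvPolynomial.X x ^ δ x) * D) =
        pairing f ((∏ x, L x ^ δ x) * D) +
          pairing f (lin (σ (∏ x, (l x + ε * n x) ^ δ x)) * lin e ^ k * D) := by
  have main₁ : ∀ (k : ℕ) (δ : Fin r →₀ ℕ), δ.degree = k → ∀ s D,
      pairing f (lin (σ (ε * s * ∏ x, (l x + ε * n x) ^ δ x)) * lin e ^ k * D) =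
        pairing f (lin (σ (ε * s)) * (∏ x, MvPolynomial.X x ^ δ x) * D) := by
    intro k
    induction k with
    | zero =>
      intro δ hδ s D
      rw [Finsupp.degree_eq_zero_iff] at hδ
      simp [hδ]
    | succ k ih =>
      intro δ hδ s D
      obtain ⟨δ, x, hδ', rfl⟩ := exists_eq_add_single hδ
      rw [prod_pow_add_single, prod_pow_add_single,
        show ε * s * ((l x + ε * n x) * ∏ y, (l y + ε * n y) ^ δ y) =
            ε * (s * ∏ y, (l y + ε * n y) ^ δ y) * (l x + ε * n x) by ring, pow_succ',
        ← mul_assoc (lin _), mul_assoc _ (lin e ^ k), K2, ← mul_assoc ε,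
        show ∀ a c e D : MvPolynomial (Fin r) K, a * c * (e * D) = a * e * (c * D) by
          intros; ring, ih δ hδ']
      congr 1
      ring
  intro k
  induction k with
  | zero =>
    intro δ hδ D
    obtain ⟨x, rfl⟩ := degree_eq_one hδ
    have hprod : ∀ {M : Type u} [CommMonoid M] (g : Fin r → M),
        ∏ y, g y ^ (Finsupp.single x 1 : Fin r →₀ ℕ) y = g x := by
      intro M _ g
      rw [Finset.prod_eq_single x] <;> simp +contextual [eq_comm]
    rw [hprod, hprod, hprod, hX, map_add σ, hl, zero_add, pow_zero, mul_one, add_mul, map_add]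
  | succ k ih =>
    intro δ hδ D
    obtain ⟨δ, x, hδ', rfl⟩ := exists_eq_add_single hδ
    have h1 := main₁ (k + 1) δ hδ' (n x) D
    have h2 := ih δ hδ' (L x * D)
    have h3 := K1 (∏ x, (l x + ε * n x) ^ δ x) x (lin e ^ k * D)
    rw [prod_pow_add_single, prod_pow_add_single, prod_pow_add_single,
      show (l x + ε * n x) * ∏ y, (l y + ε * n y) ^ δ y =
          (∏ y, (l y + ε * n y) ^ δ y) * l x + ε * n x * ∏ y, (l y + ε * n y) ^ δ y by
        ring, map_add σ, map_add lin, add_mul, add_mul, map_add, h1, hX,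
      add_mul, add_mul, map_add,
      show ∀ a c D : MvPolynomial (Fin r) K, a * c * D = c * (a * D) by intros; ring, h2]
    rw [add_assoc]
    congr 2
    · ring
    · rw [pow_succ', show ∀ a c e D : MvPolynomial (Fin r) K, a * (c * e) * D = a * c * (e * D)
        by intros; ring, h3]
      congr 1
      ring

set_option maxHeartbeats 1000000 in
open DoubleQuadratic in
/-- If the space of linear forms has a basis `e, v, a e, a v` with `a² = 0`, and a further balanced
endomorphism satisfies `e ↦ a v`, `v ↦ τ a v`, then `f` is the sum of a form in two variables and of
a tangent vector to the forms that are sums of two powers, at two points that come together when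
`τ = 0`. Moving the points apart and replacing the tangent vector by a difference quotient, `f`
deforms to a sum of two powers and of a form in the remaining two variables. -/
theorem deformsToSplitting_three {K : Type u} [Field K] {r d : ℕ} (hd : 1 ≤ d)
    {f : DPoly r K} (hf : f ∈ forms r K d) (hn : Nondegenerate f)
    {a a' : Module.End K (Fin r → K)} (ha : Balanced f a) (ha' : Balanced f a')
    (haa : a * a = 0) {e v : Fin r → K} (b : Module.Basis (Fin 4) K (Fin r → K))
    (hb : ⇑b = ![e, v, a e, a v]) {τ : K} (he : a' e = a v) (hv : a' v = τ • a v) :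
    DeformsToSplitting d f 3 := by
  classical
  let t : K[X] := X
  let p : K[X] := C τ + X
  let w : Fin r → Fin 4 → K := fun x i => b.repr (Pi.single x 1) i
  let m₁ : Fin 4 → DoubleQuadratic p t 0 :=
    ![mk p t 0 1 0 0 0, mk p t 0 0 1 0 0, mk p t 0 0 0 1 0, mk p t 0 0 0 0 1]
  let m₂ : Fin 4 → MvPolynomial (Fin r) K[X] := ![lin (C ∘ e), lin (C ∘ v), 0, 0]
  let m : Fin 4 → DoubleQuadratic p t 0 × MvPolynomial (Fin r) K[X] := fun i => (m₁ i, m₂ i)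
  let z₁ : DoubleQuadratic p t 0 := mk p t 0 0 0 1 1
  let G : Matrix (Fin 4) (Fin 4) K[X] := !![0, 0, 1, 1; 0, 0, 0, 1 + p; 0, 0, t, t;
    0, 0, 0, t * (1 + p)]
  let ν : Fin 3 → Fin 4 → K[X] := ![![1, 0, 0, 0], ![1, 0, t, 0], ![1, p, t, t * p]]
  let ξ : Fin 3 → K[X] := ![0, t, t * (1 + p)]
  let θ : Fin 4 → K := ![0, 0, pairing f (lin (a e) * lin e ^ (d - 1)),
    pairing f (lin (a v) * lin e ^ (d - 1))]
  let Φ := (functional p t 0 fun i => C (θ i)) ∘ₗ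
      LinearMap.fst K[X] (DoubleQuadratic p t 0) (MvPolynomial (Fin r) K[X]) +
    pairing (mapCoeff C f) ∘ₗ
      LinearMap.snd K[X] (DoubleQuadratic p t 0) (MvPolynomial (Fin r) K[X])
  let σ := combination p t 0 (evalRingHom (0 : K)) ![0, 0, a e, a v]
  let l : Fin r → DoubleQuadratic p t 0 := fun x => mk p t 0 (C (w x 0)) (C (w x 1)) 0 0
  let n : Fin r → DoubleQuadratic p t 0 := fun x => mk p t 0 (C (w x 2)) (C (w x 3)) 0 0
  let ε : DoubleQuadratic p t 0 := mk p t 0 0 0 1 0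
  let P : Fin r → DoubleQuadratic p t 0 := fun x => l x + ε * n x
  let L : Fin r → MvPolynomial (Fin r) K := fun x => lin (w x 0 • e + w x 1 • v)
  have haa' : ∀ u, a (a u) = 0 := fun u => LinearMap.congr_fun haa u
  have hX : ∀ x, MvPolynomial.X x = L x + lin (σ (ε * n x)) := by
    intro x
    rw [← lin_single, ← b.sum_repr (Pi.single x 1), Fin.sum_univ_four, hb]
    simp [L, σ, ε, n, w, mk_mul_mk, combination_mk, add_assoc]
  have hbal : ∀ D, pairing f (lin (a v) * lin v * D) = τ * pairing f (lin (a v) * lin e * D) := by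
    intro D
    rw [← he, ha' e v D, hv, map_smul, mul_smul_comm, smul_mul_assoc, map_smul, smul_eq_mul, he,
      mul_comm (lin e)]
  have K1 : ∀ s x D, pairing f (lin (σ (s * l x)) * lin e * D) =
      pairing f (lin (σ s) * L x * D) := by
    intro s x D
    obtain ⟨a₀, a₁, a₂, a₃, rfl⟩ := exists_eq_mk s
    have h1 := ha e v D
    rw [mul_comm (lin e)] at h1
    simp only [l, L, σ, mk_mul_mk, combination_mk, map_add, map_smul, add_mul, mul_add,
      smul_mul_assoc, mul_smul_comm, Matrix.cons_val, smul_zero, zero_add, map_mul, smul_eq_mul,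
      hbal, h1]
    simp [p, t]
    ring
  have hkill : ∀ u u' D, pairing f (lin (a u) * lin (a u') * D) = 0 := by
    intro u u' D
    rw [ha, haa', map_zero, mul_zero, zero_mul, map_zero]
  have K2 : ∀ s x D, pairing f (lin (σ (ε * s * P x)) * lin e * D) =
      pairing f (lin (σ (ε * s)) * MvPolynomial.X x * D) := by
    intro s x D
    have h1 : σ (ε * s * (ε * n x)) = 0 := by
      obtain ⟨a₀, a₁, a₂, a₃, rfl⟩ := exists_eq_mk s
      simp [σ, ε, n, mk_mul_mk, combination_mk, t]
    have h2 : ∀ s', ∃ u, σ s' = a u := fun s' => by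
      obtain ⟨a₀, a₁, a₂, a₃, rfl⟩ := exists_eq_mk s'
      exact ⟨a₂.eval 0 • e + a₃.eval 0 • v, by simp [σ, combination_mk]⟩
    obtain ⟨u, hu⟩ := h2 (ε * s)
    obtain ⟨u', hu'⟩ := h2 (ε * n x)
    rw [hX, mul_add (ε * s), map_add, h1, add_zero, K1, mul_add (lin _), add_mul, map_add, hu, hu',
      hkill, add_zero]
  have main : ∀ (k : ℕ) (δ : Fin r →₀ ℕ), δ.degree = k + 1 → ∀ D,
      pairing f ((∏ x, MvPolynomial.X x ^ δ x) * D) =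
        pairing f ((∏ x, L x ^ δ x) * D) +
          pairing f (lin (σ (∏ x, P x ^ δ x)) * lin e ^ k * D) :=
    pairing_prod_eq_add σ (fun x => by simp [σ, l, combination_mk]) hX K1 K2
  rw [← Fintype.card_fin 3]
  refine .of_basis (z := (z₁, 0)) hd hn b m G ?_ Φ ?_ ξ ?_ ?_ ν ?_ ?_
  · intro i
    rw [Fin.sum_univ_four]
    fin_cases i <;> refine Prod.ext ?_ ?_ <;>
      simp [m, m₁, m₂, z₁, G, smul_mk, mk_mul_mk, mk_add_mk, p, t]
  · ext α
    rw [mapCoeff_apply, formOf_apply]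
    split_ifs with hα
    · have hq₁ : ∀ x, (∑ i, (C (b.repr (Pi.single x 1) i) : K[X]) • m i).1 = P x := by
        intro x
        simp [Fin.sum_univ_four, m, m₁, P, l, n, ε, w, smul_mk, mk_mul_mk, mk_add_mk]
      have hq₂ : ∀ x, MvPolynomial.map (evalRingHom 0)
          (∑ i, (C (b.repr (Pi.single x 1) i) : K[X]) • m i).2 = L x := by
        intro x
        have h1 : ∀ u : Fin r → K, eval (0 : K) ∘ (C : K →+* K[X]) ∘ u = u := by
          intro u
          ext
          simp
        simp [Fin.sum_univ_four, m, m₂, L, w, MvPolynomial.smul_eq_C_mul, map_lin, h1]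
      have h2 : mapCoeff (evalRingHom 0) (mapCoeff (C : K →+* K[X]) f) = f := by
        ext
        simp [mapCoeff_apply]
      have h3 : ∀ s, (functional p t 0 (fun i => C (θ i)) s).eval 0 =
          pairing f (lin (σ s) * lin e ^ (d - 1)) := by
        intro s
        obtain ⟨a₀, a₁, a₂, a₃, rfl⟩ := exists_eq_mk s
        simp [functional_mk, θ, σ, combination_mk, add_mul]
      have h4 := main (d - 1) α (by omega) 1
      rw [mul_one, mul_one, mul_one] at h4
      simp only [Φ, LinearMap.add_apply, LinearMap.comp_apply, LinearMap.fst_apply,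
        LinearMap.snd_apply, Prod.fst_prod, Prod.snd_prod, Prod.pow_fst, Prod.pow_snd, hq₁, map_add,
        map_pairing, h2, map_prod, map_pow, hq₂]
      rw [coe_evalRingHom, h3, add_comm, ← h4]
      have h5 : (∏ x, (MvPolynomial.X x : MvPolynomial (Fin r) K) ^ α x) =
          MvPolynomial.monomial α 1 := by
        rw [MvPolynomial.monomial_eq, Finsupp.prod_fintype _ _ (by simp)]
        simp
      rw [h5, pairing_monomial, one_mul]
    · rw [mem_forms.1 hf α hα, map_zero]
  · have h1 : t ≠ 0 := X_ne_zero
    have h2 : p ≠ 0 := fun h => by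
      simpa [p, coeff_C] using congrArg (coeff · 1) h
    have h3 : 1 + p ≠ 0 := fun h => by
      simpa [p, coeff_C, coeff_one] using congrArg (coeff · 1) h
    have h4 : t * (1 + p) ≠ t := fun h => mul_ne_zero h1 h2 (by linear_combination h)
    have h5 := mul_ne_zero h1 h3
    intro i j
    fin_cases i <;> fin_cases j <;> simp only [ξ, Fin.zero_eta, Fin.mk_one, Fin.reduceFinMk,
      Matrix.cons_val, h1, h4, h5, h1.symm, h4.symm, h5.symm, imp_self, false_imp_iff]
  · intro j
    have hfac : ∀ g : K[X], aeval z₁ (X - C g) = z₁ - mk p t 0 g 0 0 0 := fun g => by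
      rw [map_sub, aeval_X, aeval_C, DoubleQuadratic.algebraMap_eq]
    have h1 : aeval z₁ (∏ i, (X - C (ξ i))) = 0 := by
      rw [Fin.prod_univ_three, map_mul, map_mul]
      simp only [ξ, hfac, z₁, mk_sub_mk, mk_mul_mk, zero_eq, Matrix.cons_val]
      congr 1 <;> ring
    have h2 : aeval (0 : MvPolynomial (Fin r) K[X]) (∏ i, (X - C (ξ i))) = 0 := by
      rw [Fin.prod_univ_three, map_mul, map_mul]
      simp [ξ]
    rw [aeval_prod_apply, h1, h2]
    exact zero_mul _
  · intro i h
    have := congrFun h 0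
    fin_cases i <;> simp [ν] at this
  · intro i
    ext1 k
    fin_cases i <;> fin_cases k <;>
      simp only [G, ν, ξ, Matrix.mulVec, dotProduct, Fin.sum_univ_four, Matrix.of_apply,
        Matrix.cons_val, Pi.smul_apply, smul_eq_mul, Fin.zero_eta, Fin.mk_one, Fin.reduceFinMk] <;>
      ring

end Three

/-! ### Algebras generated by one element -/

section Monogenic

variable {K A : Type*} [Field K] [CommRing A] [Algebra K A]

variable (K) in
/-- The factor `e A` of the algebra `A` at the idempotent `e` is generated by one element. -/
def IsMonogenicAt (e : A) : Prop := ∃ b : A, ∀ z, ∃ P : K[X], e * z = e * aeval b P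

theorem mul_aeval_congr {e b b' : A} (h : e * b = e * b') (P : K[X]) :
    e * aeval b P = e * aeval b' P := by
  induction P using Polynomial.induction_on' with
  | add p q hp hq => rw [map_add, map_add, mul_add, mul_add, hp, hq]
  | monomial n c =>
    have key : e * b ^ n = e * b' ^ n := by
      induction n with
      | zero => simp
      | succ n ih => rw [pow_succ, ← mul_assoc, ih, mul_right_comm, h, mul_right_comm,
          mul_assoc, ← pow_succ]
    rw [aeval_monomial, aeval_monomial, mul_left_comm, key, mul_left_comm]

/-- A product of two monogenic algebras is monogenic over an algebraically closed field: shifting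
one of the two generators makes their minimal polynomials coprime. -/
theorem IsMonogenicAt.add [IsAlgClosed K] [FiniteDimensional K A] {e₁ e₂ : A}
    (h₁ : IsIdempotentElem e₁) (h₂ : IsIdempotentElem e₂) (h : e₁ * e₂ = 0)
    (hm₁ : IsMonogenicAt K e₁) (hm₂ : IsMonogenicAt K e₂) : IsMonogenicAt K (e₁ + e₂) := by
  classical
  have : Infinite K := IsAlgClosed.instInfinite
  obtain ⟨b₁, hb₁⟩ := hm₁
  obtain ⟨b₂, hb₂⟩ := hm₂
  have hne : ∀ b : A, minpoly K b ≠ 0 := fun b => minpoly.ne_zero (Algebra.IsIntegral.isIntegral b)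
  obtain ⟨c, hc⟩ := Infinite.exists_notMem_finset
    (((minpoly K b₁).roots.toFinset ×ˢ (minpoly K b₂).roots.toFinset).image fun x => x.1 - x.2)
  have hcop : IsCoprime (minpoly K b₁) ((minpoly K b₂).comp (X - C c)) := by
    rw [Polynomial.isCoprime_iff_aeval_ne_zero_of_isAlgClosed K K]
    intro x
    by_contra! hx
    apply hc
    refine Finset.mem_image.2 ⟨(x, x - c), Finset.mem_product.2 ⟨?_, ?_⟩, by simp⟩
    · simpa [hne] using hx.1
    · simpa [hne, eval_comp] using hx.2
  obtain ⟨u, v, huv⟩ := hcop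
  set b : A := e₁ * b₁ + e₂ * (b₂ + algebraMap K A c)
  have hb1 : e₁ * b = e₁ * b₁ := by
    simp only [b]
    linear_combination b₁ * h₁.eq + (b₂ + algebraMap K A c) * h
  have hb2 : e₂ * b = e₂ * (b₂ + algebraMap K A c) := by
    simp only [b]
    linear_combination b₁ * h + (b₂ + algebraMap K A c) * h₂.eq
  have hshift : ∀ P : K[X], aeval (b₂ + algebraMap K A c) (P.comp (X - C c)) = aeval b₂ P := by
    intro P
    simp [aeval_comp]
  have h1 : e₁ * aeval b (v * (minpoly K b₂).comp (X - C c)) = e₁ := by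
    have h2 : v * (minpoly K b₂).comp (X - C c) = 1 - u * minpoly K b₁ := by
      linear_combination huv
    rw [mul_aeval_congr hb1, h2]
    simp
  have h2 : e₂ * aeval b (v * (minpoly K b₂).comp (X - C c)) = 0 := by
    rw [mul_aeval_congr hb2, map_mul, hshift, minpoly.aeval, mul_zero, mul_zero]
  set Q := v * (minpoly K b₂).comp (X - C c)
  refine ⟨b, fun z => ?_⟩
  obtain ⟨P₁, hP₁⟩ := hb₁ z
  obtain ⟨P₂, hP₂⟩ := hb₂ z
  refine ⟨Q * P₁ + (1 - Q) * P₂.comp (X - C c), ?_⟩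
  have h3 : e₁ * aeval b P₁ = e₁ * aeval b₁ P₁ := mul_aeval_congr hb1 P₁
  have h4 : e₂ * aeval b (P₂.comp (X - C c)) = e₂ * aeval b₂ P₂ := by
    rw [mul_aeval_congr hb2, hshift]
  simp only [map_add, map_mul, map_sub, map_one]
  linear_combination hP₁ + hP₂ - h3 - h4 - (aeval b P₁ - aeval b (P₂.comp (X - C c))) * (h1 + h2)

/-- An idempotent that is not local splits: some element has two generalized eigenvalues. -/
theorem exists_idempotents [IsAlgClosed K] [FiniteDimensional K A] {e : A}
    (he : IsIdempotentElem e) {z : A} (hz : ∀ c : K, ¬ IsNilpotent (e * z - c • e)) :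
    ∃ e₁ e₂ : A, IsIdempotentElem e₁ ∧ IsIdempotentElem e₂ ∧ e₁ * e₂ = 0 ∧ e₁ + e₂ = e ∧
      e₁ ≠ 0 ∧ e₂ ≠ 0 := by
  have he0 : e ≠ 0 := by
    rintro rfl
    exact hz 0 (by simp)
  let I : Ideal A := Ideal.span {1 - e}
  have hI : ∀ y, Ideal.Quotient.mk I y = 0 ↔ e * y = 0 := by
    intro y
    rw [Ideal.Quotient.eq_zero_iff_mem, Ideal.mem_span_singleton']
    constructor
    · rintro ⟨a, rfl⟩
      linear_combination -a * he.eq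
    · intro h
      exact ⟨y, by linear_combination -h⟩
  have hnt : Nontrivial (A ⧸ I) := by
    refine ⟨⟨1, 0, fun h => he0 ?_⟩⟩
    have := (hI 1).1 h
    rwa [mul_one] at this
  set m := minpoly K (Ideal.Quotient.mk I z)
  have hint : IsIntegral K (Ideal.Quotient.mk I z) := Algebra.IsIntegral.isIntegral _
  have hker : ∀ P : K[X], e * aeval z P = 0 ↔ m ∣ P := by
    intro P
    rw [← hI, minpoly.dvd_iff, ← Ideal.Quotient.mkₐ_eq_mk K, aeval_algHom_apply]
  obtain ⟨c, hc⟩ := IsAlgClosed.exists_root m (minpoly.degree_pos hint).ne'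
  have hm0 : m ≠ 0 := minpoly.ne_zero hint
  obtain ⟨M, hM, hMc⟩ := exists_eq_pow_rootMultiplicity_mul_and_not_dvd m hm0 c
  have hn : 0 < rootMultiplicity c m := (rootMultiplicity_pos hm0).2 hc
  set n := rootMultiplicity c m
  obtain ⟨u, v, huv⟩ : IsCoprime ((X - C c) ^ n) M :=
    ((irreducible_X_sub_C c).coprime_iff_not_dvd.2 hMc).pow_left
  have huv' : aeval z u * aeval z ((X - C c) ^ n) + aeval z v * aeval z M = 1 := by
    rw [← map_mul, ← map_mul, ← map_add, huv, map_one]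
  have hm : e * (aeval z ((X - C c) ^ n) * aeval z M) = 0 := by
    rw [← map_mul, ← hM, hker]
  set x := aeval z ((X - C c) ^ n)
  set y := aeval z M
  have hsum : e * (aeval z v * y) + e * (aeval z u * x) = e := by linear_combination e * huv'
  have horth : e * (aeval z v * y) * (e * (aeval z u * x)) = 0 := by
    linear_combination e * aeval z v * aeval z u * hm
  refine ⟨e * (aeval z v * y), e * (aeval z u * x), ?_, ?_, horth, hsum, fun h => ?_, fun h => ?_⟩
  · change _ * _ = _
    linear_combination e * (aeval z v * y) * hsum - horth + aeval z v * y * he.eq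
  · change _ * _ = _
    linear_combination e * (aeval z u * x) * hsum - horth + aeval z u * x * he.eq
  · have h1 : e * y = 0 := by linear_combination -y * hsum + y * h + aeval z u * hm
    rw [hker] at h1
    have hM0 : M ≠ 0 := fun h0 => hm0 (by rw [hM, h0, mul_zero])
    have h2 := natDegree_le_of_dvd h1 hM0
    have h3 : m.natDegree = n + M.natDegree := by
      conv_lhs => rw [hM]
      rw [natDegree_mul (pow_ne_zero _ (X_sub_C_ne_zero c)) hM0, natDegree_pow, natDegree_X_sub_C,
        mul_one]
    omega
  · refine hz c ⟨n, ?_⟩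
    have h1 : e * x = 0 := by linear_combination -x * hsum + x * h + aeval z v * hm
    have h2 : e * z - c • e = e * (z - algebraMap K A c) := by
      rw [Algebra.smul_def]
      ring
    rw [h2, mul_pow, he.pow_eq hn.ne']
    simpa [x] using h1

/-- A finite-dimensional commutative algebra over an algebraically closed field is monogenic as soon
as its local factors are. -/
theorem isMonogenicAt_of_local [IsAlgClosed K] [FiniteDimensional K A]
    (h : ∀ e : A, IsIdempotentElem e → e ≠ 0 → (∀ z, ∃ c : K, IsNilpotent (e * z - c • e)) →
      IsMonogenicAt K e) {e : A} (he : IsIdempotentElem e) : IsMonogenicAt K e := by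
  induction hn : Module.finrank K ((Ideal.span {e}).restrictScalars K) using
    Nat.strong_induction_on generalizing e with
  | _ n ih =>
  by_cases he0 : e = 0
  · subst he0
    exact ⟨0, fun z => ⟨0, by simp⟩⟩
  by_cases hl : ∀ z, ∃ c : K, IsNilpotent (e * z - c • e)
  · exact h e he he0 hl
  push Not at hl
  obtain ⟨z, hz⟩ := hl
  obtain ⟨e₁, e₂, h₁, h₂, horth, hsum, h₁0, h₂0⟩ := exists_idempotents he hz
  have key : ∀ e₁ e₂ : A, IsIdempotentElem e₁ → IsIdempotentElem e₂ → e₁ * e₂ = 0 → e₁ + e₂ = e →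
      e₂ ≠ 0 → Module.finrank K ((Ideal.span {e₁}).restrictScalars K) < n := by
    intro e₁ e₂ h₁ h₂ horth hsum h₂0
    rw [← hn]
    apply Submodule.finrank_lt_finrank_of_lt
    refine lt_of_le_of_ne ?_ fun heq => h₂0 ?_
    · rw [Submodule.restrictScalars_le, Ideal.span_singleton_le_span_singleton]
      exact ⟨e₁, by rw [← hsum]; linear_combination -h₁.eq - horth⟩
    · have h1 : e ∈ (Ideal.span {e₁}).restrictScalars K := by
        rw [heq]
        exact Ideal.mem_span_singleton_self e
      obtain ⟨a, ha⟩ := Ideal.mem_span_singleton'.1 h1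
      linear_combination -h₂.eq + e₂ * hsum - e₂ * ha + (a - 1) * horth
  rw [← hsum]
  exact .add h₁ h₂ horth (ih _ (key e₁ e₂ h₁ h₂ horth hsum h₂0) h₁ rfl)
    (ih _ (key e₂ e₁ h₂ h₁ (by rw [mul_comm, horth]) (by rw [add_comm, hsum]) h₁0) h₂ rfl)

theorem finrank_eq_natDegree_minpoly {A : Type*} [Ring A] [Algebra K A] {b : A}
    (h : ∀ z, ∃ P : K[X], z = aeval b P) : Module.finrank K A = (minpoly K b).natDegree := by
  have hsurj : Function.Surjective (aeval b : K[X] →ₐ[K] A) := fun z =>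
    (h z).imp fun P hP => hP.symm
  rw [← (Ideal.quotientKerAlgEquivOfSurjective hsurj).toLinearEquiv.finrank_eq,
    (Ideal.quotientEquivAlgOfEq K
      (minpoly.ker_aeval_eq_span_minpoly K b)).toLinearEquiv.finrank_eq,
    finrank_quotient_span_eq_natDegree]

end Monogenic

/-! ### The centre of a form -/

section Centre

variable {K : Type u} [Field K] {r d : ℕ} {f : DPoly r K}

theorem Nondegenerate.eq_zero_of_mul (hn : Nondegenerate f) (hf : f ∈ forms r K d) (hd : 2 ≤ d)
    {u : Fin r → K} (h : ∀ w D, pairing f (lin u * lin w * D) = 0) : u = 0 := by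
  apply hn
  intro γ
  by_cases hγ : γ.degree + 1 = d
  · obtain ⟨δ, x, -, rfl⟩ := exists_eq_add_single (n := d - 2) (α := γ) (by omega)
    have h1 := h (Pi.single x 1) (MvPolynomial.monomial δ 1)
    rwa [lin_single, mul_assoc, MvPolynomial.X, MvPolynomial.monomial_mul, one_mul, add_comm,
      pairing_lin_mul_monomial] at h1
  · exact Finset.sum_eq_zero fun x _ => by rw [apply_add_single_eq_zero hf hγ, mul_zero]

theorem Nondegenerate.eq_zero_of_mul_mul (hn : Nondegenerate f) (hf : f ∈ forms r K d) (hd : 3 ≤ d)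
    {u : Fin r → K} (h : ∀ w w' D, pairing f (lin u * lin w * (lin w' * D)) = 0) : u = 0 := by
  apply hn
  intro γ
  by_cases hγ : γ.degree + 1 = d
  · obtain ⟨δ, x, hδ, rfl⟩ := exists_eq_add_single (n := d - 2) (α := γ) (by omega)
    obtain ⟨δ, y, -, rfl⟩ := exists_eq_add_single (n := d - 3) (α := δ) (by omega)
    have h1 := h (Pi.single x 1) (Pi.single y 1) (MvPolynomial.monomial δ 1)
    rw [lin_single, lin_single, mul_assoc, MvPolynomial.X, MvPolynomial.X,
      MvPolynomial.monomial_mul, one_mul, MvPolynomial.monomial_mul, one_mul,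
      pairing_lin_mul_monomial] at h1
    convert h1 using 3 with z
    congr 2
    abel
  · exact Finset.sum_eq_zero fun x _ => by rw [apply_add_single_eq_zero hf hγ, mul_zero]

/-- Balanced endomorphisms of a form of degree at least three commute: in
`f((ab - ba)u · v · w ⋯)` each of `a` and `b` can be moved to any of the three arguments. -/
protected theorem Balanced.mul_comm {a b : Module.End K (Fin r → K)} (hf : f ∈ forms r K d)
    (hn : Nondegenerate f) (hd : 3 ≤ d) (ha : Balanced f a) (hb : Balanced f b) :
    a * b = b * a := by
  refine LinearMap.ext fun u => ?_
  rw [← sub_eq_zero]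
  refine hn.eq_zero_of_mul_mul hf hd fun v w D => ?_
  have h1 : pairing f (lin (a (b u)) * lin v * (lin w * D)) =
      pairing f (lin (b (a u)) * lin v * (lin w * D)) := by
    rw [ha, show lin (b u) * lin (a v) * (lin w * D) = lin (b u) * lin w * (lin (a v) * D) by ring,
      hb, show lin u * lin (b w) * (lin (a v) * D) = lin u * lin (a v) * (lin (b w) * D) by ring,
      ← ha, show lin (a u) * lin v * (lin (b w) * D) = lin (a u) * lin (b w) * (lin v * D) by ring,
      ← hb]
    congr 1
    ring
  simp only [Module.End.mul_apply, map_sub, sub_mul, h1, sub_self]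

theorem Balanced.mul {a b : Module.End K (Fin r → K)} (hf : f ∈ forms r K d)
    (hn : Nondegenerate f) (hd : 3 ≤ d) (ha : Balanced f a) (hb : Balanced f b) :
    Balanced f (a * b) := fun v w E => by
  rw [Module.End.mul_apply, ha, hb, ha.mul_comm hf hn hd hb, Module.End.mul_apply]

/-- The commutative algebra of all balanced endomorphisms. -/
def centre (hf : f ∈ forms r K d) (hn : Nondegenerate f) (hd : 3 ≤ d) :
    Subalgebra K (Module.End K (Fin r → K)) where
  carrier := {a | Balanced f a}
  mul_mem' ha hb := Balanced.mul hf hn hd ha hb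
  add_mem' ha hb := Balanced.add ha hb
  algebraMap_mem' c := by
    rw [Algebra.algebraMap_eq_smul_one]
    exact (Balanced.one f).smul c

variable (hf : f ∈ forms r K d) (hn : Nondegenerate f) (hd : 3 ≤ d)

instance : CommRing (centre hf hn hd) where
  mul_comm a b := Subtype.ext (Balanced.mul_comm hf hn hd a.2 b.2)

instance : FiniteDimensional K (centre hf hn hd) :=
  inferInstanceAs (FiniteDimensional K (Subalgebra.toSubmodule (centre hf hn hd)))

/-- Transposition identifies `M_f` with the algebra of balanced endomorphisms. -/
theorem finrank_matrixSpace :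
    Module.finrank K (matrixSpace f) = Module.finrank K (centre hf hn hd) := by
  let φ : Matrix (Fin r) (Fin r) K ≃ₗ[K] Module.End K (Fin r → K) :=
    Matrix.transposeLinearEquiv (Fin r) (Fin r) K K ≪≫ₗ Matrix.toLin'
  have h : (matrixSpace f).map (φ : Matrix (Fin r) (Fin r) K →ₗ[K] Module.End K (Fin r → K)) =
      Subalgebra.toSubmodule (centre hf hn hd) := by
    ext a
    rw [Submodule.mem_map_equiv, mem_matrixSpace_iff_balanced]
    have : Matrix.toLin' (φ.symm a).transpose = a := φ.apply_symm_apply a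
    rw [this]
    rfl
  exact (φ.ofSubmodules _ _ h).finrank_eq

end Centre

/-! ### Balanced endomorphisms of rank one -/

section RankOne

variable {K : Type u} [Field K] {r d : ℕ} {f : DPoly r K}

/-- If `f(u · w ⋯)` is proportional to `f(u · e ⋯)` for all `w`, then the derivative of `f` along
`u` is a power of a linear form, and it is determined by its value at `e`. -/
theorem Nondegenerate.eq_zero_of_pow (hn : Nondegenerate f) (hf : f ∈ forms r K d)
    {u e : Fin r → K}
    (hu : ∀ w, ∃ k : K, ∀ D, pairing f (lin u * lin w * D) = k * pairing f (lin u * lin e * D))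
    (h0 : pairing f (lin u * lin e ^ (d - 1)) = 0) : u = 0 := by
  have key : ∀ (n : ℕ) (γ : Fin r →₀ ℕ), γ.degree = n → ∀ m, n + m = d - 1 →
      pairing f (lin u * MvPolynomial.monomial γ 1 * lin e ^ m) = 0 := by
    intro n
    induction n with
    | zero =>
      intro γ hγ m hm
      rw [Finsupp.degree_eq_zero_iff] at hγ
      subst hγ
      rw [show m = d - 1 by omega, MvPolynomial.monomial_zero', map_one, mul_one, h0]
    | succ n ih =>
      intro γ hγ m hm
      obtain ⟨δ, x, hδ, rfl⟩ := exists_eq_add_single hγ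
      obtain ⟨k, hk⟩ := hu (Pi.single x 1)
      have h1 : (MvPolynomial.monomial (δ + Finsupp.single x 1) 1 : MvPolynomial (Fin r) K) =
          lin (Pi.single x 1) * MvPolynomial.monomial δ 1 := by
        rw [lin_single, MvPolynomial.X, MvPolynomial.monomial_mul, one_mul, add_comm]
      rw [h1, ← mul_assoc, mul_assoc _ _ (lin e ^ m), hk]
      have h2 := ih δ hδ (m + 1) (by omega)
      rw [pow_succ'] at h2
      rw [show lin u * lin e * (MvPolynomial.monomial δ 1 * lin e ^ m) =
        lin u * MvPolynomial.monomial δ 1 * (lin e * lin e ^ m) by ring, h2, mul_zero]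
  apply hn
  intro γ
  by_cases hγ : γ.degree + 1 = d
  · rw [← pairing_lin_mul_monomial]
    simpa using key _ γ rfl 0 (by omega)
  · exact Finset.sum_eq_zero fun x _ => by rw [apply_add_single_eq_zero hf hγ, mul_zero]

/-- Balanced endomorphisms of rank one with the same kernel are proportional. -/
theorem Balanced.exists_apply_eq_smul (hn : Nondegenerate f) (hf : f ∈ forms r K d)
    {a a' : Module.End K (Fin r → K)} (ha : Balanced f a) (ha' : Balanced f a') {e : Fin r → K}
    (hae : a e ≠ 0) (h : ∀ w, ∃ k : K, a w = k • a e ∧ a' w = k • a' e) :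
    ∃ c : K, a' e = c • a e := by
  have key : ∀ {z : Module.End K (Fin r → K)}, Balanced f z →
      ∀ w (k : K), z w = k • z e → ∀ D, pairing f (lin (z e) * lin w * D) =
        k * pairing f (lin (z e) * lin e * D) := by
    intro z hz w k hk D
    rw [hz, hk, map_smul, mul_smul_comm, smul_mul_assoc, map_smul, smul_eq_mul, mul_comm (lin e)]
  set c := pairing f (lin (a e) * lin e ^ (d - 1))
  have hc : c ≠ 0 := fun hc => hae <| hn.eq_zero_of_pow hf
    (fun w => (h w).imp fun k hk => key ha w k hk.1) hc
  refine ⟨pairing f (lin (a' e) * lin e ^ (d - 1)) / c, ?_⟩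
  set c' := pairing f (lin (a' e) * lin e ^ (d - 1))
  rw [← sub_eq_zero]
  refine hn.eq_zero_of_pow hf (e := e) (fun w => ?_) ?_
  · obtain ⟨k, hk, hk'⟩ := h w
    refine ⟨k, fun D => ?_⟩
    simp only [map_sub, map_smul, sub_mul, smul_mul_assoc, smul_eq_mul, key ha w k hk,
      key ha' w k hk']
    ring
  · simp only [map_sub, map_smul, sub_mul, smul_mul_assoc, smul_eq_mul]
    change c' - c' / c * c = 0
    rw [div_mul_cancel₀ _ hc, sub_self]

/-- Balanced endomorphisms `a`, `a'` such that `a`, `a'` and `a + a'` have rank at most one are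
proportional. -/
theorem Balanced.exists_eq_smul (hn : Nondegenerate f) (hf : f ∈ forms r K d) (hd : 2 ≤ d)
    {a a' : Module.End K (Fin r → K)} (ha : Balanced f a) (ha' : Balanced f a') (ha0 : a ≠ 0)
    (h : ∀ v w, ¬ LinearIndependent K ![a v, a w])
    (h' : ∀ v w, ¬ LinearIndependent K ![a' v, a' w])
    (h'' : ∀ v w, ¬ LinearIndependent K ![(a + a') v, (a + a') w]) :
    ∃ c : K, a' = c • a := by
  have line : ∀ {z : Module.End K (Fin r → K)}, (∀ v w, ¬ LinearIndependent K ![z v, z w]) →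
      ∀ e, z e ≠ 0 → ∀ w, ∃ k : K, z w = k • z e := by
    intro z hz e he w
    have := hz e w
    rw [LinearIndependent.pair_iff' he] at this
    push Not at this
    exact this.imp fun k hk => hk.symm
  obtain ⟨e, he⟩ : ∃ e, a e ≠ 0 := by
    by_contra! h0
    exact ha0 (LinearMap.ext h0)
  by_cases hker : ∀ v, a v = 0 → a' v = 0
  · have hk : ∀ w, ∃ k : K, a w = k • a e ∧ a' w = k • a' e := by
      intro w
      obtain ⟨k, hk⟩ := line h e he w
      have h1 := hker (w - k • e) (by rw [map_sub, map_smul, hk, sub_self])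
      rw [map_sub, map_smul, sub_eq_zero] at h1
      exact ⟨k, hk, h1⟩
    obtain ⟨c, hc⟩ := ha.exists_apply_eq_smul hn hf ha' he hk
    refine ⟨c, LinearMap.ext fun w => ?_⟩
    obtain ⟨k, hk, hk'⟩ := hk w
    rw [hk', hc, LinearMap.smul_apply, hk, smul_comm]
  · push Not at hker
    obtain ⟨v, hv, hv'⟩ := hker
    -- The images of `a` and `a'` agree: both are spanned by the image of `a + a'` at `v`.
    have him : ∀ w, ∃ k : K, a' w = k • a e := by
      intro w
      obtain ⟨l, hl⟩ := line h' v hv' e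
      obtain ⟨k, hk⟩ := line h'' v (by simpa [hv] using hv') e
      obtain ⟨m, hm⟩ := line h' v hv' w
      have h1 : a e = (k - l) • a' v := by
        simp only [LinearMap.add_apply, hv, zero_add, hl] at hk
        rw [sub_smul, ← hk, add_sub_cancel_right]
      have h2 : k - l ≠ 0 := fun h2 => he (by rw [h1, h2, zero_smul])
      exact ⟨m * (k - l)⁻¹, by rw [hm, h1, smul_smul, mul_assoc, inv_mul_cancel₀ h2, mul_one]⟩
    obtain ⟨c, hc⟩ := him e
    refine ⟨c, ?_⟩
    have hz : Balanced f (a' - c • a) := by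
      have h1 : a' - c • a = a' + (-c) • a := by module
      rw [h1]
      exact ha'.add (ha.smul _)
    have hze : (a' - c • a) e = 0 := by simp [hc]
    have hzw : ∀ w, ∃ k : K, (a' - c • a) w = k • a e := by
      intro w
      obtain ⟨k, hk⟩ := him w
      obtain ⟨l, hl⟩ := line h e he w
      exact ⟨k - c * l, by simp [hk, hl, sub_smul, mul_smul]⟩
    set z := a' - c • a
    rw [← sub_eq_zero]
    change z = 0
    by_contra hz0
    obtain ⟨w, hw⟩ : ∃ w, z w ≠ 0 := by
      by_contra! h0
      exact hz0 (LinearMap.ext h0)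
    obtain ⟨k, hk⟩ := hzw w
    have hk0 : k ≠ 0 := by
      rintro rfl
      exact hw (by rw [hk, zero_smul])
    have hse : ∀ D, pairing f (lin (a e) * lin e * D) = 0 := by
      intro D
      have h1 := hz w e D
      rw [hze, hk, map_smul, map_zero, mul_zero, zero_mul, map_zero, smul_mul_assoc,
        smul_mul_assoc, map_smul, smul_eq_mul] at h1
      exact (mul_eq_zero.1 h1).resolve_left hk0
    refine he (hn.eq_zero_of_mul hf hd fun x D => ?_)
    obtain ⟨l, hl⟩ := line h e he x
    rw [ha, hl, map_smul, mul_smul_comm, smul_mul_assoc, map_smul, mul_comm (lin e), hse, smul_zero]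

end RankOne

/-! ### Nilpotent endomorphisms -/

section Endomorphisms

variable {K V : Type*} [Field K] [AddCommGroup V] [Module K V]

theorem linearIndependent_four {n : Module.End K V} (hn : ∀ v, n (n v) = 0) {v w : V}
    (h : LinearIndependent K ![n v, n w]) : LinearIndependent K ![v, w, n v, n w] := by
  rw [LinearIndependent.pair_iff] at h
  rw [Fintype.linearIndependent_iff]
  intro g hg
  simp only [Fin.sum_univ_four, Matrix.cons_val] at hg
  have h1 := congrArg n hg
  simp only [map_add, map_smul, hn, smul_zero, add_zero, map_zero] at h1
  obtain ⟨h2, h3⟩ := h _ _ h1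
  rw [h2, h3, zero_smul, zero_smul, zero_add, zero_add] at hg
  obtain ⟨h4, h5⟩ := h _ _ hg
  intro i
  fin_cases i
  exacts [h2, h3, h4, h5]

theorem eq_zero_of_isNilpotent {n : Module.End K V} (hn : IsNilpotent n) {v : V} (hv : v ≠ 0)
    {c : K} (h : n v = c • v) : c = 0 := by
  obtain ⟨k, hk⟩ := hn
  have h1 : ∀ k, (n ^ k) v = c ^ k • v := by
    intro k
    induction k with
    | zero => simp
    | succ k ih => rw [pow_succ, Module.End.mul_apply, h, map_smul, ih, smul_smul, pow_succ']
  have h2 := h1 k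
  rw [hk, LinearMap.zero_apply] at h2
  exact eq_zero_of_pow_eq_zero ((smul_eq_zero.1 h2.symm).resolve_right hv)

/-- A nilpotent endomorphism of maximal order is cyclic. -/
theorem exists_aeval_apply_eq {n : Module.End K V} (hn : IsNilpotent n) (U : Submodule K V)
    [FiniteDimensional K U] (hU : ∀ u ∈ U, n u ∈ U) {u : V} (hu : u ∈ U)
    (h : (n ^ (Module.finrank K U - 1)) u ≠ 0) {w : V} (hw : w ∈ U) :
    ∃ P : K[X], aeval n P u = w := by
  have hmem : ∀ P : K[X], aeval n P u ∈ U := by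
    intro P
    induction P using Polynomial.induction_on' with
    | add p q hp hq => rw [map_add]; exact U.add_mem hp hq
    | monomial k c =>
      rw [aeval_monomial, ← Algebra.smul_def, LinearMap.smul_apply]
      refine U.smul_mem _ ?_
      induction k with
      | zero => simpa
      | succ k ih => rw [pow_succ', Module.End.mul_apply]; exact hU _ ih
  let T : degreeLT K (Module.finrank K U) →ₗ[K] U :=
    { toFun P := ⟨aeval n P.1 u, hmem P.1⟩
      map_add' P Q := by ext; simp
      map_smul' c P := by ext; simp }
  have hinj : Function.Injective T := by
    rw [injective_iff_map_eq_zero]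
    rintro ⟨P, hP⟩ h0
    have h0' : aeval n P u = 0 := congrArg Subtype.val h0
    ext1
    by_contra hP0
    change P ≠ 0 at hP0
    obtain ⟨Q, hQ, hQ'⟩ := exists_eq_pow_rootMultiplicity_mul_and_not_dvd P hP0 0
    rw [map_zero, sub_zero] at hQ hQ'
    set j := rootMultiplicity 0 P
    obtain ⟨k, hk⟩ := hn
    obtain ⟨s, t, hst⟩ : IsCoprime (X ^ k) Q := (irreducible_X.coprime_iff_not_dvd.2 hQ').pow_left
    have h1 : aeval n t * aeval n Q = 1 := by
      rw [← map_mul, ← map_one (aeval n : K[X] →ₐ[K] _), ← hst, map_add, map_mul _ s, map_pow,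
        aeval_X, hk, mul_zero, zero_add]
    have h2 : (n ^ j) u = 0 := by
      have h3 : aeval n (t * P) u = 0 := by
        rw [map_mul, Module.End.mul_apply, h0', map_zero]
      rw [hQ, mul_left_comm, map_mul, map_mul, h1, mul_one, map_pow, aeval_X] at h3
      exact h3
    have h4 : j < Module.finrank K U := by
      have h5 := mem_degreeLT.1 hP
      rw [degree_eq_natDegree hP0, Nat.cast_lt] at h5
      refine lt_of_le_of_lt ?_ h5
      have h6 : (X ^ j : K[X]) ∣ P := ⟨Q, hQ⟩
      simpa using natDegree_le_of_dvd h6 hP0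
    apply h
    rw [show Module.finrank K U - 1 = (Module.finrank K U - 1 - j) + j by omega, pow_add,
      Module.End.mul_apply, h2, map_zero]
  have hfin : FiniteDimensional K (degreeLT K (Module.finrank K U)) :=
    (degreeLTEquiv K (Module.finrank K U)).symm.finiteDimensional
  have hsurj : Function.Surjective T := by
    rw [← LinearMap.injective_iff_surjective_of_finrank_eq_finrank]
    · exact hinj
    · rw [(degreeLTEquiv K (Module.finrank K U)).finrank_eq]
      simp
  obtain ⟨P, hP⟩ := hsurj ⟨w, hw⟩
  exact ⟨P.1, congrArg Subtype.val hP⟩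

end Endomorphisms

/-! ### Local factors of the centre -/

section Local

variable {K : Type u} [Field K] {r d : ℕ} {f : DPoly r K}
variable {hf : f ∈ forms r K d} {hn : Nondegenerate f} {hd : 3 ≤ d}

theorem centre_apply_comm (a b : centre hf hn hd) (v : Fin r → K) :
    a.1 (b.1 v) = b.1 (a.1 v) :=
  LinearMap.congr_fun (congrArg Subtype.val (mul_comm a b)) v

theorem centre_isNilpotent {n : centre hf hn hd} (h : IsNilpotent n) : IsNilpotent n.1 :=
  h.map (centre hf hn hd).val

theorem aeval_centre (n : centre hf hn hd) (P : K[X]) : (aeval n P).1 = aeval n.1 P :=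
  (aeval_algHom_apply (centre hf hn hd).val n P).symm

/-- A nilpotent element of the largest possible order acts cyclically on the range of `e`, and an
algebra of endomorphisms that commute with a cyclic one consists of polynomials in it. -/
theorem isMonogenicAt_of_pow_ne_zero {e n : centre hf hn hd} (he : IsIdempotentElem e)
    (hen : e * n = n) (hnil : IsNilpotent n)
    (h : e * n ^ (Module.finrank K (LinearMap.range e.1) - 1) ≠ 0) : IsMonogenicAt K e := by
  obtain ⟨v, hv⟩ : ∃ v, (n.1 ^ (Module.finrank K (LinearMap.range e.1) - 1)) (e.1 v) ≠ 0 := by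
    by_contra! h0
    apply h
    rw [mul_comm]
    exact Subtype.ext (LinearMap.ext h0)
  have hcyc := fun w => exists_aeval_apply_eq (w := w) (centre_isNilpotent hnil)
    (LinearMap.range e.1) (fun u _ => ⟨n.1 u, LinearMap.congr_fun (congrArg Subtype.val hen) u⟩)
    ⟨v, rfl⟩ hv
  refine ⟨n, fun z => ?_⟩
  obtain ⟨P, hP⟩ := hcyc (e.1 (z.1 (e.1 v))) ⟨_, rfl⟩
  refine ⟨P, Subtype.ext (LinearMap.ext fun w => ?_)⟩
  obtain ⟨Q, hQ⟩ := hcyc (e.1 w) ⟨_, rfl⟩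
  have hee : ∀ x, e.1 (e.1 x) = e.1 x := fun x => LinearMap.congr_fun (congrArg Subtype.val he) x
  rw [← aeval_centre] at hP hQ
  calc e.1 (z.1 w) = e.1 (z.1 (e.1 w)) := by
        rw [centre_apply_comm z e, hee]
    _ = (aeval n P).1 (e.1 w) := by
        rw [← hQ, centre_apply_comm z, centre_apply_comm e, ← hP, centre_apply_comm]
    _ = e.1 ((aeval n P).1 w) := centre_apply_comm _ _ _

/-- A local factor whose nilpotent elements form at most a line is generated by one element. -/
theorem isMonogenicAt_of_isNilpotent {e : centre hf hn hd}
    (hloc : ∀ z, ∃ c : K, IsNilpotent (e * z - c • e)) (he : IsIdempotentElem e)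
    (n₀ : centre hf hn hd)
    (h : ∀ n, e * n = n → IsNilpotent n → ∃ k : K, n = k • n₀) : IsMonogenicAt K e := by
  refine ⟨n₀, fun z => ?_⟩
  obtain ⟨c, hc⟩ := hloc z
  have hen : e * (e * z - c • e) = e * z - c • e := by
    rw [mul_sub, ← mul_assoc, he.eq, mul_smul_comm, he.eq]
  obtain ⟨k, hk⟩ := h _ hen hc
  refine ⟨C c + C k * X, ?_⟩
  have h1 : e * z = c • e + k • e * n₀ := by
    rw [smul_mul_assoc, ← mul_smul_comm, ← hk, hen, add_sub_cancel]
  rw [h1]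
  simp only [map_add, map_mul, aeval_C, aeval_X, Algebra.smul_def]
  ring

/-- A local factor is generated by one element if its nilpotent elements have rank at most one,
since they are then proportional. -/
theorem isMonogenicAt_of_rank_le_one {e : centre hf hn hd}
    (hloc : ∀ z, ∃ c : K, IsNilpotent (e * z - c • e)) (he : IsIdempotentElem e)
    (h : ∀ n, e * n = n → IsNilpotent n → ∀ v w, ¬ LinearIndependent K ![n.1 v, n.1 w]) :
    IsMonogenicAt K e := by
  by_cases h0 : ∀ n, e * n = n → IsNilpotent n → n = 0
  · exact isMonogenicAt_of_isNilpotent hloc he 0 fun n hen hnil => ⟨0, by simp [h0 n hen hnil]⟩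
  push Not at h0
  obtain ⟨n₀, hen₀, hnil₀, hn₀⟩ := h0
  refine isMonogenicAt_of_isNilpotent hloc he n₀ fun n hen hnil => ?_
  obtain ⟨k, hk⟩ := Balanced.exists_eq_smul hn hf (by omega) n₀.2 n.2
    (fun h0 => hn₀ (Subtype.ext h0)) (h n₀ hen₀ hnil₀) (h n hen hnil)
    (h (n₀ + n) (by rw [mul_add, hen₀, hen]) ((Commute.all n₀ n).isNilpotent_add hnil₀ hnil))
  exact ⟨k, Subtype.ext hk⟩

/-- If no nilpotent element of the factor acts cyclically on the range of `e`, of dimension at most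
three, then all of them have square zero. Their rank is at most one, because a square-zero
endomorphism of rank two needs a space of dimension four. -/
theorem isMonogenicAt_of_finrank_le_three {e : centre hf hn hd}
    (hloc : ∀ z, ∃ c : K, IsNilpotent (e * z - c • e)) (he : IsIdempotentElem e)
    (hrank : Module.finrank K (LinearMap.range e.1) ≤ 3) : IsMonogenicAt K e := by
  by_cases h : ∃ n, e * n = n ∧ IsNilpotent n ∧
      e * n ^ (Module.finrank K (LinearMap.range e.1) - 1) ≠ 0
  · obtain ⟨n, h1, h2, h3⟩ := h
    exact isMonogenicAt_of_pow_ne_zero he h1 h2 h3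
  push Not at h
  refine isMonogenicAt_of_rank_le_one hloc he fun n hen hnil v w hvw => ?_
  have h1 := h n hen hnil
  have hsq : ∀ v, n.1 (n.1 v) = 0 := by
    have h2 : e * n ^ 2 = 0 := by
      rw [show 2 = (Module.finrank K (LinearMap.range e.1) - 1) +
        (2 - (Module.finrank K (LinearMap.range e.1) - 1)) by omega, pow_add, ← mul_assoc, h1,
        zero_mul]
    rw [pow_two, ← mul_assoc, hen] at h2
    exact fun v => LinearMap.congr_fun (congrArg Subtype.val h2) v
  have hev : ∀ v, n.1 (e.1 v) = n.1 v := fun v => by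
    rw [← centre_apply_comm]
    exact LinearMap.congr_fun (congrArg Subtype.val hen) v
  have hev' : ∀ v, e.1 (n.1 v) = n.1 v := LinearMap.congr_fun (congrArg Subtype.val hen)
  rw [← hev v, ← hev w] at hvw
  have hli := linearIndependent_four hsq hvw
  have hle : Submodule.span K (Set.range ![e.1 v, e.1 w, n.1 (e.1 v), n.1 (e.1 w)]) ≤
      LinearMap.range e.1 := by
    rw [Submodule.span_le]
    rintro _ ⟨i, rfl⟩
    fin_cases i
    exacts [⟨v, rfl⟩, ⟨w, rfl⟩, ⟨_, hev' _⟩, ⟨_, hev' _⟩]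
  have h3 := Submodule.finrank_mono hle
  rw [finrank_span_eq_card hli, Fintype.card_fin] at h3
  omega

end Local

/-! ### Local centres in four variables -/

section RankFour

variable {K : Type u} [Field K] {d : ℕ} {f : DPoly 4 K}
variable {hf : f ∈ forms 4 K d} {hn : Nondegenerate f} {hd : 3 ≤ d}

/-- Two central elements with `x² = 0`, `y² = c xy`, `xy ≠ 0` make the space of linear forms a free
module of rank one over the centre, and the form deforms to a sum of four powers. -/
theorem deformsToSplitting_of_mul_ne_zero [Infinite K] {x y : centre hf hn hd} (hxx : x * x = 0)
    {c : K} (hyy : y * y = c • (x * y)) (hxy : x * y ≠ 0) :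
    DeformsToSplitting d f (Module.finrank K (centre hf hn hd)) := by
  obtain ⟨e, he⟩ : ∃ e, x.1 (y.1 e) ≠ 0 := by
    by_contra! h0
    exact hxy (Subtype.ext (LinearMap.ext h0))
  have hx : ∀ v, x.1 (x.1 v) = 0 := LinearMap.congr_fun (congrArg Subtype.val hxx)
  have hy : ∀ v, y.1 (y.1 v) = c • x.1 (y.1 v) := LinearMap.congr_fun (congrArg Subtype.val hyy)
  have hyx : ∀ v, y.1 (x.1 v) = x.1 (y.1 v) := fun v => centre_apply_comm y x v
  have hli : LinearIndependent K ![e, x.1 e, y.1 e, x.1 (y.1 e)] := by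
    rw [Fintype.linearIndependent_iff]
    intro g hg
    simp only [Fin.sum_univ_four, Matrix.cons_val] at hg
    have h0 := congrArg x.1 (congrArg y.1 hg)
    simp only [map_add, map_smul, hyx, hy, hx, smul_zero, add_zero, map_zero] at h0
    have h0 := (smul_eq_zero.1 h0).resolve_right he
    rw [h0, zero_smul, zero_add] at hg
    have h2 := congrArg x.1 hg
    simp only [map_add, map_smul, hx, smul_zero, add_zero, zero_add, map_zero] at h2
    have h2 := (smul_eq_zero.1 h2).resolve_right he
    rw [h2, zero_smul, add_zero] at hg
    have h1 := congrArg y.1 hg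
    simp only [map_add, map_smul, hyx, hy, hx, smul_zero, add_zero, map_zero] at h1
    have h1 := (smul_eq_zero.1 h1).resolve_right he
    rw [h1, zero_smul, zero_add] at hg
    have h3 := (smul_eq_zero.1 hg).resolve_right he
    intro i
    fin_cases i
    exacts [h0, h1, h2, h3]
  let b := basisOfLinearIndependentOfCardEqFinrank hli (by simp)
  have hb : ⇑b = ![e, x.1 e, y.1 e, x.1 (y.1 e)] :=
    coe_basisOfLinearIndependentOfCardEqFinrank hli (by simp)
  let m : Fin 4 → centre hf hn hd := ![1, x, y, x * y]
  have hm : ∀ i, (m i).1 e = b i := by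
    rw [hb]
    intro i
    fin_cases i <;> rfl
  let T : centre hf hn hd →ₗ[K] (Fin 4 → K) :=
    { toFun z := z.1 e
      map_add' _ _ := rfl
      map_smul' _ _ := rfl }
  have hT : Function.Bijective T := by
    constructor
    · rw [injective_iff_map_eq_zero]
      intro z hz
      refine Subtype.ext (b.ext fun i => ?_)
      rw [← hm, centre_apply_comm]
      change (m i).1 (T z) = 0
      rw [hz, map_zero]
    · intro v
      refine ⟨∑ i, b.repr v i • m i, ?_⟩
      conv_rhs => rw [← b.sum_repr v]
      rw [map_sum]
      exact Finset.sum_congr rfl fun i _ => by rw [map_smul, ← hm]; rfl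
  rw [(LinearEquiv.ofBijective T hT).finrank_eq, Module.finrank_fin_fun]
  exact deformsToSplitting_four (by omega) hf hn x.2 y.2 (congrArg Subtype.val (mul_comm x y))
    (x * y).2 (congrArg Subtype.val hxx) c (congrArg Subtype.val hyy) b hb

/-- If the image of a vector `e` under every central element is a combination of `e`, `a e`,
`a² e`, with `a³ = 0` and `a² e ≠ 0`, then the centre is generated by `a`. -/
theorem isMonogenicAt_of_apply_mem
    {a : centre hf hn hd} (ha : ∀ v, a.1 (a.1 (a.1 v)) = 0) {e : Fin 4 → K}
    (he : a.1 (a.1 e) ≠ 0)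
    (hloc : ∀ z : centre hf hn hd, ∃ c : K, IsNilpotent (z - c • 1))
    (h : ∀ z : centre hf hn hd, z.1 e ∈ Submodule.span K {e, a.1 e, a.1 (a.1 e)}) :
    IsMonogenicAt K (1 : centre hf hn hd) := by
  have hz : ∀ z : centre hf hn hd, z.1 e = 0 → z = 0 := by
    intro z hz
    have hz1 : z.1 (a.1 e) = 0 := by rw [centre_apply_comm, hz, map_zero]
    have hz2 : z.1 (a.1 (a.1 e)) = 0 := by rw [centre_apply_comm, hz1, map_zero]
    have hnil : IsNilpotent z := by
      obtain ⟨c, hc⟩ := hloc z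
      have h1 := eq_zero_of_isNilpotent (centre_isNilpotent hc) (c := -c) (v := e)
        (fun h0 => he (by rw [h0, map_zero, map_zero]))
        (by
          change z.1 e - c • e = _
          rw [hz, zero_sub, neg_smul])
      rwa [neg_eq_zero.1 h1, zero_smul, sub_zero] at hc
    by_contra hz0
    obtain ⟨w, hw⟩ : ∃ w, z.1 w ≠ 0 := by
      by_contra! h0
      exact hz0 (Subtype.ext (LinearMap.ext h0))
    have hli : LinearIndependent K ![e, a.1 e, a.1 (a.1 e), w] := by
      rw [Fintype.linearIndependent_iff]
      intro g hg
      simp only [Fin.sum_univ_four, Matrix.cons_val] at hg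
      have h3 := congrArg z.1 hg
      simp only [map_add, map_smul, hz, hz1, hz2, smul_zero, zero_add, map_zero] at h3
      have h3 := (smul_eq_zero.1 h3).resolve_right hw
      rw [h3, zero_smul, add_zero] at hg
      have h0 := congrArg a.1 (congrArg a.1 hg)
      simp only [map_add, map_smul, ha, smul_zero, add_zero, map_zero] at h0
      have h0 := (smul_eq_zero.1 h0).resolve_right he
      rw [h0, zero_smul, zero_add] at hg
      have h1 := congrArg a.1 hg
      simp only [map_add, map_smul, ha, smul_zero, add_zero, map_zero] at h1
      have h1 := (smul_eq_zero.1 h1).resolve_right he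
      rw [h1, zero_smul, zero_add] at hg
      have h2 := (smul_eq_zero.1 hg).resolve_right he
      intro i
      fin_cases i
      exacts [h0, h1, h2, h3]
    let b := basisOfLinearIndependentOfCardEqFinrank hli (by simp)
    have hb : ⇑b = ![e, a.1 e, a.1 (a.1 e), w] :=
      coe_basisOfLinearIndependentOfCardEqFinrank hli (by simp)
    have hdec : ∀ v, ∃ g : Fin 4 → K,
        v = g 0 • e + g 1 • a.1 e + g 2 • a.1 (a.1 e) + g 3 • w := fun v => ⟨b.repr v, by
      conv_lhs => rw [← b.sum_repr v]
      simp [Fin.sum_univ_four, hb]⟩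
    obtain ⟨g, hg⟩ := hdec (z.1 w)
    obtain ⟨k, hk⟩ := hdec (a.1 w)
    -- The image of `z` is spanned by a multiple of `a² e`.
    have hk3 : k 3 = 0 := by
      refine eq_zero_of_isNilpotent (n := a.1) (v := z.1 w) ⟨3, LinearMap.ext ha⟩ hw ?_
      rw [centre_apply_comm, hk]
      simp [hz, hz1, hz2]
    have hg3 : g 3 = 0 := by
      refine eq_zero_of_isNilpotent (centre_isNilpotent hnil) hw ?_
      conv_lhs => rw [hg]
      simp [hz, hz1, hz2]
    have haz : a.1 (z.1 w) = 0 := by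
      rw [centre_apply_comm, hk]
      simp [hz, hz1, hz2, hk3]
    rw [hg3, zero_smul, add_zero] at hg
    rw [hk3, zero_smul, add_zero] at hk
    have haz' := haz
    rw [hg] at haz'
    have hg0 := congrArg a.1 haz'
    simp only [map_add, map_smul, ha, smul_zero, add_zero, map_zero] at hg0 haz'
    have hg0 := (smul_eq_zero.1 hg0).resolve_right he
    rw [hg0, zero_smul, zero_add] at haz'
    have hg1 := (smul_eq_zero.1 haz').resolve_right he
    rw [hg0, hg1, zero_smul, zero_smul, zero_add, zero_add] at hg
    have hk0 := congrArg a.1 (congrArg a.1 hk)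
    simp only [map_add, map_smul, ha, smul_zero, add_zero] at hk0
    have hk0 := (smul_eq_zero.1 hk0.symm).resolve_right he
    -- The derivative of `f` along `z w` vanishes.
    have hT : ∀ x, z.1 x = 0 → ∀ D, pairing f (lin (z.1 w) * lin x * D) = 0 := fun x hx D => by
      rw [z.2, hx, map_zero, mul_zero, zero_mul, map_zero]
    have hw' : ∀ D, pairing f (lin (z.1 w) * lin w * D) = 0 := by
      intro D
      have h1 := hT e hz D
      have h2 : a.1 (a.1 w) = k 1 • a.1 (a.1 e) := by
        rw [hk, hk0]
        simp [ha]
      have hg2 : g 2 ≠ 0 := by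
        intro h0
        rw [h0, zero_smul] at hg
        exact hw hg
      rw [hg, map_smul, smul_mul_assoc, smul_mul_assoc, map_smul, smul_eq_mul] at h1
      have h1 := (mul_eq_zero.1 h1).resolve_left hg2
      rw [hg, map_smul, smul_mul_assoc, smul_mul_assoc, map_smul, a.2, a.2, h2, map_smul,
        mul_smul_comm, smul_mul_assoc, map_smul, mul_comm (lin e), h1, smul_zero, smul_zero]
    refine hw (hn.eq_zero_of_mul hf (by omega) fun x D => ?_)
    obtain ⟨l, rfl⟩ := hdec x
    simp [mul_add, add_mul, hT e hz, hT _ hz1, hT _ hz2, hw']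
  refine ⟨a, fun z => ?_⟩
  obtain ⟨k₀, k₁, k₂, hk⟩ := Submodule.mem_span_triple.1 (h z)
  refine ⟨C k₀ + C k₁ * X + C k₂ * X ^ 2, ?_⟩
  rw [one_mul, one_mul, ← sub_eq_zero]
  apply hz
  simp only [map_add, map_mul, map_pow, aeval_C, aeval_X, ← Algebra.smul_def]
  change z.1 e - (algebraMap K (centre hf hn hd) k₀ + k₁ • a + k₂ • a ^ 2).1 e = 0
  rw [Algebra.algebraMap_eq_smul_one, pow_two, sub_eq_zero, ← hk]
  rfl

/-- If some central element has cube zero and nonzero square, then the centre is generated by one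
element, or it has a basis `1, x, y, xy` with `x² = 0` and `y² = c xy`. -/
theorem isMonogenicAt_or_deformsToSplitting_of_sq_ne_zero [IsAlgClosed K]
    (hloc : ∀ z : centre hf hn hd, ∃ c : K, IsNilpotent (z - c • 1))
    {a : centre hf hn hd} (ha : a * a * a = 0) (ha2 : a * a ≠ 0) :
    IsMonogenicAt K (1 : centre hf hn hd) ∨
      DeformsToSplitting d f (Module.finrank K (centre hf hn hd)) := by
  have : Infinite K := IsAlgClosed.instInfinite
  obtain ⟨e, he⟩ : ∃ e, a.1 (a.1 e) ≠ 0 := by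
    by_contra! h0
    exact ha2 (Subtype.ext (LinearMap.ext h0))
  have hav : ∀ v, a.1 (a.1 (a.1 v)) = 0 := fun v => LinearMap.congr_fun (congrArg Subtype.val ha) v
  by_cases hbe : ∀ z : centre hf hn hd, z.1 e ∈ Submodule.span K {e, a.1 e, a.1 (a.1 e)}
  · exact .inl (isMonogenicAt_of_apply_mem hav he hloc hbe)
  right
  have he_mem : e ∈ Submodule.span K {e, a.1 e, a.1 (a.1 e)} := Submodule.subset_span (by simp)
  have hae_mem : a.1 e ∈ Submodule.span K {e, a.1 e, a.1 (a.1 e)} :=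
    Submodule.subset_span (by simp)
  have hae2_mem : a.1 (a.1 e) ∈ Submodule.span K {e, a.1 e, a.1 (a.1 e)} :=
    Submodule.subset_span (by simp)
  obtain ⟨b, hbnil, hbe⟩ : ∃ b : centre hf hn hd, IsNilpotent b ∧
      b.1 e ∉ Submodule.span K {e, a.1 e, a.1 (a.1 e)} := by
    push Not at hbe
    obtain ⟨z, hz⟩ := hbe
    obtain ⟨c, hc⟩ := hloc z
    refine ⟨_, hc, fun h => hz ?_⟩
    have h1 : z.1 e = (z - c • 1 : centre hf hn hd).1 e + c • e :=
      (sub_add_cancel (z.1 e) (c • e)).symm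
    rw [h1]
    exact Submodule.add_mem _ h (Submodule.smul_mem _ _ he_mem)
  -- Any such `b` completes `1, a, a²` to a basis of the centre.
  have hdec : ∀ b : centre hf hn hd, b.1 e ∉ Submodule.span K {e, a.1 e, a.1 (a.1 e)} →
      (∀ v, ∃ k : Fin 4 → K, v = k 0 • e + k 1 • a.1 e + k 2 • a.1 (a.1 e) + k 3 • b.1 e) ∧
      ∀ z : centre hf hn hd, ∃ k : Fin 4 → K,
        z = k 0 • 1 + k 1 • a + k 2 • (a * a) + k 3 • b := by
    intro b hbe
    have hli : LinearIndependent K ![e, a.1 e, a.1 (a.1 e), b.1 e] := by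
      rw [Fintype.linearIndependent_iff]
      intro g hg
      simp only [Fin.sum_univ_four, Matrix.cons_val] at hg
      have h3 : g 3 = 0 := by
        by_contra h3
        apply hbe
        have h4 : b.1 e = -(g 3)⁻¹ • (g 0 • e + g 1 • a.1 e + g 2 • a.1 (a.1 e)) := by
          rw [eq_neg_of_add_eq_zero_left hg, smul_neg, neg_smul, neg_neg, smul_smul,
            inv_mul_cancel₀ h3, one_smul]
        rw [h4]
        exact Submodule.smul_mem _ _ (Submodule.add_mem _ (Submodule.add_mem _
          (Submodule.smul_mem _ _ he_mem) (Submodule.smul_mem _ _ hae_mem))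
          (Submodule.smul_mem _ _ hae2_mem))
      rw [h3, zero_smul, add_zero] at hg
      have h0 := congrArg a.1 (congrArg a.1 hg)
      simp only [map_add, map_smul, hav, smul_zero, add_zero, map_zero] at h0
      have h0 := (smul_eq_zero.1 h0).resolve_right he
      rw [h0, zero_smul, zero_add] at hg
      have h1 := congrArg a.1 hg
      simp only [map_add, map_smul, hav, smul_zero, add_zero, map_zero] at h1
      have h1 := (smul_eq_zero.1 h1).resolve_right he
      rw [h1, zero_smul, zero_add] at hg
      have h2 := (smul_eq_zero.1 hg).resolve_right he
      intro i
      fin_cases i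
      exacts [h0, h1, h2, h3]
    let B := basisOfLinearIndependentOfCardEqFinrank hli (by simp)
    have hB : ⇑B = ![e, a.1 e, a.1 (a.1 e), b.1 e] :=
      coe_basisOfLinearIndependentOfCardEqFinrank hli (by simp)
    have h1 : ∀ v, ∃ k : Fin 4 → K,
        v = k 0 • e + k 1 • a.1 e + k 2 • a.1 (a.1 e) + k 3 • b.1 e := fun v => ⟨B.repr v, by
      conv_lhs => rw [← B.sum_repr v]
      simp [Fin.sum_univ_four, hB]⟩
    refine ⟨h1, fun z => ?_⟩
    obtain ⟨k, hk⟩ := h1 (z.1 e)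
    refine ⟨k, ?_⟩
    rw [← sub_eq_zero]
    set y := z - (k 0 • 1 + k 1 • a + k 2 • (a * a) + k 3 • b)
    have hy : y.1 e = 0 := by
      change z.1 e - (k 0 • e + k 1 • a.1 e + k 2 • a.1 (a.1 e) + k 3 • b.1 e) = 0
      rw [hk, sub_self]
    refine Subtype.ext (LinearMap.ext fun v => ?_)
    obtain ⟨l, rfl⟩ := h1 v
    simp [centre_apply_comm y a, centre_apply_comm y b, hy]
  have hzero : ∀ {k₀ k₁ k₂ : K}, k₀ • (1 : centre hf hn hd) + k₁ • a + k₂ • (a * a) = 0 →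
      k₀ = 0 ∧ k₁ = 0 ∧ k₂ = 0 := by
    intro k₀ k₁ k₂ h
    have hg : k₀ • e + k₁ • a.1 e + k₂ • a.1 (a.1 e) = 0 :=
      LinearMap.congr_fun (congrArg Subtype.val h) e
    have h0 := congrArg a.1 (congrArg a.1 hg)
    simp only [map_add, map_smul, hav, smul_zero, add_zero, map_zero] at h0
    have h0 := (smul_eq_zero.1 h0).resolve_right he
    rw [h0, zero_smul, zero_add] at hg
    have h1 := congrArg a.1 hg
    simp only [map_add, map_smul, hav, smul_zero, add_zero, map_zero] at h1
    have h1 := (smul_eq_zero.1 h1).resolve_right he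
    rw [h1, zero_smul, zero_add] at hg
    exact ⟨h0, h1, (smul_eq_zero.1 hg).resolve_right he⟩
  have hnot : ∀ b : centre hf hn hd, b.1 e ∉ Submodule.span K {e, a.1 e, a.1 (a.1 e)} →
      ∀ {k₀ k₁ k₂ δ : K}, k₀ • (1 : centre hf hn hd) + k₁ • a + k₂ • (a * a) + δ • b = 0 →
        δ = 0 := by
    intro b hbe k₀ k₁ k₂ δ h
    by_contra hδ
    apply hbe
    have hg : k₀ • e + k₁ • a.1 e + k₂ • a.1 (a.1 e) + δ • b.1 e = 0 :=
      LinearMap.congr_fun (congrArg Subtype.val h) e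
    have h4 : b.1 e = -δ⁻¹ • (k₀ • e + k₁ • a.1 e + k₂ • a.1 (a.1 e)) := by
      rw [eq_neg_of_add_eq_zero_left hg, smul_neg, neg_smul, neg_neg, smul_smul,
        inv_mul_cancel₀ hδ, one_smul]
    rw [h4]
    exact Submodule.smul_mem _ _ (Submodule.add_mem _ (Submodule.add_mem _
      (Submodule.smul_mem _ _ he_mem) (Submodule.smul_mem _ _ hae_mem))
      (Submodule.smul_mem _ _ hae2_mem))
  -- Subtracting a multiple of `a` from `b` gives `ab = 0`.
  obtain ⟨b, hbnil, hbe, hab⟩ : ∃ b : centre hf hn hd, IsNilpotent b ∧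
      b.1 e ∉ Submodule.span K {e, a.1 e, a.1 (a.1 e)} ∧ a * b = 0 := by
    obtain ⟨k, hk⟩ := (hdec b hbe).2 (a * b)
    have anil : IsNilpotent a := ⟨3, by rw [pow_succ, pow_two, ha]⟩
    have h0 : k 0 = 0 := by
      have h1 : k 0 • (1 : centre hf hn hd) = a * (b - k 1 • 1 - k 2 • a) - k 3 • b := by
        simp only [mul_sub, mul_smul_comm, mul_one]
        rw [hk]
        abel
      have h2 : IsNilpotent (k 0 • (1 : centre hf hn hd)) := by
        rw [h1]
        exact (Commute.all _ _).isNilpotent_sub ((Commute.all _ _).isNilpotent_mul_right anil)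
          (hbnil.smul _)
      exact eq_zero_of_isNilpotent (centre_isNilpotent h2) (v := e) (c := k 0)
        (fun h0 => he (by rw [h0, map_zero, map_zero])) rfl
    rw [h0, zero_smul, zero_add] at hk
    have h3 : k 3 = 0 := by
      by_contra h3
      have e1 : k 3 • (a * a * b) = 0 := by
        have := congrArg (a * a * ·) hk
        simp only [mul_add, mul_smul_comm, ← mul_assoc, ha, zero_mul, smul_zero, zero_add] at this
        rw [← this]
      have e1 := (smul_eq_zero.1 e1).resolve_left h3
      have e2 := congrArg (a * ·) hk
      simp only [mul_add, mul_smul_comm, ← mul_assoc, ha, e1, smul_zero, add_zero] at e2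
      refine mul_ne_zero h3 h3 (hnot b hbe (k₀ := 0) (k₁ := k 3 * k 1)
        (k₂ := k 1 + k 3 * k 2) ?_)
      have e3 := congrArg (k 3 • ·) hk
      simp only [smul_add, smul_smul] at e3
      rw [zero_smul, zero_add, add_smul]
      rw [← sub_eq_zero] at e3
      linear_combination -e2 - e3
    rw [h3, zero_smul, add_zero] at hk
    have h1 : k 1 = 0 := by
      refine eq_zero_of_isNilpotent (centre_isNilpotent hbnil) he ?_
      have e2 := congrArg (a * ·) hk
      simp only [mul_add, mul_smul_comm, ← mul_assoc, ha, smul_zero, add_zero] at e2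
      rw [mul_comm] at e2
      exact LinearMap.congr_fun (congrArg Subtype.val e2) e
    rw [h1, zero_smul, zero_add] at hk
    refine ⟨b - k 2 • a, (Commute.all _ _).isNilpotent_sub hbnil (anil.smul _), fun h => hbe ?_,
      by rw [mul_sub, hk, mul_smul_comm, sub_self]⟩
    have h5 : b.1 e = (b - k 2 • a : centre hf hn hd).1 e + k 2 • a.1 e :=
      (sub_add_cancel (b.1 e) (k 2 • a.1 e)).symm
    rw [h5]
    exact Submodule.add_mem _ h (Submodule.smul_mem _ _ hae_mem)
  obtain ⟨ρ, hρ⟩ : ∃ ρ : K, b * b = ρ • (a * a) := by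
    obtain ⟨k, hk⟩ := (hdec b hbe).2 (b * b)
    have e1 := congrArg (a * ·) hk
    simp only [mul_add, mul_smul_comm, ← mul_assoc, ha, hab, zero_mul, smul_zero, add_zero,
      mul_one] at e1
    obtain ⟨-, h0, h1⟩ := hzero (k₀ := 0) (by rw [zero_smul, zero_add]; exact e1.symm)
    rw [h0, h1, zero_smul, zero_smul, zero_add, zero_add] at hk
    refine ⟨k 2, ?_⟩
    have h3 : k 3 = 0 := by
      by_cases hbb : b.1 (b.1 e) = 0
      · have h2 : k 2 • a.1 (a.1 e) + k 3 • b.1 e = 0 := by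
          rw [← hbb]
          exact (LinearMap.congr_fun (congrArg Subtype.val hk) e).symm
        by_contra h3
        apply hbe
        rw [(eq_inv_smul_iff₀ h3).2 (eq_neg_of_add_eq_zero_right h2)]
        exact Submodule.smul_mem _ _ (Submodule.neg_mem _ (Submodule.smul_mem _ _ hae2_mem))
      · refine eq_zero_of_isNilpotent (centre_isNilpotent hbnil) hbb ?_
        have e2 := congrArg (b * ·) hk
        simp only [mul_add, mul_smul_comm, ← mul_assoc, mul_comm b a, hab, zero_mul, smul_zero,
          zero_add] at e2
        exact LinearMap.congr_fun (congrArg Subtype.val e2) e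
    rw [hk, h3, zero_smul, add_zero]
  have hbav : ∀ v, b.1 (a.1 v) = 0 := by
    rw [mul_comm] at hab
    exact LinearMap.congr_fun (congrArg Subtype.val hab)
  have habv : ∀ v, a.1 (b.1 v) = 0 := fun v => by rw [centre_apply_comm, hbav]
  -- If `b² = 0`, then `b` and `a²` have rank one and the same kernel.
  have hρ0 : ρ ≠ 0 := by
    rintro rfl
    rw [zero_smul] at hρ
    have hbb : ∀ v, b.1 (b.1 v) = 0 := LinearMap.congr_fun (congrArg Subtype.val hρ)
    obtain ⟨c, hc⟩ := Balanced.exists_apply_eq_smul hn hf (a * a).2 b.2 (e := e) he (by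
      intro w
      obtain ⟨k, rfl⟩ := (hdec b hbe).1 w
      refine ⟨k 0, ?_, ?_⟩
      · change a.1 (a.1 _) = k 0 • a.1 (a.1 e)
        simp [hav, habv]
      · simp [hbav, hbb])
    apply hbe
    rw [hc]
    exact Submodule.smul_mem _ _ hae2_mem
  obtain ⟨κ, hκ⟩ := IsAlgClosed.exists_pow_nat_eq (-ρ) (n := 2) (by norm_num)
  have hκ0 : κ ≠ 0 := by
    rintro rfl
    apply hρ0
    simpa using hκ.symm
  -- Since `ab = 0` and `b² = -κ² a²`, the square of `b + κ a` vanishes.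
  refine deformsToSplitting_of_mul_ne_zero (x := b + κ • a) (y := a) (c := κ⁻¹) ?_ ?_ ?_
  · have h1 : (b + κ • a) * (b + κ • a) = (ρ + κ ^ 2) • (a * a) := by
      simp only [add_mul, mul_add, smul_mul_assoc, mul_smul_comm, mul_comm b a, hab, hρ, smul_zero,
        add_zero, zero_add, add_smul, smul_smul, pow_two]
    rw [h1, hκ, add_neg_cancel, zero_smul]
  · rw [add_mul, mul_comm b a, hab, zero_add, smul_mul_assoc, smul_smul, inv_mul_cancel₀ hκ0,
      one_smul]
  · rw [add_mul, mul_comm b a, hab, zero_add, smul_mul_assoc]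
    exact smul_ne_zero hκ0 ha2

end RankFour

/-! ### Centres with square-zero maximal ideal -/

section SquareZero

variable {K : Type u} [Field K] {d : ℕ} {f : DPoly 4 K}
variable {hf : f ∈ forms 4 K d} {hn : Nondegenerate f} {hd : 3 ≤ d}

/-- A square-zero endomorphism of rank two of a space of dimension four has a Jordan basis
consisting of `v, w, a v, a w`. -/
theorem exists_eq_combination {a : centre hf hn hd} (ha : ∀ v, a.1 (a.1 v) = 0) {v w : Fin 4 → K}
    (h : LinearIndependent K ![a.1 v, a.1 w]) (x : Fin 4 → K) :
    ∃ g : Fin 4 → K, x = g 0 • v + g 1 • w + g 2 • a.1 v + g 3 • a.1 w := by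
  let B := basisOfLinearIndependentOfCardEqFinrank (linearIndependent_four ha h) (by simp)
  have hB : ⇑B = ![v, w, a.1 v, a.1 w] :=
    coe_basisOfLinearIndependentOfCardEqFinrank _ (by simp)
  refine ⟨B.repr x, ?_⟩
  conv_lhs => rw [← B.sum_repr x]
  simp [Fin.sum_univ_four, hB]

/-- An endomorphism of square zero and rank two of a space of dimension four is exact. -/
theorem exists_eq_apply {a : centre hf hn hd} (ha : ∀ v, a.1 (a.1 v) = 0) {v w : Fin 4 → K}
    (h : LinearIndependent K ![a.1 v, a.1 w]) {x : Fin 4 → K} (hx : a.1 x = 0) :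
    ∃ y, x = a.1 y := by
  obtain ⟨g, rfl⟩ := exists_eq_combination ha h x
  simp only [map_add, map_smul, ha, smul_zero, add_zero] at hx
  obtain ⟨h0, h1⟩ := LinearIndependent.pair_iff.1 h _ _ hx
  exact ⟨g 2 • v + g 3 • w, by simp [h0, h1]⟩

/-- Central elements `a`, `b` with `a² = ab = b² = 0`, such that `a` has rank two and `b` is not a
multiple of `a`, can be normalized: after subtracting a multiple of `a` from `b` there is a basis
`e, v, a e, a v` with `b e = a v` and `b v = τ a v`. -/
theorem exists_normal_form [IsAlgClosed K] {a b : centre hf hn hd} (haa : a * a = 0)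
    (hab : a * b = 0) (hba : ∀ k : K, b ≠ k • a) {v w : Fin 4 → K}
    (h : LinearIndependent K ![a.1 v, a.1 w]) :
    ∃ (c τ : K) (e v : Fin 4 → K), LinearIndependent K ![a.1 e, a.1 v] ∧
      (b - c • a : centre hf hn hd).1 e = a.1 v ∧
        (b - c • a : centre hf hn hd).1 v = τ • a.1 v := by
  have ha : ∀ v, a.1 (a.1 v) = 0 := LinearMap.congr_fun (congrArg Subtype.val haa)
  have hb : ∀ v, a.1 (b.1 v) = 0 := LinearMap.congr_fun (congrArg Subtype.val hab)
  have himg : ∀ {v w : Fin 4 → K}, LinearIndependent K ![a.1 v, a.1 w] → ∀ {x}, a.1 x = 0 →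
      ∃ p q : K, x = p • a.1 v + q • a.1 w := by
    intro v w h x hx
    obtain ⟨y, rfl⟩ := exists_eq_apply ha h hx
    obtain ⟨g, rfl⟩ := exists_eq_combination ha h y
    exact ⟨g 0, g 1, by simp [ha]⟩
  -- An eigenvector of the endomorphism `a⁻¹ b` of the quotient by the image of `a`.
  obtain ⟨c, s, t, hst, hc⟩ : ∃ c s t : K, (s ≠ 0 ∨ t ≠ 0) ∧
      b.1 (s • v + t • w) = c • a.1 (s • v + t • w) := by
    obtain ⟨p₁, q₁, h₁⟩ := himg h (hb v)
    obtain ⟨p₂, q₂, h₂⟩ := himg h (hb w)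
    obtain ⟨c, hc⟩ := Module.End.exists_eigenvalue (Matrix.toLin' !![p₁, p₂; q₁, q₂])
    obtain ⟨x, hx, hx0⟩ := hc.exists_hasEigenvector
    rw [Module.End.mem_eigenspace_iff, Matrix.toLin'_apply] at hx
    have e0 := congrFun hx 0
    have e1 := congrFun hx 1
    simp only [Matrix.mulVec, dotProduct, Fin.sum_univ_two, Matrix.of_apply, Matrix.cons_val,
      Pi.smul_apply, smul_eq_mul] at e0 e1
    refine ⟨c, x 0, x 1, ?_, ?_⟩
    · by_contra! h0
      apply hx0
      ext i
      fin_cases i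
      exacts [h0.1, h0.2]
    · simp only [map_add, map_smul, h₁, h₂, smul_add, smul_smul]
      rw [← e0, ← e1]
      module
  set v' := s • v + t • w
  have hv' : a.1 v' ≠ 0 := by
    intro h0
    have h1 := LinearIndependent.pair_iff.1 h s t (by simpa [v'] using h0)
    rcases hst with hs | ht
    exacts [hs h1.1, ht h1.2]
  set b' : centre hf hn hd := b - c • a with hb'
  have hb'v : b'.1 v' = 0 := by
    change b.1 v' - c • a.1 v' = 0
    rw [hc, sub_self]
  clear_value v'
  have hb'a : ∀ x, b'.1 (a.1 x) = 0 := by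
    intro x
    change b.1 (a.1 x) - c • a.1 (a.1 x) = 0
    rw [centre_apply_comm, hb, ha, smul_zero, sub_zero]
  obtain ⟨u, hu⟩ : ∃ u, b'.1 u ≠ 0 := by
    by_contra! h0
    exact hba c (sub_eq_zero.1 (Subtype.ext (LinearMap.ext h0)))
  have hli : LinearIndependent K ![a.1 v', a.1 u] := by
    rw [LinearIndependent.pair_iff' hv']
    intro k hk
    obtain ⟨y, hy⟩ := exists_eq_apply ha h (x := u - k • v') (by
      rw [map_sub, map_smul, hk, sub_self])
    apply hu
    rw [sub_eq_iff_eq_add.1 hy, map_add, map_smul, hb'a, hb'v, smul_zero, add_zero]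
  obtain ⟨ρ, τ, hρ⟩ := himg hli (x := b'.1 u) (by rw [centre_apply_comm, hb'a])
  -- The vector `e = u + μ v'` is chosen such that `a e` and `b' e` are independent also if `ρ = 0`.
  obtain ⟨μ, hμ⟩ : ∃ μ : K, ρ - τ * μ ≠ 0 := by
    by_cases h0 : ρ = 0
    · refine ⟨1, fun h1 => hu ?_⟩
      have h2 : τ = 0 := by linear_combination h0 - h1
      rw [hρ, h0, h2, zero_smul, zero_smul, add_zero]
    · exact ⟨0, by simpa using h0⟩
  refine ⟨c, τ, u + μ • v', ρ • v' + τ • u, ?_, ?_, ?_⟩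
  · rw [LinearIndependent.pair_iff] at hli ⊢
    intro x y hxy
    obtain ⟨h1, h2⟩ := hli (x * μ + y * ρ) (x + y * τ) (by
      rw [← hxy]
      simp only [map_add, map_smul]
      module)
    have h3 : y * (ρ - τ * μ) = 0 := by linear_combination h1 - μ * h2
    have h4 := (mul_eq_zero.1 h3).resolve_right hμ
    exact ⟨by linear_combination h2 - τ * h4, h4⟩
  · rw [map_add, map_smul, hb'v, smul_zero, add_zero, hρ, map_add, map_smul, map_smul]
  · rw [map_add, map_smul, hb'v, smul_zero, zero_add, map_smul, hρ, map_add, map_smul, map_smul]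

/-- The case of a square-zero maximal ideal that contains an element `a` of rank two and is not
spanned by it. The normal form and nondegeneracy show that an element of the maximal ideal is
determined by its value at `e`, so that the centre has dimension three. -/
theorem deformsToSplitting_of_mul_eq_zero [IsAlgClosed K]
    (hloc : ∀ z : centre hf hn hd, ∃ c : K, IsNilpotent (z - c • 1))
    (hmul : ∀ x y : centre hf hn hd, IsNilpotent x → IsNilpotent y → x * y = 0)
    {a b : centre hf hn hd} (hanil : IsNilpotent a) (hbnil : IsNilpotent b)
    (hba : ∀ k : K, b ≠ k • a) {v w : Fin 4 → K} (h : LinearIndependent K ![a.1 v, a.1 w]) :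
    DeformsToSplitting d f (Module.finrank K (centre hf hn hd)) := by
  have haa := hmul a a hanil hanil
  have ha : ∀ v, a.1 (a.1 v) = 0 := LinearMap.congr_fun (congrArg Subtype.val haa)
  obtain ⟨c, τ, e, v, hli, hbe, hbv⟩ := exists_normal_form haa (hmul a b hanil hbnil) hba h
  clear h
  set b' : centre hf hn hd := b - c • a
  let B := basisOfLinearIndependentOfCardEqFinrank (linearIndependent_four ha hli) (by simp)
  have hB : ⇑B = ![e, v, a.1 e, a.1 v] :=
    coe_basisOfLinearIndependentOfCardEqFinrank _ (by simp)
  have hav0 : a.1 v ≠ 0 := fun h0 => by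
    have := (LinearIndependent.pair_iff.1 hli 0 1 (by simp [h0])).2
    exact one_ne_zero this
  have hx := exists_eq_combination ha hli
  have F1 : ∀ D, pairing f (lin (a.1 e) * lin v * D) = pairing f (lin (a.1 v) * lin e * D) := by
    intro D
    rw [a.2, mul_comm (lin e)]
  have F2 : ∀ D, pairing f (lin (a.1 v) * lin v * D) = τ * pairing f (lin (a.1 v) * lin e * D) := by
    intro D
    rw [← hbe, b'.2 e v, hbv, hbe, map_smul, mul_smul_comm, smul_mul_assoc, map_smul, smul_eq_mul,
      mul_comm (lin e)]
  have F3 : ∀ x y D, pairing f (lin (a.1 x) * lin (a.1 y) * D) = 0 := by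
    intro x y D
    rw [a.2, ha, map_zero, mul_zero, zero_mul, map_zero]
  -- A nilpotent central element that kills `e` vanishes.
  have key : ∀ z : centre hf hn hd, IsNilpotent z → z.1 e = 0 → z = 0 := by
    intro z hz hze
    have hza : ∀ x, z.1 (a.1 x) = 0 := by
      have := hmul z a hz hanil
      exact LinearMap.congr_fun (congrArg Subtype.val this)
    obtain ⟨α, γ, hαγ⟩ : ∃ α γ : K, z.1 v = α • a.1 e + γ • a.1 v := by
      obtain ⟨y, hy⟩ := exists_eq_apply ha hli (x := z.1 v) (by rw [centre_apply_comm, hza])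
      obtain ⟨g, rfl⟩ := hx y
      exact ⟨g 0, g 1, by rw [hy]; simp [ha]⟩
    have G1 : ∀ D, α * pairing f (lin (a.1 e) * lin e * D) +
        γ * pairing f (lin (a.1 v) * lin e * D) = 0 := by
      intro D
      have h1 := z.2 v e D
      rw [hze, map_zero, mul_zero, zero_mul, map_zero, hαγ] at h1
      simpa [add_mul] using h1
    have G2 : ∀ D, (α + γ * τ) * pairing f (lin (a.1 v) * lin e * (lin e * D)) = 0 := by
      intro D
      have h1 := G1 (lin v * D)
      rw [show ∀ x : Fin 4 → K, lin x * lin e * (lin v * D) = lin x * lin v * (lin e * D) by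
        intros; ring, show ∀ x : Fin 4 → K, lin x * lin e * (lin v * D) =
        lin x * lin v * (lin e * D) by intros; ring, F1, F2] at h1
      linear_combination h1
    have hατ : α + γ * τ = 0 := by
      by_contra h0
      have G3 : ∀ D, pairing f (lin (a.1 v) * lin e * (lin e * D)) = 0 := fun D =>
        (mul_eq_zero.1 (G2 D)).resolve_left h0
      have G4 : ∀ y D, pairing f (lin (a.1 v) * lin e * (lin y * D)) = 0 := by
        intro y D
        obtain ⟨g, rfl⟩ := hx y
        have h1 : pairing f (lin (a.1 v) * lin e * (lin v * D)) = 0 := by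
          rw [show lin (a.1 v) * lin e * (lin v * D) = lin (a.1 v) * lin v * (lin e * D) by ring,
            F2, G3, mul_zero]
        have h2 : ∀ x, pairing f (lin (a.1 v) * lin e * (lin (a.1 x) * D)) = 0 := by
          intro x
          rw [show lin (a.1 v) * lin e * (lin (a.1 x) * D) =
            lin (a.1 v) * lin (a.1 x) * (lin e * D) by ring, F3]
        simp [add_mul, mul_add, G3, h1, h2]
      apply hav0
      refine hn.eq_zero_of_mul_mul hf hd fun x y D => ?_
      obtain ⟨g, rfl⟩ := hx x
      simp [add_mul, mul_add, G4, F2, F3]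
    have hzv : z.1 v = 0 := by
      refine hn.eq_zero_of_mul hf (by omega) fun x D => ?_
      obtain ⟨g, rfl⟩ := hx x
      have h1 : pairing f (lin (z.1 v) * lin e * D) = 0 := by
        rw [z.2, hze, map_zero, mul_zero, zero_mul, map_zero]
      have h2 : pairing f (lin (z.1 v) * lin v * D) = 0 := by
        rw [hαγ]
        simp only [map_add, map_smul, add_mul, smul_mul_assoc, F1, F2, smul_eq_mul]
        linear_combination pairing f (lin (a.1 v) * lin e * D) * hατ
      have h3 : ∀ y, pairing f (lin (z.1 v) * lin (a.1 y) * D) = 0 := by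
        intro y
        rw [z.2, hza, map_zero, mul_zero, zero_mul, map_zero]
      simp [add_mul, mul_add, h1, h2, h3]
    refine Subtype.ext (LinearMap.ext fun x => ?_)
    obtain ⟨g, rfl⟩ := hx x
    simp [hze, hzv, hza]
  have hcard : Module.finrank K (centre hf hn hd) = 3 := by
    have hli3 : LinearIndependent K ![1, a, b'] := by
      rw [Fintype.linearIndependent_iff]
      intro g hg
      simp only [Fin.sum_univ_three, Matrix.cons_val] at hg
      have h1 : g 0 • e + g 1 • a.1 e + g 2 • b'.1 e = 0 :=
        LinearMap.congr_fun (congrArg Subtype.val hg) e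
      rw [hbe] at h1
      have h2 := Fintype.linearIndependent_iff.1 (linearIndependent_four ha hli)
        ![g 0, 0, g 1, g 2] (by simpa [Fin.sum_univ_four] using h1)
      intro i
      fin_cases i
      exacts [h2 0, h2 2, h2 3]
    have hspan : ⊤ ≤ Submodule.span K (Set.range ![1, a, b']) := by
      rintro z -
      obtain ⟨c₀, hc₀⟩ := hloc z
      set n := z - c₀ • 1 with hnz
      have han : a.1 (n.1 e) = 0 :=
        LinearMap.congr_fun (congrArg Subtype.val (hmul a n hanil hc₀)) e
      obtain ⟨y, hy⟩ := exists_eq_apply ha hli han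
      obtain ⟨g, rfl⟩ := hx y
      have h1 : n - g 0 • a - g 1 • b' = 0 := by
        refine key _ ((Commute.all _ _).isNilpotent_sub ((Commute.all _ _).isNilpotent_sub hc₀
          (hanil.smul _)) (((Commute.all _ _).isNilpotent_sub hbnil (hanil.smul _)).smul _)) ?_
        change n.1 e - g 0 • a.1 e - g 1 • b'.1 e = 0
        rw [hy, hbe]
        simp [ha]
      have h2 : z = c₀ • 1 + g 0 • a + g 1 • b' := by
        rw [← sub_eq_zero, ← h1, hnz]
        abel
      have hmem : ∀ i, (![1, a, b'] : Fin 3 → centre hf hn hd) i ∈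
          Submodule.span K (Set.range ![1, a, b']) := fun i => Submodule.subset_span ⟨i, rfl⟩
      rw [h2]
      exact Submodule.add_mem _ (Submodule.add_mem _ (Submodule.smul_mem _ _ (hmem 0))
        (Submodule.smul_mem _ _ (hmem 1))) (Submodule.smul_mem _ _ (hmem 2))
    rw [Module.finrank_eq_card_basis (Module.Basis.mk hli3 hspan), Fintype.card_fin]
  rw [hcard]
  exact deformsToSplitting_three (by omega) hf hn a.2 b'.2 (congrArg Subtype.val haa) B hB hbe hbv

/-- A local centre in four variables. The cases are distinguished by the largest order of nilpotency
of a central element; if all squares of nilpotent elements vanish, by the vanishing of their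
products and by their rank. -/
theorem isMonogenicAt_one_or_deformsToSplitting [IsAlgClosed K]
    (hloc : ∀ z : centre hf hn hd, ∃ c : K, IsNilpotent (z - c • 1)) :
    IsMonogenicAt K (1 : centre hf hn hd) ∨
      DeformsToSplitting d f (Module.finrank K (centre hf hn hd)) := by
  have : Infinite K := IsAlgClosed.instInfinite
  have hloc' : ∀ z : centre hf hn hd, ∃ c : K, IsNilpotent (1 * z - c • 1) := by simpa using hloc
  by_cases h3 : ∃ n : centre hf hn hd, IsNilpotent n ∧ n ^ 3 ≠ 0
  · obtain ⟨n, hnil, h3⟩ := h3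
    refine .inl (isMonogenicAt_of_pow_ne_zero .one (one_mul n) hnil ?_)
    have h1 : LinearMap.range (1 : centre hf hn hd).1 = ⊤ := LinearMap.range_id
    rw [h1, finrank_top, Module.finrank_fin_fun, one_mul]
    exact h3
  push Not at h3
  by_cases h2 : ∃ n : centre hf hn hd, IsNilpotent n ∧ n * n ≠ 0
  · obtain ⟨n, hnil, h2⟩ := h2
    refine isMonogenicAt_or_deformsToSplitting_of_sq_ne_zero hloc ?_ h2
    rw [← h3 n hnil, pow_succ, pow_two]
  push Not at h2
  by_cases h1 : ∃ x y : centre hf hn hd, IsNilpotent x ∧ IsNilpotent y ∧ x * y ≠ 0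
  · obtain ⟨x, y, hx, hy, hxy⟩ := h1
    exact .inr (deformsToSplitting_of_mul_ne_zero (c := 0) (h2 x hx) (by rw [h2 y hy, zero_smul])
      hxy)
  push Not at h1
  by_cases hr : ∃ (a : centre hf hn hd) (v w : Fin 4 → K), IsNilpotent a ∧
      LinearIndependent K ![a.1 v, a.1 w]
  · obtain ⟨a, v, w, ha, hvw⟩ := hr
    by_cases hb : ∃ b : centre hf hn hd, IsNilpotent b ∧ ∀ k : K, b ≠ k • a
    · obtain ⟨b, hbnil, hb⟩ := hb
      exact .inr (deformsToSplitting_of_mul_eq_zero hloc h1 ha hbnil hb hvw)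
    · push Not at hb
      exact .inl (isMonogenicAt_of_isNilpotent hloc' .one a fun n _ hnil => hb n hnil)
  · push Not at hr
    exact .inl (isMonogenicAt_of_rank_le_one hloc' .one fun n _ hnil v w => hr n v w hnil)

end SquareZero

/-! ### Deformations of forms in at most four variables -/

section Classification

theorem IsMonogenicAt.deformsToSplitting {K : Type u} [Field K] [IsAlgClosed K] {r d : ℕ}
    {f : DPoly r K} {hf : f ∈ forms r K d} {hn : Nondegenerate f} {hd : 3 ≤ d} (hr : 0 < r)
    (h : IsMonogenicAt K (1 : centre hf hn hd)) :
    DeformsToSplitting d f (Module.finrank K (centre hf hn hd)) := by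
  obtain ⟨b, hb⟩ := h
  rw [finrank_eq_natDegree_minpoly (b := b) fun z => by simpa using hb z]
  have h1 : minpoly K b = minpoly K b.1 :=
    (minpoly.algHom_eq (centre hf hn hd).val Subtype.val_injective b).symm
  rw [h1]
  exact deformsToSplitting_natDegree_minpoly hr (by omega) hf hn b.2

/-- A nondegenerate form of degree at least three in at most four variables deforms to a form that
splits as often as the dimension of its centre allows. -/
theorem deformsToSplitting_finrank_centre {K : Type u} [Field K] [IsAlgClosed K] {r d : ℕ}
    {f : DPoly r K} (hf : f ∈ forms r K d) (hn : Nondegenerate f) (hd : 3 ≤ d) (hr : 0 < r)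
    (hr4 : r ≤ 4) : DeformsToSplitting d f (Module.finrank K (centre hf hn hd)) := by
  by_cases h : ∃ e : centre hf hn hd, IsIdempotentElem e ∧
      (∀ z, ∃ c : K, IsNilpotent (e * z - c • e)) ∧ 3 < Module.finrank K (LinearMap.range e.1)
  · obtain ⟨e, he, hloc, hrank⟩ := h
    have h1 : Module.finrank K (LinearMap.range e.1) ≤ r := by
      simpa using Submodule.finrank_le (LinearMap.range e.1)
    obtain rfl : r = 4 := by omega
    have h2 : LinearMap.range e.1 = ⊤ := by
      apply Submodule.eq_top_of_finrank_eq
      rw [Module.finrank_fin_fun]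
      omega
    have h3 : e = 1 := by
      refine Subtype.ext (LinearMap.ext fun v => ?_)
      obtain ⟨w, rfl⟩ := LinearMap.range_eq_top.1 h2 v
      exact LinearMap.congr_fun (congrArg Subtype.val he) w
    subst h3
    simp only [one_mul] at hloc
    exact (isMonogenicAt_one_or_deformsToSplitting hloc).elim (fun h => h.deformsToSplitting hr) id
  · push Not at h
    refine (isMonogenicAt_of_local (fun e he _ hloc => ?_) .one).deformsToSplitting hr
    exact isMonogenicAt_of_finrank_le_three hloc he (h e he hloc)

end Classification

end RegularSplitting

end

theorem mainTheorem9 {K : Type*} [Field K] [IsAlgClosed K] (r d : ℕ) (hr : r ≤ 4) (hd : 3 ≤ d)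
    (f : DPoly r K) (hf : f ∈ forms r K d) (hann : annDeg f 1 = ⊥) :
    ∃ n : ℕ, 1 ≤ n ∧ ∃ ft : DPoly r (MvPolynomial (Fin n) K),
      ft ∈ forms r (MvPolynomial (Fin n) K) d ∧
      specializeZero ft = f ∧
      HasRegularSplitting d (generic ft) (Module.finrank K (matrixSpace f)) := by
  have hn := nondegenerate_of_annDeg_eq_bot hann
  rcases Nat.eq_zero_or_pos r with rfl | hr0
  · -- Without variables there are no forms of positive degree, and the splitting is empty.
    have hzero : f = 0 := by
      refine Finsupp.ext fun α => ?_
      rw [mem_forms.1 hf α, Finsupp.zero_apply]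
      rw [Subsingleton.elim α 0, map_zero]
      omega
    refine ⟨1, le_rfl, 0, Submodule.zero_mem _, ?_, ?_⟩
    · rw [hzero]
      simp [specializeZero, mapCoeff]
    · rw [Module.finrank_zero_of_subsingleton]
      exact ⟨fun i => i.elim0, fun i => i.elim0, fun i => i.elim0, by simp [generic, mapCoeff],
        fun i => i.elim0⟩
  · rw [finrank_matrixSpace hf hn hd]
    exact (deformsToSplitting_finrank_centre hf hn hd hr0 hr).exists_family
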